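/- Let $G=(V,E)$ be an undirected graph on $n$ vertices with capacities $\mathrm{cap}:V\to\mathbb N$. A set $S\subseteq V$ is a capacitated dominating set if there is a function $f:V\setminus S\to S$ (a dominating function) such that $f(v)$ is a neighbour of $v$ for every $v\in V\setminus S$ and $|f^{-1}(w)|\le \mathrm{cap}(w)$ for every $w\in S$; $\mathrm{OPT}$ denotes the smallest size of such a set. For $U\subseteq V$, the Simplified Capacitated Dominating Set instance $(G,U,\mathrm{cap})$ asks for a smallest capacitated dominating set $S\supseteq U$ that has a dominating function $f$ with $|f^{-1}(w)|\le 1$ for all $w\in S\setminus U$. The scheme with bound $k$ is: for each $U\subseteq V$ with $|U|\le k$ solve the instance $(G,U,\mathrm{cap})$, and return a smallest set found. Theorem. Let $c\in(0,1/3)$ be a fixed real number. 1. Let $k(n)=\lfloor cn\rfloor$ for all $n$, or $k(n)=\lceil cn\rceil$ for all $n$. There is a program of a random access machine with logarithmic cost which, given $G$, $\mathrm{cap}$ and the integer $k(n)$, carries out the scheme with bound $k(n)$ (that is, it outputs a set that the scheme may return) in time $O^*\big(\binom{n}{k(n)}\big)$ and in polynomial space. If $c$ is rational, there is such a program that is given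 $G$ and $\mathrm{cap}$ only. Here the factor suppressed by $O^*$ and the space bound are polynomials in $n$ plus the total bit length of the capacities. Moreover $$O^*\Big(\tbinom{n}{k(n)}\Big)=O^*\Big(\big(1/(c^c(1-c)^{1-c})\big)^n\Big),$$ i.e. each of the two functions of $n$ is at most a polynomial in $n$ times the other. 2. Every set $S$ returned by the scheme with bound $\lceil cn\rceil$ satisfies $|S|\le\left(\frac1{4c}+c\right)\mathrm{OPT}$ if $c\le\frac14$, and $|S|\le(2-3c)\,\mathrm{OPT}$ if $c\ge\frac14$. (If $cn$ is an integer, this is the scheme that tries exactly the sets $U$ with $|U|\le cn$.) 3. For every $n$, every set $S$ returned by the scheme that tries exactly the sets $U$ with $|U|\le cn$, i.e. with bound $\lfloor cn\rfloor$, satisfies $|S|\le\left(\frac1{4c}+c\right)\mathrm{OPT}+\frac1c-2$ if $c\le\frac14$, and $|S|\le(2-3c)\,\mathrm{OPT}+\frac1c-2$ if $c\ge\frac14$. -/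

import Mathlib

/-! ## Capacitated domination -/

namespace CapDom

/-- A dominating function `f : V \ S → S` for the set `S`: `f v` is a neighbour of `v`, and every
`w ∈ S` has at most `cap w` preimages. -/
def IsDominatingFunction {V : Type*} (G : SimpleGraph V) (cap : V → ℕ) (S : Finset V)
    (f : {v : V // v ∉ S} → {v : V // v ∈ S}) : Prop :=
  (∀ v : {v : V // v ∉ S}, G.Adj v.1 (f v).1) ∧
    ∀ w : {v : V // v ∈ S}, (f ⁻¹' {w}).ncard ≤ cap w.1

/-- `S` is a capacitated dominating set. -/
def IsCapDominating {V : Type*} (G : SimpleGraph V) (cap : V → ℕ) (S : Finset V) : Prop :=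
  ∃ f, IsDominatingFunction G cap S f

/-- The smallest size of a capacitated dominating set (the whole vertex set is always one, see
`isCapDominating_univ`). -/
noncomputable def optimum {V : Type*} (G : SimpleGraph V) (cap : V → ℕ) : ℕ :=
  sInf {m : ℕ | ∃ S : Finset V, IsCapDominating G cap S ∧ S.card = m}

/-- `S` is a feasible solution of the Simplified Capacitated Dominating Set instance
`(G, U, cap)`: it contains `U` and has a dominating function under which every vertex outside `U`
has at most one preimage. -/
def IsSimplifiedSolution {V : Type*} (G : SimpleGraph V) (cap : V → ℕ) (U S : Finset V) : Prop :=
  U ⊆ S ∧ ∃ f, IsDominatingFunction G cap S f ∧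
    ∀ w : {v : V // v ∈ S}, (w : V) ∉ U → (f ⁻¹' {w}).ncard ≤ 1

/-- `S` is what the following scheme returns: for every `U` with `|U| ≤ k` solve the Simplified
Capacitated Dominating Set instance `(G, U, cap)`, and return the smallest set found.
(Ties are broken arbitrarily.) -/
def IsSchemeOutput {V : Type*} (G : SimpleGraph V) (cap : V → ℕ) (k : ℕ) (S : Finset V) : Prop :=
  (∃ U : Finset V, U.card ≤ k ∧ IsSimplifiedSolution G cap U S) ∧
    ∀ U T : Finset V, U.card ≤ k → IsSimplifiedSolution G cap U T → S.card ≤ T.card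

theorem isCapDominating_univ {V : Type*} [Fintype V] (G : SimpleGraph V) (cap : V → ℕ) :
    IsCapDominating G cap Finset.univ := by
  have : IsEmpty {v : V // v ∉ (Finset.univ : Finset V)} := ⟨fun v => v.2 (Finset.mem_univ v.1)⟩
  refine ⟨isEmptyElim, fun v => isEmptyElim v, fun w => ?_⟩
  rw [Set.eq_empty_of_isEmpty (_ ⁻¹' {w}), Set.ncard_empty]
  exact Nat.zero_le _

/-! ## The machine model: a random access machine with logarithmic cost

Memory consists of cells holding natural numbers.  A cell is addressed by the name `a` of an
array and an index `i`; array names occurring in a program are fixed, whereas indices are computed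
at run time.  All cells that are not part of the input are initially `0`. -/

/-- Memory contents: `m (a, i)` is the number in cell `i` of array `a`. -/
abbrev Mem : Type := ℕ × ℕ →₀ ℕ

/-- The number of bits in use: for each nonzero cell the bit lengths of its index and its
contents. -/
noncomputable def Mem.bits (m : Mem) : ℕ := m.sum fun x v => Nat.size x.2 + Nat.size v

/-- Arithmetic expressions (`sub` is truncated subtraction, `div` is integer division with
`x / 0 = 0`). -/
inductive Expr : Type
  | lit (x : ℕ) : Expr
  | get (a : ℕ) (i : Expr) : Expr
  | add (x y : Expr) : Expr
  | sub (x y : Expr) : Expr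
  | mul (x y : Expr) : Expr
  | div (x y : Expr) : Expr

/-- The value of an expression. -/
def Expr.eval (m : Mem) : Expr → ℕ
  | .lit x => x
  | .get a i => m (a, i.eval m)
  | .add x y => x.eval m + y.eval m
  | .sub x y => x.eval m - y.eval m
  | .mul x y => x.eval m * y.eval m
  | .div x y => x.eval m / y.eval m

/-- The logarithmic cost of evaluating an expression: every node of the expression contributes
one plus the bit length of its value.  (In particular the operands of every operation and the
index of every memory access are paid for by their bit lengths.) -/
def Expr.cost (m : Mem) : Expr → ℕ
  | .lit x => 1 + Nat.size x
  | .get a i => i.cost m + (1 + Nat.size (m (a, i.eval m)))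
  | .add x y => x.cost m + y.cost m + (1 + Nat.size (x.eval m + y.eval m))
  | .sub x y => x.cost m + y.cost m + (1 + Nat.size (x.eval m - y.eval m))
  | .mul x y => x.cost m + y.cost m + (1 + Nat.size (x.eval m * y.eval m))
  | .div x y => x.cost m + y.cost m + (1 + Nat.size (x.eval m / y.eval m))

/-- Programs.  Tests interpret a nonzero value as true. -/
inductive Prog : Type
  | nop : Prog
  | store (a : ℕ) (i x : Expr) : Prog
  | seq (p q : Prog) : Prog
  | ite (b : Expr) (p q : Prog) : Prog
  | loop (b : Expr) (p : Prog) : Prog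

/-- `Exec p m m' t s`: started in memory `m`, the program `p` halts in memory `m'` after time `t`,
and the largest number of bits in use at any moment is `s`.  The bits needed for the intermediate
values of the expressions being evaluated are included in `s`. -/
inductive Exec : Prog → Mem → Mem → ℕ → ℕ → Prop
  | nop (m : Mem) : Exec .nop m m 1 m.bits
  | store (a : ℕ) (i x : Expr) (m : Mem) :
      Exec (.store a i x) m (m.update (a, i.eval m) (x.eval m))
        (i.cost m + x.cost m + 1)
        (max (m.bits + i.cost m + x.cost m) (Mem.bits (m.update (a, i.eval m) (x.eval m))))
  | seq {p q : Prog} {m m₁ m₂ : Mem} {t₁ t₂ s₁ s₂ : ℕ} :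
      Exec p m m₁ t₁ s₁ → Exec q m₁ m₂ t₂ s₂ → Exec (.seq p q) m m₂ (t₁ + t₂) (max s₁ s₂)
  | ite_true {b : Expr} {p q : Prog} {m m₁ : Mem} {t s : ℕ} :
      b.eval m ≠ 0 → Exec p m m₁ t s →
      Exec (.ite b p q) m m₁ (b.cost m + 1 + t) (max (m.bits + b.cost m) s)
  | ite_false {b : Expr} {p q : Prog} {m m₁ : Mem} {t s : ℕ} :
      b.eval m = 0 → Exec q m m₁ t s →
      Exec (.ite b p q) m m₁ (b.cost m + 1 + t) (max (m.bits + b.cost m) s)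
  | loop_done {b : Expr} {p : Prog} {m : Mem} :
      b.eval m = 0 → Exec (.loop b p) m m (b.cost m + 1) (m.bits + b.cost m)
  | loop_step {b : Expr} {p : Prog} {m m₁ m₂ : Mem} {t₁ t₂ s₁ s₂ : ℕ} :
      b.eval m ≠ 0 → Exec p m m₁ t₁ s₁ → Exec (.loop b p) m₁ m₂ t₂ s₂ →
      Exec (.loop b p) m m₂ (b.cost m + 1 + t₁ + t₂) (max (m.bits + b.cost m) (max s₁ s₂))

/-! ## Inputs, outputs, resources -/

open Classical in
/-- The input memory: `n` in cell `0` of array `0`, the capacity of `v` in cell `v` of array `1`,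
the `(u, v)` entry of the adjacency matrix in cell `u * n + v` of array `2`. -/
noncomputable def inputMem {n : ℕ} (G : SimpleGraph (Fin n)) (cap : Fin n → ℕ) : Mem :=
  Finsupp.single (0, 0) n + ∑ v : Fin n, Finsupp.single (1, (v : ℕ)) (cap v) +
    ∑ u : Fin n, ∑ v : Fin n,
      Finsupp.single (2, (u : ℕ) * n + (v : ℕ)) (if G.Adj u v then 1 else 0)

/-- The same input, with the number `k` in addition, in cell `1` of array `0`. -/
noncomputable def inputMemWith {n : ℕ} (G : SimpleGraph (Fin n)) (cap : Fin n → ℕ) (k : ℕ) : Mem :=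
  inputMem G cap + Finsupp.single (0, 1) k

/-- The output `S` is read off as its characteristic vector in array `3`. -/
def HasOutput {n : ℕ} (m : Mem) (S : Finset (Fin n)) : Prop :=
  ∀ v : Fin n, m (3, (v : ℕ)) = if v ∈ S then 1 else 0

/-- The size of an instance: the number of vertices plus the bit lengths of the capacities. -/
def inputSize {n : ℕ} (cap : Fin n → ℕ) : ℕ := n + ∑ v : Fin n, Nat.size (cap v)

/-- The program `P`, started on the memory `inp G cap`, carries out the scheme with the bound
`k n` on `|U|` in time `O*(T n)` and in polynomial space; the suppressed factor of `O*` and the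
space bound are polynomials in the size of the instance. -/
def RunsScheme (P : Prog) (inp : {n : ℕ} → SimpleGraph (Fin n) → (Fin n → ℕ) → Mem)
    (k : ℕ → ℕ) (T : ℕ → ℕ) : Prop :=
  ∃ p : Polynomial ℕ, ∀ (n : ℕ) (G : SimpleGraph (Fin n)) (cap : Fin n → ℕ),
    ∃ (S : Finset (Fin n)) (m' : Mem) (t s : ℕ),
      Exec P (inp G cap) m' t s ∧ HasOutput m' S ∧ IsSchemeOutput G cap (k n) S ∧
      t ≤ p.eval (inputSize cap) * T n ∧ s ≤ p.eval (inputSize cap)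

/-- `O*(f) = O*(g)`: each of the two functions is at most a polynomial times the other one. -/
def OStarEq (f g : ℕ → ℝ) : Prop :=
  ∃ p : Polynomial ℕ, ∀ n : ℕ,
    f n ≤ (p.eval n : ℕ) * g n ∧ g n ≤ (p.eval n : ℕ) * f n

end CapDom

/-! The theorem rests on four separate arguments.

Solving one instance `(G, U, cap)` is a maximum matching problem. Replace `w ∈ U` by `min (cap w) n`
copies, keep one copy of every other vertex, and join copies of neighbours unless both lie in `U` or
both capacities vanish. A solution `S` yields a matching with `n - |S|` edges
(`IsSimplifiedSolution.exists_isMatch`). Conversely, every edge of a matching has an end outside `U`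
that can be declared dominated by the other end (`IsMatch.isSimplifiedSolution`, `IsMatch.card_le`).
So a maximum matching gives an optimal solution (`IsMatch.optimal`).

Maximum matchings are found by a search in the style of Edmonds that never contracts anything. For
each outer vertex `x` it stores a whole matching `X x` exposing `x` in place of the root, and for
each inner vertex `a` the set `W a` of its descendants. An edge from an outer vertex to an unreached
one augments the matching or extends the tree (`Search.grow`). An edge between outer vertices with
exactly one end in some `W a` makes `a` outer (`Search.merge`). When neither exists, the outer
vertices split into at least `|A| + 1` odd classes with no edges between them, which is the
Tutte–Berge obstruction (`Search.deficient`). The obstructions of successive failed searches add up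
(`Frozen.extend`) and bound from below the number of vertices exposed by any matching
(`Frozen.le_card`).

The sets `U` are visited as `n`-digit binary numbers with at most `k` ones. Deleting lowest ones
shows that the successor of `x` is the smallest multiple of some power of two above `x`
(`lt_pop_of_lt_cand`), so the enumeration has polynomial delay and handles at most `∑ i ≤ k,
n.choose i ≤ (n + 1) * n.choose k` sets. Resources are controlled by one parameter `B`, polynomial
in the input size: indices stay below `B` and contents below `2 ^ B`, so evaluating a fixed
expression costs `O(B)` and the memory takes `O(B ^ 2)` bits (`RunM`). The comparison of `n.choose
k` with the entropy function follows from the binomial distribution with parameter `c`: its mode has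
weight at least `1 / (n + 1)`, and `k` is within one of the mode (`one_le_mul_binomialWeight`,
`binomialWeight_mul_entropy`).

For the ratio, take an optimal solution of size `m` and let `p` be the number of its vertices with
at least two preimages. If `p ≤ k`, all of them fit into `U` and the scheme is optimal. Otherwise
put the `k` busiest into `U` and add to the solution all but one preimage of each of the others. By
averaging this costs at most `(p - k) (n - m - p) / p` extra vertices (`IsSchemeOutput.card_le`).
With `x = n / p ≥ 3`, `k ≥ c n` and `p ≤ m`, the relative loss is at most `(1 - c x) (x - 2)`. Its
maximum is at `x = (1 + 2 c) / (2 c)` if `c ≤ 1 / 4` and at `x = 3` if `c ≥ 1 / 4`, which produces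
the two constants. Rounding `c n` down adds at most `1 / c - 2`. -/

namespace CapDom

/-! ## A cost-aware program logic -/

/-- Weight bounding the bit length of the value of an expression. -/
def Expr.sz : Expr → ℕ
  | .lit x => Nat.size x
  | .get _ _ => 1
  | .add x y => x.sz + y.sz + 1
  | .sub x y => x.sz + y.sz
  | .mul x y => x.sz + y.sz
  | .div x y => x.sz + y.sz

/-- Weight bounding the cost of an expression. -/
def Expr.cw : Expr → ℕ
  | .lit x => 1 + Nat.size x
  | .get _ i => i.cw + 2
  | .add x y => x.cw + y.cw + (1 + (x.sz + y.sz + 1))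
  | .sub x y => x.cw + y.cw + (1 + (x.sz + y.sz))
  | .mul x y => x.cw + y.cw + (1 + (x.sz + y.sz))
  | .div x y => x.cw + y.cw + (1 + (x.sz + y.sz))

/-- Total weight of the expressions in a program. -/
def Prog.weight : Prog → ℕ
  | .nop => 0
  | .store _ i x => i.cw + x.cw
  | .seq p q => p.weight + q.weight
  | .ite b p q => b.cw + p.weight + q.weight
  | .loop b p => b.cw + p.weight

/-- All nonzero cells have a small array name, an index below `B` and a content below `2 ^ B`. -/
def Good (B : ℕ) (m : Mem) : Prop :=
  ∀ a i, m (a, i) ≠ 0 → a < 40 ∧ i < B ∧ m (a, i) < 2 ^ B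

theorem Good.lt {B : ℕ} {m : Mem} (h : Good B m) (a i : ℕ) : m (a, i) < 2 ^ B := by
  by_cases h0 : m (a, i) = 0
  · rw [h0]; positivity
  · exact (h a i h0).2.2

theorem size_add_le (x y : ℕ) : Nat.size (x + y) ≤ Nat.size x + Nat.size y + 1 := by
  rw [Nat.size_le]
  have hx := Nat.lt_size_self x
  have hy := Nat.lt_size_self y
  have h1 : 2 ^ Nat.size x ≤ 2 ^ (Nat.size x + Nat.size y) :=
    Nat.pow_le_pow_right (by simp) (by simp)
  have h2 : 2 ^ Nat.size y ≤ 2 ^ (Nat.size x + Nat.size y) :=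
    Nat.pow_le_pow_right (by simp) (by simp)
  rw [pow_succ]; omega

theorem size_mul_le (x y : ℕ) : Nat.size (x * y) ≤ Nat.size x + Nat.size y := by
  rw [Nat.size_le, pow_add]
  exact Nat.mul_lt_mul'' (Nat.lt_size_self x) (Nat.lt_size_self y)

theorem Expr.size_eval_le {B : ℕ} {m : Mem} (h : Good B m) (e : Expr) :
    Nat.size (e.eval m) ≤ e.sz * (B + 1) := by
  induction e with
  | lit x => simp only [eval, sz]; exact Nat.le_mul_of_pos_right _ (by simp)
  | get a i _ =>
    simp only [eval, sz]
    have := Nat.size_le.2 (h.lt a (i.eval m)); omega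
  | add x y hx hy =>
    simp only [eval, sz]; have := size_add_le (x.eval m) (y.eval m); nlinarith
  | sub x y hx hy =>
    simp only [eval, sz]
    have := Nat.size_le_size (Nat.sub_le (x.eval m) (y.eval m)); nlinarith
  | mul x y hx hy =>
    simp only [eval, sz]; have := size_mul_le (x.eval m) (y.eval m); nlinarith
  | div x y hx hy =>
    simp only [eval, sz]
    have := Nat.size_le_size (Nat.div_le_self (x.eval m) (y.eval m)); nlinarith

theorem Expr.cost_le {B : ℕ} {m : Mem} (h : Good B m) (e : Expr) :
    e.cost m ≤ e.cw * (B + 1) := by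
  induction e with
  | lit x => simp only [cost, cw]; exact Nat.le_mul_of_pos_right _ (by simp)
  | get a i hi =>
    simp only [cost, cw]
    have := Nat.size_le.2 (h.lt a (i.eval m)); nlinarith
  | add x y hx hy =>
    have := size_eval_le h (.add x y)
    simp only [eval, sz, cost, cw] at *; nlinarith
  | sub x y hx hy =>
    have := size_eval_le h (.sub x y)
    simp only [eval, sz, cost, cw] at *; nlinarith
  | mul x y hx hy =>
    have := size_eval_le h (.mul x y)
    simp only [eval, sz, cost, cw] at *; nlinarith
  | div x y hx hy =>
    have := size_eval_le h (.div x y)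
    simp only [eval, sz, cost, cw] at *; nlinarith

/-- At most 40 arrays have nonzero cells, at most `B` of them each, and the index and the content of
a cell take at most `B` bits apiece. -/
theorem Good.bits_le {B : ℕ} {m : Mem} (h : Good B m) : m.bits ≤ 80 * B ^ 2 := by
  unfold Mem.bits Finsupp.sum
  have hsub : m.support ⊆ Finset.range 40 ×ˢ Finset.range B := by
    rintro ⟨a, i⟩ hx
    have := h a i (by simpa using hx)
    simp only [Finset.mem_product, Finset.mem_range]; exact ⟨this.1, this.2.1⟩
  calc ∑ x ∈ m.support, (Nat.size x.2 + Nat.size (m x))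
      ≤ ∑ x ∈ m.support, 2 * B := by
        refine Finset.sum_le_sum fun x hx => ?_
        have h1 := h x.1 x.2 (by simpa using hx)
        have h2 := Nat.size_le.2 h1.2.2
        have h3 := Nat.size_le.2 (h1.2.1.trans B.lt_two_pow_self)
        have h4 : m x = m (x.1, x.2) := rfl
        rw [h4]; omega
    _ = m.support.card * (2 * B) := by simp
    _ ≤ (40 * B) * (2 * B) := by
        refine Nat.mul_le_mul_right _ ((Finset.card_le_card hsub).trans ?_)
        simp
    _ = 80 * B ^ 2 := by ring

theorem mem_update_apply (m : Mem) (x : ℕ × ℕ) (v : ℕ) (y : ℕ × ℕ) :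
    (m.update x v) y = if y = x then v else m y := by
  rw [Finsupp.coe_update, Function.update_apply]

theorem Good.update {B : ℕ} {m : Mem} (h : Good B m) {a i v : ℕ} (ha : a < 40) (hi : i < B)
    (hv : v < 2 ^ B) : Good B (m.update (a, i) v) := by
  intro b j
  rw [mem_update_apply]
  split_ifs with hb
  · simp only [Prod.mk.injEq] at hb
    intro _; exact ⟨hb.1 ▸ ha, hb.2 ▸ hi, hv⟩
  · exact h b j

/-- Started on `m`, the program halts in a memory satisfying `Q`, within time `T * (B + 1)` and
within the space bound determined by `B`. -/
def RunM (B : ℕ) (p : Prog) (T : ℕ) (m : Mem) (Q : Mem → Prop) : Prop :=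
  ∃ m' t s, Exec p m m' t s ∧ t ≤ T * (B + 1) ∧ s ≤ 80 * B ^ 2 + p.weight * (B + 1) ∧
    Good B m' ∧ Q m'

theorem RunM.mono {B : ℕ} {p : Prog} {T T' : ℕ} {m : Mem} {Q Q' : Mem → Prop}
    (h : RunM B p T m Q) (hT : T ≤ T') (hQ : ∀ m', Good B m' → Q m' → Q' m') :
    RunM B p T' m Q' := by
  obtain ⟨m', t, s, h1, h2, h3, h4, h5⟩ := h
  exact ⟨m', t, s, h1, h2.trans (Nat.mul_le_mul_right _ hT), h3, h4, hQ _ h4 h5⟩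

theorem RunM.nop {B : ℕ} {m : Mem} {Q : Mem → Prop} (h : Good B m) (hQ : Q m) :
    RunM B .nop 1 m Q :=
  ⟨m, 1, m.bits, .nop m, by omega, h.bits_le.trans (by omega), h, hQ⟩

theorem RunM.store {B : ℕ} {m : Mem} {Q : Mem → Prop} (h : Good B m) {a : ℕ} {i x : Expr}
    (ha : a < 40) (hi : i.eval m < B) (hx : x.eval m < 2 ^ B)
    (hQ : Q (m.update (a, i.eval m) (x.eval m))) :
    RunM B (.store a i x) (i.cw + x.cw + 1) m Q := by
  have h' := h.update ha hi hx
  have h1 := i.cost_le h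
  have h2 := x.cost_le h
  have h3 := h.bits_le
  have h4 := h'.bits_le
  refine ⟨_, _, _, .store a i x m, ?_, ?_, h', hQ⟩
  · nlinarith
  · simp only [Prog.weight, max_le_iff]
    constructor <;> nlinarith

/-- Times add up but memory does not: both programs keep the memory `Good B`, so the quadratic term
is shared and only the static weights of the expressions are added. -/
theorem RunM.seq {B : ℕ} {m : Mem} {Q : Mem → Prop} {p q : Prog} {T₁ T₂ : ℕ}
    (h : RunM B p T₁ m fun m' => RunM B q T₂ m' Q) : RunM B (.seq p q) (T₁ + T₂) m Q := by
  obtain ⟨m₁, t₁, s₁, h1, h2, h3, h4, m₂, t₂, s₂, h1', h2', h3', h4', h5⟩ := h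
  refine ⟨m₂, _, _, .seq h1 h1', by nlinarith, ?_, h4', h5⟩
  simp only [Prog.weight, max_le_iff]
  constructor <;> nlinarith

theorem RunM.ite {B : ℕ} {m : Mem} {Q : Mem → Prop} {b : Expr} {p q : Prog} {T : ℕ}
    (hg : Good B m) (h1 : b.eval m ≠ 0 → RunM B p T m Q) (h2 : b.eval m = 0 → RunM B q T m Q) :
    RunM B (.ite b p q) (b.cw + 1 + T) m Q := by
  have hb := b.cost_le hg
  have hB := hg.bits_le
  by_cases h : b.eval m = 0
  · obtain ⟨m', t, s, h3, h4, h5, h6, h7⟩ := h2 h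
    refine ⟨m', _, _, .ite_false h h3, by nlinarith, ?_, h6, h7⟩
    simp only [Prog.weight, max_le_iff]
    constructor <;> nlinarith
  · obtain ⟨m', t, s, h3, h4, h5, h6, h7⟩ := h1 h
    refine ⟨m', _, _, .ite_true h h3, by nlinarith, ?_, h6, h7⟩
    simp only [Prog.weight, max_le_iff]
    constructor <;> nlinarith

/-- The measure `μ` drops in every round, so `μ m` bounds the number of rounds. The space bound is
independent of that number because every intermediate memory is `Good B`. -/
theorem RunM.loop {B : ℕ} {b : Expr} {p : Prog} {T : ℕ} (I : Mem → Prop) (μ : Mem → ℕ)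
    (step : ∀ m, Good B m → I m → b.eval m ≠ 0 → RunM B p T m fun m' => I m' ∧ μ m' < μ m)
    {m : Mem} (hg : Good B m) (hI : I m) :
    RunM B (.loop b p) (μ m * (b.cw + 1 + T) + (b.cw + 1)) m fun m' => I m' ∧ b.eval m' = 0 := by
  induction hk : μ m using Nat.strong_induction_on generalizing m with
  | _ k ih =>
  have hb := b.cost_le hg
  have hB := hg.bits_le
  by_cases h : b.eval m = 0
  · refine ⟨m, _, _, .loop_done h, ?_, ?_, hg, hI, h⟩
    · have := Nat.zero_le (k * (b.cw + 1 + T) * (B + 1))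
      rw [add_mul]; nlinarith
    · simp only [Prog.weight]; nlinarith
  · obtain ⟨m₁, t₁, s₁, h1, h2, h3, h4, h5, h6⟩ := step m hg hI h
    obtain ⟨m₂, t₂, s₂, h1', h2', h3', h4', h5'⟩ := ih (μ m₁) (hk ▸ h6) h4 h5 rfl
    refine ⟨m₂, _, _, .loop_step h h1 h1', ?_, ?_, h4', h5'⟩
    · have h7 : μ m₁ + 1 ≤ k := by omega
      have h8 := Nat.mul_le_mul_right (b.cw + 1 + T) h7
      have h9 := Nat.mul_le_mul_right (B + 1) h8
      nlinarith
    · simp only [Prog.weight, max_le_iff] at *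
      refine ⟨by nlinarith, by nlinarith, h3'⟩

/-! ## Symbolic states -/

/-- The contents of all arrays, except for the two reserved arrays `4` and `5`. -/
abbrev State : Type := ℕ → ℕ → ℕ

/-- The state of a memory. -/
def view (m : Mem) : State := fun a i => if a = 4 ∨ a = 5 then 0 else m (a, i)

/-- The value of an expression in a state, `j` being the value of the counter in array `5`. -/
def Expr.val (σ : State) (j : ℕ) : Expr → ℕ
  | .lit x => x
  | .get a i => if a = 5 then j else σ a (i.val σ j)
  | .add x y => x.val σ j + y.val σ j
  | .sub x y => x.val σ j - y.val σ j
  | .mul x y => x.val σ j * y.val σ j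
  | .div x y => x.val σ j / y.val σ j

/-- The expression does not read array `4`, and reads array `5` only at index `0` and only if
`c` is true. -/
def Expr.ok (c : Bool) : Expr → Bool
  | .lit _ => true
  | .get a (.lit 0) => a != 4 && (a != 5 || c)
  | .get a i => a != 4 && a != 5 && i.ok c
  | .add x y => x.ok c && y.ok c
  | .sub x y => x.ok c && y.ok c
  | .mul x y => x.ok c && y.ok c
  | .div x y => x.ok c && y.ok c

/-- The scratch array `4` and the counter array `5` are hidden from states, so that specifications
mention program variables only. The syntactic test `ok` ensures that an expression reads nothing
hidden except, possibly, the counter. -/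
theorem Expr.eval_eq_val {e : Expr} {c : Bool} (h : e.ok c = true) {m : Mem} {j : ℕ}
    (hj : c = true → m (5, 0) = j) : e.eval m = e.val (view m) j := by
  induction e with
  | lit x => rfl
  | get a i hi =>
    by_cases h0 : i = .lit 0
    · subst h0
      simp only [ok, Bool.and_eq_true, bne_iff_ne, Bool.or_eq_true] at h
      simp only [eval, val, view]
      by_cases h5 : a = 5
      · subst h5; simp only [if_true]; exact hj (by simpa using h.2)
      · simp [h5, h.1]
    · have h' : (a ≠ 4 ∧ a ≠ 5) ∧ i.ok c = true := by
        rw [ok.eq_3 _ _ _ (by simpa using h0)] at h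
        simpa using h
      simp only [eval, val, view]
      simp [h'.1.1, h'.1.2, hi h'.2]
  | add x y hx hy | sub x y hx hy | mul x y hx hy | div x y hx hy =>
    simp only [ok, Bool.and_eq_true] at h
    simp only [eval, val, hx h.1, hy h.2]

theorem Expr.eval_closed {e : Expr} (h : e.ok false = true) (m : Mem) :
    e.eval m = e.val (view m) 0 := eval_eq_val h (by simp)

/-- Started in the state `σ`, the program halts in a state satisfying `Q`, within time
`T * (B + 1)` and within the space bound determined by `B`. -/
def Run (B : ℕ) (p : Prog) (T : ℕ) (σ : State) (Q : State → Prop) : Prop :=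
  ∀ m, Good B m → view m = σ → RunM B p T m fun m' => Q (view m')

/-- Array names, indices and contents are within bounds. -/
def GoodS (B : ℕ) (σ : State) : Prop := ∀ a i, σ a i < 2 ^ B

theorem Good.view {B : ℕ} {m : Mem} (h : Good B m) : GoodS B (view m) := by
  intro a i
  unfold CapDom.view
  split_ifs
  · positivity
  · exact h.lt a i

theorem Run.mono {B : ℕ} {p : Prog} {T T' : ℕ} {σ : State} {Q Q' : State → Prop}
    (h : Run B p T σ Q) (hT : T ≤ T') (hQ : ∀ σ', GoodS B σ' → Q σ' → Q' σ') :
    Run B p T' σ Q' := fun m hg hm => (h m hg hm).mono hT fun _ hg h => hQ _ hg.view h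

theorem Run.good {B : ℕ} {p : Prog} {T : ℕ} {σ : State} {Q : State → Prop}
    (h : GoodS B σ → Run B p T σ Q) : Run B p T σ Q :=
  fun m hg hm => h (hm ▸ hg.view) m hg hm

theorem Run.nop {B : ℕ} {σ : State} {Q : State → Prop} (hQ : Q σ) : Run B .nop 1 σ Q :=
  fun _ hg hm => RunM.nop hg (hm ▸ hQ)

theorem Run.seq {B : ℕ} {p q : Prog} {T₁ T₂ : ℕ} {σ : State} {Q R : State → Prop}
    (h : Run B p T₁ σ R) (h' : ∀ σ', GoodS B σ' → R σ' → Run B q T₂ σ' Q) :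
    Run B (.seq p q) (T₁ + T₂) σ Q := fun m hg hm =>
  RunM.seq ((h m hg hm).mono le_rfl fun m' hg' hR => h' _ hg'.view hR m' hg' rfl)

theorem Run.ite {B : ℕ} {σ : State} {Q : State → Prop} {b : Expr} {p q : Prog} {T : ℕ}
    (hb : b.ok false = true) (h1 : b.val σ 0 ≠ 0 → Run B p T σ Q)
    (h2 : b.val σ 0 = 0 → Run B q T σ Q) : Run B (.ite b p q) (b.cw + 1 + T) σ Q :=
  fun m hg hm => RunM.ite hg
    (fun h => h1 (by rwa [Expr.eval_closed hb, hm] at h) m hg hm)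
    (fun h => h2 (by rwa [Expr.eval_closed hb, hm] at h) m hg hm)

theorem Run.loop {B : ℕ} {b : Expr} {p : Prog} {T : ℕ} (hb : b.ok false = true)
    (I : State → Prop) (μ : State → ℕ)
    (step : ∀ σ, GoodS B σ → I σ → b.val σ 0 ≠ 0 → Run B p T σ fun σ' => I σ' ∧ μ σ' < μ σ)
    {σ : State} (hI : I σ) {K : ℕ} (hK : μ σ ≤ K) :
    Run B (.loop b p) (K * (b.cw + 1 + T) + (b.cw + 1)) σ fun σ' => I σ' ∧ b.val σ' 0 = 0 := by
  intro m hg hm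
  refine (RunM.loop (fun m => I (view m)) (fun m => μ (view m)) (fun m hg hI h => ?_) hg
    (hm ▸ hI)).mono (T := μ (view m) * (b.cw + 1 + T) + (b.cw + 1)) ?_ fun m' hg' h => ?_
  · exact step _ hg.view hI (by rwa [Expr.eval_closed hb] at h) m hg rfl
  · rw [hm]; gcongr
  · rwa [Expr.eval_closed hb] at h

/-- Replace the first `L` entries of array `a`. -/
def State.set (σ : State) (a L : ℕ) (g : ℕ → ℕ) : State :=
  fun b j => if b = a then (if j < L then g j else σ b j) else σ b j

/-- A scalar assignment. -/
abbrev Prog.put (a : ℕ) (e : Expr) : Prog := .store a (.lit 0) e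

theorem view_update {m : Mem} {a i v : ℕ} (h4 : a ≠ 4) (h5 : a ≠ 5) :
    view (m.update (a, i) v) = fun b j => if b = a ∧ j = i then v else view m b j := by
  funext b j
  simp only [view, mem_update_apply, Prod.mk.injEq]
  by_cases h : b = a ∧ j = i
  · obtain ⟨rfl, rfl⟩ := h; simp [h4, h5]
  · simp [h]

theorem view_update_counter {m : Mem} {i v : ℕ} : view (m.update (5, i) v) = view m := by
  funext b j
  simp only [view, mem_update_apply, Prod.mk.injEq]
  by_cases h : b = 5
  · simp [h]
  · simp [h]

theorem Run.put {B : ℕ} {σ : State} {Q : State → Prop} {a : ℕ} {e : Expr}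
    (ha : a < 40 ∧ a ≠ 4 ∧ a ≠ 5) (he : e.ok false = true) (hB : 0 < B)
    (hv : e.val σ 0 < 2 ^ B) (hQ : Q (σ.set a 1 fun _ => e.val σ 0)) :
    Run B (.put a e) (1 + e.cw + 1) σ Q := by
  intro m hg hm
  have h := Expr.eval_closed he m
  rw [hm] at h
  refine RunM.store hg ha.1 hB (h ▸ hv) ?_
  rw [view_update ha.2.1 ha.2.2, h, hm]
  convert hQ using 1
  funext b j
  simp only [State.set, Expr.eval, Nat.lt_one_iff]
  by_cases h1 : b = a <;> by_cases h2 : j = 0 <;> simp [h1, h2]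

/-! ### Counted loops, array assignments and folds -/

/-- Repeat `body` for the counter running from `0` to `bnd - 1`. -/
def Prog.for (bnd : Expr) (body : Prog) : Prog :=
  .seq (.store 5 (.lit 0) (.lit 0)) (.loop (.sub bnd (.get 5 (.lit 0)))
    (.seq body (.store 5 (.lit 0) (.add (.get 5 (.lit 0)) (.lit 1)))))

/-- Time bound for `L` iterations of a loop. -/
def forTime (bnd : Expr) (T L : ℕ) : ℕ :=
  ((Expr.lit 0).cw + (Expr.lit 0).cw + 1) +
    (L * ((Expr.sub bnd (.get 5 (.lit 0))).cw + 1 +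
      (T + ((Expr.lit 0).cw + (Expr.add (.get 5 (.lit 0)) (.lit 1)).cw + 1))) +
      ((Expr.sub bnd (.get 5 (.lit 0))).cw + 1))

/-- The invariant `I i` refers to the memory after the counter has been set to `i`, hence the
updates in the hypotheses. One counter cell is enough because loops of this kind are never nested:
matrices are traversed by a single index that is split by division with remainder. -/
theorem RunM.for {B : ℕ} {bnd : Expr} {body : Prog} {T L : ℕ} (hL : L ≤ B) (hB : 0 < B)
    (I : ℕ → Mem → Prop)
    (hbnd : ∀ i m, I i m → bnd.eval m = L)
    (step : ∀ i m, i < L → Good B m → I i m → m (5, 0) = i →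
      RunM B body T m fun m' => m' (5, 0) = i ∧ I (i + 1) (m'.update (5, 0) (i + 1)))
    {m : Mem} (hg : Good B m) (hI : I 0 (m.update (5, 0) 0)) :
    RunM B (.for bnd body) (forTime bnd T L) m (I L) := by
  have hLB : L < 2 ^ B := hL.trans_lt B.lt_two_pow_self
  have h0 : (0 : ℕ) < 2 ^ B := by positivity
  refine RunM.seq (RunM.store hg (by simp) hB h0 ?_)
  have hg' : Good B (m.update (5, 0) 0) := hg.update (by simp) hB h0
  refine (RunM.loop (T := T + ((Expr.lit 0).cw + (Expr.add (.get 5 (.lit 0)) (.lit 1)).cw + 1))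
    (fun m => ∃ i ≤ L, m (5, 0) = i ∧ I i m)
    (fun m => L - m (5, 0)) ?_ hg' ⟨0, by simp, by simp, hI⟩).mono ?_ ?_
  · rintro m hg ⟨i, hi, h5, hI⟩ hb
    simp only [Expr.eval, hbnd i m hI, h5] at hb
    have hi' : i < L := by omega
    have := (step i m hi' hg hI h5)
    refine RunM.seq (this.mono le_rfl fun m' hg' ⟨h5', hI'⟩ => ?_)
    have e1 : (Expr.add (.get 5 (.lit 0)) (.lit 1)).eval m' = i + 1 := by simp [Expr.eval, h5']
    refine RunM.store hg' (by simp) hB (by rw [e1]; omega) ?_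
    rw [e1]
    simp only [Expr.eval]
    refine ⟨⟨i + 1, hi', ?_, hI'⟩, ?_⟩
    · simp
    · simp [h5]; omega
  · simp
  · rintro m' hg' ⟨⟨i, hi, h5, hI⟩, hb⟩
    simp only [Expr.eval, hbnd i m' hI, h5] at hb
    have : i = L := by omega
    exact this ▸ hI

/-- `a[i] := e` for all `i < bnd`, evaluated sequentially. -/
def Prog.fill (a : ℕ) (bnd e : Expr) : Prog := .for bnd (.store a (.get 5 (.lit 0)) e)

/-- Time bound for `Prog.fill`. -/
def fillTime (bnd e : Expr) (L : ℕ) : ℕ := forTime bnd ((Expr.get 5 (.lit 0)).cw + e.cw + 1) L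

theorem RunM.fill {B : ℕ} {a : ℕ} {bnd e : Expr} {L : ℕ} {g : ℕ → ℕ} (hL : L ≤ B) (hB : 0 < B)
    (ha : a < 40) (ha5 : a ≠ 5) {m : Mem} (hg : Good B m)
    (hbnd : ∀ m' : Mem, (∀ b j, b ≠ a → b ≠ 5 → m' (b, j) = m (b, j)) → bnd.eval m' = L)
    (he : ∀ (m' : Mem) (i : ℕ), i < L → (∀ b j, b ≠ a → b ≠ 5 → m' (b, j) = m (b, j)) →
      m' (5, 0) = i → e.eval m' = g i)
    (hv : ∀ i < L, g i < 2 ^ B) :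
    RunM B (.fill a bnd e) (fillTime bnd e L) m fun m' =>
      (∀ i, m' (a, i) = if i < L then g i else m (a, i)) ∧
      ∀ b j, b ≠ a → b ≠ 5 → m' (b, j) = m (b, j) := by
  refine RunM.for hL hB (fun k m' => (∀ i, m' (a, i) = if i < k then g i else m (a, i)) ∧
      ∀ b j, b ≠ a → b ≠ 5 → m' (b, j) = m (b, j)) (fun i m' h => hbnd m' h.2) ?_ hg ?_
  · rintro i m' hi hg' ⟨h1, h2⟩ h5
    have hv' := he m' i hi h2 h5
    have hi' : (Expr.get 5 (.lit 0)).eval m' = i := by simp [Expr.eval, h5]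
    refine RunM.store hg' ha (by omega) (hv' ▸ hv i hi) ?_
    rw [hi', hv']
    refine ⟨?_, fun j => ?_, fun b j hb hb5 => ?_⟩
    · simp [mem_update_apply, Ne.symm ha5, h5]
    · simp only [mem_update_apply, Prod.mk.injEq, ha5, false_and, if_false, true_and, h1]
      by_cases hj : j = i
      · simp [hj]
      · have : j < i + 1 ↔ j < i := by omega
        simp [hj, this]
    · simp [mem_update_apply, hb, hb5, h2 b j hb hb5]
  · refine ⟨fun i => by simp [mem_update_apply, ha5], fun b j hb hb5 => ?_⟩
    simp [mem_update_apply, hb5]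

/-- `a[i] := e` for all `i < bnd`, evaluated simultaneously. -/
def Prog.assign (a : ℕ) (bnd e : Expr) : Prog :=
  .seq (.fill 4 bnd e) (.fill a bnd (.get 4 (.get 5 (.lit 0))))

/-- Time bound for `Prog.assign`. -/
def assignTime (bnd e : Expr) (L : ℕ) : ℕ :=
  fillTime bnd e L + fillTime bnd (.get 4 (.get 5 (.lit 0))) L

/-- The expression does not read array `a`. -/
def Expr.avoids (a : ℕ) : Expr → Bool
  | .lit _ => true
  | .get b i => b != a && i.avoids a
  | .add x y => x.avoids a && y.avoids a
  | .sub x y => x.avoids a && y.avoids a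
  | .mul x y => x.avoids a && y.avoids a
  | .div x y => x.avoids a && y.avoids a

theorem Expr.val_congr_of_avoids {a : ℕ} {e : Expr} (h : e.avoids a = true) {σ σ' : State} {j : ℕ}
    (hσ : ∀ b, b ≠ a → σ b = σ' b) : e.val σ j = e.val σ' j := by
  induction e with
  | lit x => rfl
  | get b i hi =>
    simp only [avoids, Bool.and_eq_true, bne_iff_ne] at h
    simp only [val, hi h.2, hσ b h.1]
  | add x y hx hy | sub x y hx hy | mul x y hx hy | div x y hx hy =>
    simp only [avoids, Bool.and_eq_true] at h
    simp only [val, hx h.1, hy h.2]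

theorem view_eq_of_agree {m m' : Mem} {a : ℕ} (h : ∀ b j, b ≠ a → b ≠ 5 → m' (b, j) = m (b, j)) :
    ∀ b, b ≠ a → view m' b = view m b := by
  intro b hb
  funext j
  unfold view
  split_ifs with h'
  · rfl
  · exact h b j hb (by tauto)

/-- The new entries are first collected in the scratch array, so `e` may read the old contents of
`a`. The bound must avoid `a` because it is evaluated again while `a` is being overwritten. -/
theorem Run.assign {B : ℕ} {σ : State} {Q : State → Prop} {a : ℕ} {bnd e : Expr} {L : ℕ}
    (hL : bnd.val σ 0 = L) (hLB : L ≤ B) (hB : 0 < B) (ha : a < 40 ∧ a ≠ 4 ∧ a ≠ 5)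
    (hb : bnd.ok false = true) (hba : bnd.avoids a = true) (he : e.ok true = true)
    (hv : ∀ i < L, e.val σ i < 2 ^ B)
    (hQ : Q (σ.set a L fun i => e.val σ i)) :
    Run B (.assign a bnd e) (assignTime bnd e L) σ Q := by
  intro m hg hm
  subst hm
  refine RunM.seq ((RunM.fill (g := fun i => e.val (view m) i) hLB hB (by simp) (by simp) hg
    (fun m' h => ?_) (fun m' i hi h h5 => ?_) hv).mono le_rfl ?_)
  · rw [Expr.eval_closed hb, ← hL]
    congr 1
    funext b
    by_cases h4 : b = 4
    · subst h4; funext j; simp [view]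
    · exact view_eq_of_agree h b h4
  · rw [Expr.eval_eq_val he (fun _ => h5)]
    congr 1
    funext b
    by_cases h4 : b = 4
    · subst h4; funext j; simp [view]
    · exact view_eq_of_agree h b h4
  · rintro m₁ hg₁ ⟨h4, h₁⟩
    refine ((RunM.fill (g := fun i => e.val (view m) i) hLB hB ha.1 ha.2.2 hg₁
      (fun m' h => ?_) (fun m' i hi h h5 => ?_) hv).mono le_rfl ?_)
    · rw [Expr.eval_closed hb, ← hL]
      refine Expr.val_congr_of_avoids hba fun b hb => ?_
      rw [view_eq_of_agree h b hb]
      by_cases hb4 : b = 4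
      · subst hb4; funext j; simp [view]
      · exact view_eq_of_agree h₁ b hb4
    · simp only [Expr.eval, h5]
      rw [h 4 i ha.2.1.symm (by simp), h4, if_pos hi]
    · rintro m₂ - ⟨h5, h6⟩
      convert hQ using 1
      funext b j
      simp only [State.set]
      by_cases hba : b = a
      · subst hba
        simp only [if_true]
        simp only [view, ha.2.1, ha.2.2, or_self, if_false, h5]
        split_ifs
        · rfl
        · exact h₁ _ _ ha.2.1 ha.2.2
      · simp only [if_neg hba]
        rw [view_eq_of_agree h6 b hba]
        by_cases hb4 : b = 4
        · subst hb4; simp [view]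
        · rw [view_eq_of_agree h₁ b hb4]

/-- Accumulate `e` into the scalar `s`, which starts with `0`. -/
def Prog.fold (s : ℕ) (bnd e : Expr) : Prog :=
  .seq (.put s (.lit 0)) (.for bnd (.put s e))

/-- Time bound for `Prog.fold`. -/
def foldTime (bnd e : Expr) (L : ℕ) : ℕ :=
  (1 + (Expr.lit 0).cw + 1) + forTime bnd (1 + e.cw + 1) L

theorem Run.fold {B : ℕ} {σ : State} {Q : State → Prop} {s : ℕ} {bnd e : Expr} {L : ℕ}
    (hL : bnd.val σ 0 = L) (hLB : L ≤ B) (hB : 0 < B) (hs : s < 40 ∧ s ≠ 4 ∧ s ≠ 5)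
    (hb : bnd.ok false = true) (hbs : bnd.avoids s = true) (he : e.ok true = true)
    (I : ℕ → ℕ → Prop) (h0 : I 0 0)
    (hI : ∀ i v, i < L → I i v → e.val (σ.set s 1 fun _ => v) i < 2 ^ B ∧
      I (i + 1) (e.val (σ.set s 1 fun _ => v) i))
    (hQ : ∀ v, I L v → Q (σ.set s 1 fun _ => v)) :
    Run B (.fold s bnd e) (foldTime bnd e L) σ Q := by
  refine Run.seq (R := fun σ' => σ' = σ.set s 1 fun _ => 0) (Run.put hs (by rfl) hB ?_ ?_) ?_
  · simp only [Expr.val]; positivity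
  · simp [Expr.val]
  rintro _ - rfl m hg hm
  refine (RunM.for hLB hB (fun i m' => ∃ v, I i v ∧ view m' = σ.set s 1 fun _ => v) ?_ ?_ hg
    ⟨0, h0, by rw [view_update_counter, hm]⟩).mono le_rfl ?_
  · rintro i m' ⟨v, -, h⟩
    rw [Expr.eval_closed hb, h, ← hL]
    refine Expr.val_congr_of_avoids hbs fun b hb => ?_
    funext j; simp [State.set, hb]
  · rintro i m' hi hg' ⟨v, hv, h⟩ h5
    obtain ⟨h1, h2⟩ := hI i v hi hv
    have h3 : e.eval m' = e.val (σ.set s 1 fun _ => v) i := by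
      rw [Expr.eval_eq_val he (fun _ => h5), h]
    refine RunM.store hg' hs.1 hB (h3 ▸ h1) ?_
    rw [h3]
    refine ⟨by simp [mem_update_apply, Ne.symm hs.2.2, h5], _, h2, ?_⟩
    rw [view_update_counter, view_update hs.2.1 hs.2.2, h]
    funext b j
    simp only [State.set, Expr.eval, Nat.lt_one_iff]
    by_cases hb : b = s <;> by_cases hj : j = 0 <;> simp [hb, hj]
  · rintro m' - ⟨v, hv, h⟩
    exact h ▸ hQ v hv

/-! ## Derived expressions -/

namespace Expr

/-- Truth of an expression. -/
def tt (σ : State) (j : ℕ) (e : Expr) : Prop := e.val σ j ≠ 0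

/-- The loop counter. -/
abbrev ctr : Expr := .get 5 (.lit 0)
/-- A scalar variable. -/
abbrev var (a : ℕ) : Expr := .get a (.lit 0)
/-- Remainder. -/
def mod (x y : Expr) : Expr := .sub x (.mul (.div x y) y)
/-- Strict comparison. -/
def lt (x y : Expr) : Expr := .sub y x
/-- Equality. -/
def eq (x y : Expr) : Expr := .sub (.lit 1) (.add (.sub x y) (.sub y x))
/-- Negation. -/
def not (x : Expr) : Expr := .sub (.lit 1) x
/-- Conjunction. -/
def and (x y : Expr) : Expr := .mul x y
/-- Disjunction. -/
def or (x y : Expr) : Expr := .add x y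
/-- Equivalence. -/
def iff (x y : Expr) : Expr := or (and x y) (and (not x) (not y))
/-- Conditional expression. -/
def cond (b x y : Expr) : Expr := .add (.mul (not (not b)) x) (.mul (not b) y)

variable {σ : State} {j : ℕ} {x y b : Expr}

theorem val_lit {n : ℕ} : (Expr.lit n).val σ j = n := rfl
theorem val_ctr : ctr.val σ j = j := rfl
theorem val_var {a : ℕ} (ha : a ≠ 5) : (var a).val σ j = σ a 0 := by simp [val, ha]
theorem val_get {a : ℕ} (ha : a ≠ 5) : (Expr.get a x).val σ j = σ a (x.val σ j) := by
  simp [val, ha]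
theorem val_add : (Expr.add x y).val σ j = x.val σ j + y.val σ j := rfl
theorem val_sub : (Expr.sub x y).val σ j = x.val σ j - y.val σ j := rfl
theorem val_mul : (Expr.mul x y).val σ j = x.val σ j * y.val σ j := rfl
theorem val_div : (Expr.div x y).val σ j = x.val σ j / y.val σ j := rfl
theorem val_mod : (mod x y).val σ j = x.val σ j % y.val σ j := by
  simp only [mod, val]
  rw [mul_comm]; exact (Nat.mod_eq_sub_mul_div).symm
theorem tt_lt : (lt x y).tt σ j ↔ x.val σ j < y.val σ j := by
  simp only [tt, lt, val]; omega
theorem tt_eq : (eq x y).tt σ j ↔ x.val σ j = y.val σ j := by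
  simp only [tt, eq, val]; omega
theorem tt_not : (not x).tt σ j ↔ ¬ x.tt σ j := by
  simp only [tt, not, val]; omega
theorem tt_and : (and x y).tt σ j ↔ x.tt σ j ∧ y.tt σ j := by
  simp only [tt, and, val]; exact mul_ne_zero_iff
theorem tt_or : (or x y).tt σ j ↔ x.tt σ j ∨ y.tt σ j := by
  simp only [tt, or, val]; omega
theorem tt_iff : (iff x y).tt σ j ↔ (x.tt σ j ↔ y.tt σ j) := by
  simp only [iff, tt_or, tt_and, tt_not]; tauto
theorem tt_get {a : ℕ} (ha : a ≠ 5) : (Expr.get a x).tt σ j ↔ σ a (x.val σ j) ≠ 0 := by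
  simp [tt, val, ha]
open Classical in
theorem val_cond : (cond b x y).val σ j = if b.tt σ j then x.val σ j else y.val σ j := by
  -- `not (not b)` is the truth value of `b` as `0` or `1`, so exactly one of the two products
  -- survives.
  simp only [cond, not, val, tt]
  split_ifs with h
  · have : 1 - b.val σ j = 0 := by omega
    simp [this, h]
  · have : b.val σ j = 0 := by omega
    simp [this]

end Expr

/-- Search for an index below `bnd` for which `e` is true; the scalar `s` receives the index plus
one, or zero if there is none. -/
def Prog.find (s : ℕ) (bnd e : Expr) : Prog :=
  .fold s bnd (.cond e (.add .ctr (.lit 1)) (.var s))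

/-- Time bound for `Prog.find`. -/
def findTime (s : ℕ) (bnd e : Expr) (L : ℕ) : ℕ :=
  foldTime bnd (.cond e (.add .ctr (.lit 1)) (.var s)) L

theorem State.set_of_ne {σ : State} {a b L : ℕ} {g : ℕ → ℕ} (h : b ≠ a) : σ.set a L g b = σ b := by
  funext j; simp [State.set, h]

theorem Run.find {B : ℕ} {σ : State} {Q : State → Prop} {s : ℕ} {bnd e : Expr} {L : ℕ}
    (hL : bnd.val σ 0 = L) (hLB : L ≤ B) (hB : 0 < B) (hs : s < 40 ∧ s ≠ 4 ∧ s ≠ 5)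
    (hb : bnd.ok false = true) (hbs : bnd.avoids s = true)
    (he : (Expr.cond e (.add .ctr (.lit 1)) (.var s)).ok true = true) (hes : e.avoids s = true)
    (h0 : (∀ i < L, ¬ e.tt σ i) → Q (σ.set s 1 fun _ => 0))
    (h1 : ∀ i < L, e.tt σ i → Q (σ.set s 1 fun _ => i + 1)) :
    Run B (.find s bnd e) (findTime s bnd e L) σ Q := by
  refine Run.fold hL hLB hB hs hb hbs he
    -- The scalar holds the latest hit, shifted by one so that zero can mean that there was none.
    (fun k v => (v = 0 ∧ ∀ i < k, ¬ e.tt σ i) ∨ ∃ i < k, v = i + 1 ∧ e.tt σ i) (Or.inl (by simp))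
    ?_ ?_
  · intro i v hi hv
    have h2 : e.tt (σ.set s 1 fun _ => v) i ↔ e.tt σ i := by
      unfold Expr.tt
      rw [Expr.val_congr_of_avoids hes fun b hb => State.set_of_ne hb]
    have h3 : (σ.set s 1 fun _ => v) s 0 = v := by simp [State.set]
    rw [Expr.val_cond, Expr.val_var hs.2.2, h3, Expr.val_add, Expr.val_ctr, Expr.val_lit]
    have hB2 : B < 2 ^ B := B.lt_two_pow_self
    by_cases h : e.tt σ i
    · rw [if_pos (h2.2 h)]
      exact ⟨by omega, Or.inr ⟨i, by omega, rfl, h⟩⟩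
    · rw [if_neg (h2.not.2 h)]
      rcases hv with ⟨rfl, hv⟩ | ⟨i', hi', rfl, hv⟩
      · refine ⟨by omega, Or.inl ⟨rfl, fun i' hi' => ?_⟩⟩
        rcases Nat.lt_succ_iff_lt_or_eq.1 hi' with h' | rfl
        exacts [hv _ h', h]
      · exact ⟨by omega, Or.inr ⟨i', by omega, rfl, hv⟩⟩
  · rintro v (⟨rfl, hv⟩ | ⟨i, hi, rfl, hv⟩)
    exacts [h0 hv, h1 i hi hv]

/-- The scalar `s` receives the sum of `e` over the indices below `bnd`. -/
def Prog.sum (s : ℕ) (bnd e : Expr) : Prog := .fold s bnd (.add (.var s) e)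

/-- Time bound for `Prog.sum`. -/
def sumTime (s : ℕ) (bnd e : Expr) (L : ℕ) : ℕ := foldTime bnd (.add (.var s) e) L

theorem Run.sum {B : ℕ} {σ : State} {Q : State → Prop} {s : ℕ} {bnd e : Expr} {L : ℕ}
    (hL : bnd.val σ 0 = L) (hLB : L ≤ B) (hB : 0 < B) (hs : s < 40 ∧ s ≠ 4 ∧ s ≠ 5)
    (hb : bnd.ok false = true) (hbs : bnd.avoids s = true)
    (he : (Expr.add (.var s) e).ok true = true) (hes : e.avoids s = true)
    (hv : ∑ i ∈ Finset.range L, e.val σ i < 2 ^ B)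
    (hQ : Q (σ.set s 1 fun _ => ∑ i ∈ Finset.range L, e.val σ i)) :
    Run B (.sum s bnd e) (sumTime s bnd e L) σ Q := by
  refine Run.fold hL hLB hB hs hb hbs he (fun k v => v = ∑ i ∈ Finset.range k, e.val σ i)
    (by simp) ?_ (by rintro v rfl; exact hQ)
  rintro i v hi rfl
  have h3 : ∀ v, (σ.set s 1 fun _ => v) s 0 = v := by simp [State.set]
  rw [Expr.val_add, Expr.val_var hs.2.2, h3,
    Expr.val_congr_of_avoids hes fun b hb => State.set_of_ne hb, ← Finset.sum_range_succ]
  refine ⟨lt_of_le_of_lt (Finset.sum_le_sum_of_subset ?_) hv, rfl⟩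
  intro k; simp only [Finset.mem_range]; omega

/-- `Run.assign`, with a description `g` of the new entries. -/
theorem Run.assign_to {B : ℕ} {σ : State} {Q : State → Prop} {a : ℕ} {bnd e : Expr} {L : ℕ}
    (g : ℕ → ℕ) (hL : bnd.val σ 0 = L) (hLB : L ≤ B) (hB : 0 < B) (ha : a < 40 ∧ a ≠ 4 ∧ a ≠ 5)
    (hb : bnd.ok false = true) (hba : bnd.avoids a = true) (he : e.ok true = true)
    (hv : ∀ i < L, e.val σ i < 2 ^ B) (hg : ∀ i < L, e.val σ i = g i)
    (hQ : GoodS B (σ.set a L g) → Q (σ.set a L g)) :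
    Run B (.assign a bnd e) (assignTime bnd e L) σ Q := by
  have h : (σ.set a L fun i => e.val σ i) = σ.set a L g := by
    funext b j
    simp only [State.set]
    split_ifs with h1 h2
    exacts [hg j h2, rfl, rfl]
  refine (Run.assign (Q := fun σ' => σ' = σ.set a L g) hL hLB hB ha hb hba he hv h).mono le_rfl ?_
  rintro _ hg' rfl
  exact hQ hg'

/-- An assignment followed by another program. -/
theorem Run.assign_then {B : ℕ} {σ : State} {Q : State → Prop} {a : ℕ} {bnd e : Expr} {L T : ℕ}
    {q : Prog} (g : ℕ → ℕ) (hL : bnd.val σ 0 = L) (hLB : L ≤ B) (hB : 0 < B)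
    (ha : a < 40 ∧ a ≠ 4 ∧ a ≠ 5)
    (hb : bnd.ok false = true) (hba : bnd.avoids a = true) (he : e.ok true = true)
    (hv : ∀ i < L, e.val σ i < 2 ^ B) (hg : ∀ i < L, e.val σ i = g i)
    (hQ : GoodS B (σ.set a L g) → Run B q T (σ.set a L g) Q) :
    Run B (.seq (.assign a bnd e) q) (assignTime bnd e L + T) σ Q :=
  Run.seq (R := fun σ' => σ' = σ.set a L g)
    (Run.assign_to g hL hLB hB ha hb hba he hv hg fun _ => rfl) (by rintro _ h rfl; exact hQ h)

/-- A scalar assignment of the value `v`. -/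
theorem Run.put_to {B : ℕ} {σ : State} {Q : State → Prop} {a : ℕ} {e : Expr} (v : ℕ)
    (ha : a < 40 ∧ a ≠ 4 ∧ a ≠ 5) (he : e.ok false = true) (hB : 0 < B)
    (hv : v < 2 ^ B) (hg : e.val σ 0 = v)
    (hQ : GoodS B (σ.set a 1 fun _ => v) → Q (σ.set a 1 fun _ => v)) :
    Run B (.put a e) (1 + e.cw + 1) σ Q := by
  subst hg
  refine (Run.put (Q := fun σ' => σ' = σ.set a 1 fun _ => e.val σ 0) ha he hB hv rfl).mono
    le_rfl ?_
  rintro _ hg' rfl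
  exact hQ hg'

/-- A scalar assignment followed by another program. -/
theorem Run.put_then {B : ℕ} {σ : State} {Q : State → Prop} {a T : ℕ} {e : Expr} {q : Prog} (v : ℕ)
    (ha : a < 40 ∧ a ≠ 4 ∧ a ≠ 5) (he : e.ok false = true) (hB : 0 < B)
    (hv : v < 2 ^ B) (hg : e.val σ 0 = v)
    (hQ : GoodS B (σ.set a 1 fun _ => v) → Run B q T (σ.set a 1 fun _ => v) Q) :
    Run B (.seq (.put a e) q) (1 + e.cw + 1 + T) σ Q :=
  Run.seq (R := fun σ' => σ' = σ.set a 1 fun _ => v) (Run.put_to v ha he hB hv hg fun _ => rfl)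
    (by rintro _ h rfl; exact hQ h)

end CapDom

namespace CapDom

/-! ## Maximum matchings in general graphs

A matching is an involution; its fixed points are the exposed vertices. -/

/-- `M` is a matching of the graph with adjacency relation `E`. -/
structure IsMatch {V : Type*} (E : V → V → Prop) (M : V → V) : Prop where
  invol : ∀ v, M (M v) = v
  edge : ∀ v, M v ≠ v → E v (M v)

/-- State of the search for an augmenting path from the exposed vertex `r`: outer vertices `D`,
inner vertices `A`, for each inner vertex `a` the set `W a` of its descendants, and for each outer
vertex `x` a matching `X x` that exposes `x` in place of `r`. -/
structure Search {V : Type*} (E : V → V → Prop) (M : V → V) (r : V) (D A : V → Prop)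
    (W : V → V → Prop) (X : V → V → V) : Prop where
  rootD : D r
  disj : ∀ v, D v → ¬ A v
  rootX : ∀ v, X r v = M v
  rootW : ∀ a, A a → ¬ W a r
  isMatch : ∀ x, D x → IsMatch E (X x)
  fixed : ∀ x, D x → X x x = x
  cover : ∀ x v, D x → (D v ∨ A v) → v ≠ x → X x v ≠ v
  closed : ∀ x v, D x → (D v ∨ A v) → D (X x v) ∨ A (X x v)
  outside : ∀ x v, D x → ¬ D v → ¬ A v → X x v = M v
  inner : ∀ x a, D x → A a → D (X x a)
  W_sub : ∀ a v, A a → W a v → D v ∨ A v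
  W_self : ∀ a, A a → ¬ W a a
  W_below : ∀ a x v, A a → D x → W a x → W a v → W a (X x v)
  W_part : ∀ a x, A a → D x → ¬ W a x → W a (X x a)
  W_above : ∀ a x v, A a → D x → ¬ W a x → W a v → W a (X x v) ∨ X x v = a
  W_trans : ∀ a b v, A a → A b → W a b → W b v → W a v
  W_laminar : ∀ a b v, A a → A b → a ≠ b → W a v → W b v → W a b ∨ W b a

section

variable {V : Type*} {E : V → V → Prop} {M : V → V} {r : V} {D A : V → Prop}
  {W : V → V → Prop} {X : V → V → V}

theorem IsMatch.eq_iff (h : IsMatch E M) {u v : V} : M u = v ↔ M v = u := by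
  constructor <;> (rintro rfl; exact h.invol _)

theorem IsMatch.inj (h : IsMatch E M) {u v : V} (huv : M u = M v) : u = v := by
  rw [← h.invol u, huv, h.invol]

/-- Modify a matching exposing `x` by the edge `x y`. -/
theorem IsMatch.swap [DecidableEq V] (h : IsMatch E M) (hE : ∀ u v, E u v → E v u) {x y : V}
    (hx : M x = x) (hxy : E x y) (hne : x ≠ y) :
    IsMatch E fun v => if v = M y then (if v = y then x else v) else if v = x then y else
      if v = y then x else M v := by
  -- The formula also covers an exposed `y`: then `M y = y`, and the edge `x y` is simply added.
  -- Thus one formula serves both for growing the tree and for augmenting.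
  have hxM : M y ≠ x := fun h' => hne (by rw [h.eq_iff] at h'; rw [← h', hx])
  constructor
  · intro v
    have := h.invol v
    have := h.invol y
    have := h.eq_iff (u := v) (v := y)
    have := h.eq_iff (u := v) (v := x)
    grind
  · intro v hv
    have := h.edge v
    have := hE x y hxy
    grind

/-- The matching `X x` exposes `x` and still contains the edge from `y` to `M y`, because both ends
are outside the tree. Exchanging that edge for `x y` exposes `M y`, the new outer vertex. The new
inner vertex `y` has the single descendant `M y`, and every inner vertex above `x` gains both. -/
theorem Search.grow [DecidableEq V] (S : Search E M r D A W X) (hM : IsMatch E M)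
    (hE : ∀ u v, E u v → E v u) {x y : V} (hx : D x) (hyD : ¬ D y) (hyA : ¬ A y) (hxy : E x y)
    (hy : M y ≠ y) :
    Search E M r (fun v => D v ∨ v = M y) (fun v => A v ∨ v = y)
      (fun a v => if a = y then v = M y else W a v ∨ (W a x ∧ (v = y ∨ v = M y)))
      (fun u v => if u = M y then (if v = M y then M y else if v = x then y else
        if v = y then x else X x v) else X u v) := by
  -- The tree is closed under `X r = M`, so the partner of a vertex outside it is outside too.
  have hzT : ¬ D (M y) ∧ ¬ A (M y) := by
    constructor <;> intro h <;>
    · have h1 := S.closed r (M y) S.rootD (by tauto)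
      rw [S.rootX, hM.invol] at h1; tauto
  have hzr : M y ≠ r := fun h => hzT.1 (h ▸ S.rootD)
  have hzx : M y ≠ x := fun h => hzT.1 (h ▸ hx)
  have hyx : y ≠ x := fun h => hyD (h ▸ hx)
  have hXy : ∀ u, D u → X u y = M y := fun u hu => S.outside u y hu hyD hyA
  have hXz : ∀ u, D u → X u (M y) = y := fun u hu => by
    rw [S.outside u _ hu hzT.1 hzT.2, hM.invol]
  have hWy : ∀ a, A a → ¬ W a y := fun a ha h => by have := S.W_sub a y ha h; tauto
  have hWz : ∀ a, A a → ¬ W a (M y) := fun a ha h => by have := S.W_sub a _ ha h; tauto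
  have hXx := S.fixed x hx
  have hmx := S.isMatch x hx
  constructor
  · exact Or.inl S.rootD
  · have := S.disj; grind
  · have := S.rootX; grind
  · have := S.rootW; have := S.rootD; grind
  · rintro u (hu | rfl)
    · have : u ≠ M y := fun h => hzT.1 (h ▸ hu)
      simp only [this, if_false]
      exact S.isMatch u hu
    · have h1 := hmx.swap hE hXx hxy (Ne.symm hyx)
      simp only [if_true]
      convert h1 using 2 with v
      rw [hXy x hx]
      grind
  · intro u hu
    have := S.fixed u
    grind
  · intro u v hu hv hne
    have := S.cover u v
    have := S.cover x v
    have := hXy u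
    have := hXz u
    have := hXy x hx
    have := hXz x hx
    have := hmx.eq_iff (u := v) (v := y)
    grind
  · intro u v hu hv
    have := S.closed u v
    have := S.closed x v
    have := hXy u
    have := hXz u
    grind
  · intro u v hu hv hv'
    have := S.outside u v
    have := S.outside x v hx
    grind
  · intro u a hu ha
    have := S.inner u a
    have := S.inner x a
    have := hXy u
    have := S.disj x hx
    grind
  · intro a v ha hv
    have := S.W_sub a v
    grind
  · intro a ha
    have := S.W_self a
    grind
  · intro a u v ha hu hau hav
    have := S.W_below a u v
    have := S.W_below a x v
    have := hXy u
    have := hXz u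
    have := hWy a
    have := hWz a
    grind
  · intro a u ha hu hau
    have := S.W_part a u
    have := S.W_part a x
    have := hXy u
    have := hWy a
    have := hWz a
    grind
  · intro a u v ha hu hau hav
    have := S.W_above a u v
    have := S.W_above a x v
    have := hXy u
    have := hXz u
    have := hWy a
    have := hWz a
    grind
  · intro a b v ha hb hab hbv
    have := S.W_trans a b v
    have := S.W_trans a b x
    have := hWy a
    have := hWz a
    have := hWy b
    have := hWz b
    grind
  · intro a b v ha hb hne hav hbv
    have := S.W_laminar a b v
    have := S.W_laminar a b x
    have := hWy a
    have := hWz a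
    have := hWy b
    have := hWz b
    grind

/-! ### Turning inner vertices into outer ones -/

/-- The matching exposing the inner vertex `a`, obtained from an edge `x y` that leaves the set of
descendants of `a`. -/
def crossMatching [DecidableEq V] (W : V → V → Prop) [∀ u v, Decidable (W u v)] (X : V → V → V)
    (x y a v : V) : V :=
  if v = a then a else if W a v then (if v = x then y else X x v) else
    (if v = y then x else X y v)

/-- If `W b` contained `x`, laminarity would nest `a` and `b`. Since `a` is not below `b`, the
vertex `b` would be below `a`, and transitivity would put `y` into `W a`. -/
theorem Search.not_mem_of_cross (S : Search E M r D A W X) {x y a : V} (ha : A a) (hax : W a x)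
    (hay : ¬ W a y) {b : V} (hb : A b) (hbxy : W b x ↔ W b y) (hba : ¬ W b a) :
    ¬ W b x ∧ ¬ W b y := by
  have hne : b ≠ a := by rintro rfl; tauto
  suffices ¬ W b x by tauto
  intro hbx
  rcases S.W_laminar b a x hb ha hne hbx hax with h | h
  · exact hba h
  · exact hay (S.W_trans a b y ha hb h (hbxy.1 hbx))

section
variable [DecidableEq V] [∀ u v, Decidable (W u v)] {x y a : V}

/-- Since `x ∈ W a`, the matching `X x` maps `W a` to itself. Since `y ∉ W a`, the matching `X y`
maps `W a ∪ {a}` to itself, hence also its complement. Using the first inside and the second outside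
leaves `x`, `y` and `a` exposed, and the edge `x y` then covers `x` and `y`. -/
theorem Search.isMatch_cross (S : Search E M r D A W X) (hE : ∀ u v, E u v → E v u) (hx : D x)
    (hy : D y) (hxy : E x y) (ha : A a) (hax : W a x) (hay : ¬ W a y) :
    IsMatch E (crossMatching W X x y a) := by
  have hXx := S.fixed x hx
  have hXy := S.fixed y hy
  have hmx := S.isMatch x hx
  have hmy := S.isMatch y hy
  have hxa : x ≠ a := fun h => S.disj x hx (h ▸ ha)
  have hya : y ≠ a := fun h => S.disj y hy (h ▸ ha)
  have haa := S.W_self a ha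
  constructor
  · intro v
    have h1 := S.W_below a x v ha hx hax
    have h2 := S.W_above a y v ha hy hay
    have h3 := S.W_above a y (X y v) ha hy hay
    have h4 := hmx.invol v
    have h5 := hmy.invol v
    have h6 := hmx.eq_iff (u := v) (v := x)
    have h7 := hmy.eq_iff (u := v) (v := y)
    have h8 := S.W_part a y ha hy hay
    unfold crossMatching
    grind
  · intro v
    have h4 := hmx.edge v
    have h5 := hmy.edge v
    have := hE x y hxy
    unfold crossMatching
    grind

theorem Search.cross_cover (S : Search E M r D A W X) (hx : D x) (hy : D y)
    (hax : W a x) (hay : ¬ W a y) {v : V} (hv : D v ∨ A v) (hva : v ≠ a) :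
    crossMatching W X x y a v ≠ v := by
  have := S.cover x v hx hv
  have := S.cover y v hy hv
  unfold crossMatching
  grind

theorem Search.cross_closed (S : Search E M r D A W X) (hx : D x) (hy : D y)
    {v : V} (hv : D v ∨ A v) :
    D (crossMatching W X x y a v) ∨ A (crossMatching W X x y a v) := by
  have := S.closed x v hx hv
  have := S.closed y v hy hv
  unfold crossMatching
  grind

theorem Search.cross_outside (S : Search E M r D A W X) (hx : D x) (hy : D y) (ha : A a)
    {v : V} (hv : ¬ D v) (hv' : ¬ A v) : crossMatching W X x y a v = M v := by
  have := S.outside x v hx hv hv'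
  have := S.outside y v hy hv hv'
  unfold crossMatching
  grind

theorem Search.cross_inner (S : Search E M r D A W X) (hx : D x) (hy : D y)
    {b : V} (hb : A b) (hba : b ≠ a) : D (crossMatching W X x y a b) := by
  have := S.inner x b hx hb
  have := S.inner y b hy hb
  unfold crossMatching
  grind

/-- If `a` is below `b`, then so is `x` by transitivity, and `y` because the edge does not separate
`b`. Hence both `X x` and `X y` preserve `W b`. -/
theorem Search.cross_below (S : Search E M r D A W X) (hx : D x) (hy : D y) (ha : A a)
    (hax : W a x) (hay : ¬ W a y) {b v : V} (hb : A b) (hbxy : W b x ↔ W b y) (hba : W b a)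
    (hbv : W b v) : W b (crossMatching W X x y a v) := by
  have hne : b ≠ a := by rintro rfl; tauto
  have h1 := S.W_trans b a x hb ha hba hax
  have h2 := S.W_below b x v hb hx h1 hbv
  have h3 := S.W_below b y v hb hy (hbxy.1 h1) hbv
  unfold crossMatching
  grind

/-- If `a` is not below `b`, then neither are `x` and `y`, so both `X x` and `X y` pair `b` with a
vertex of `W b`. The next lemma uses the same dichotomy. -/
theorem Search.cross_part (S : Search E M r D A W X) (hx : D x) (hy : D y) (ha : A a)
    (hax : W a x) (hay : ¬ W a y) {b : V} (hb : A b) (hbxy : W b x ↔ W b y) (hba : ¬ W b a) :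
    W b (crossMatching W X x y a b) := by
  have hne : b ≠ a := by rintro rfl; tauto
  obtain ⟨h1, h2⟩ := S.not_mem_of_cross ha hax hay hb hbxy hba
  have h3 := S.W_part b x hb hx h1
  have h4 := S.W_part b y hb hy h2
  have h5 := S.disj b
  unfold crossMatching
  grind

theorem Search.cross_above (S : Search E M r D A W X) (hx : D x) (hy : D y) (ha : A a)
    (hax : W a x) (hay : ¬ W a y) {b v : V} (hb : A b) (hbxy : W b x ↔ W b y) (hba : ¬ W b a)
    (hbv : W b v) :
    W b (crossMatching W X x y a v) ∨ crossMatching W X x y a v = b := by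
  obtain ⟨h1, h2⟩ := S.not_mem_of_cross ha hax hay hb hbxy hba
  have h3 := S.W_above b x v hb hx h1 hbv
  have h4 := S.W_above b y v hb hy h2 hbv
  unfold crossMatching
  grind

end

/-- All inner vertices separated by the edge `x y`, those on the blossom it closes, become outer
simultaneously. The sets `W` and the matchings of the old outer vertices are kept; the invariants
for the new ones are the properties of `crossMatching`. -/
theorem Search.merge [DecidableEq V] (S : Search E M r D A W X)
    (hE : ∀ u v, E u v → E v u) {x y : V} (hx : D x) (hy : D y) (hxy : E x y)
    [∀ u v, Decidable (W u v)] [∀ u, Decidable (A u)] :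
    Search E M r (fun v => D v ∨ (A v ∧ ¬ (W v x ↔ W v y))) (fun v => A v ∧ (W v x ↔ W v y)) W
      (fun a v => if A a ∧ ¬ (W a x ↔ W a y) then (if v = a then a else
        if W a v ↔ W a x then (if v = x then y else X x v) else (if v = y then x else X y v))
        else X a v) := by
  -- The formula for the new matching is symmetric in the ends of the edge, so they may be renamed
  -- such that `x'` is the one in `W a`.
  have key : ∀ a, A a → ¬ (W a x ↔ W a y) → ∃ x' y', D x' ∧ D y' ∧ E x' y' ∧ W a x' ∧ ¬ W a y' ∧
      (∀ b, (W b x ↔ W b y) ↔ (W b x' ↔ W b y')) ∧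
      ∀ v, (if v = a then a else
        if W a v ↔ W a x then (if v = x then y else X x v) else (if v = y then x else X y v)) =
        crossMatching W X x' y' a v := by
    intro a ha h
    by_cases hax : W a x
    · refine ⟨x, y, hx, hy, hxy, hax, by tauto, fun _ => Iff.rfl, fun v => ?_⟩
      unfold crossMatching; simp only [hax, iff_true]
    · refine ⟨y, x, hy, hx, hE _ _ hxy, by tauto, hax, fun _ => Iff.comm, fun v => ?_⟩
      unfold crossMatching; simp only [hax, iff_false]; grind
  have hdisj := S.disj
  constructor
  · exact Or.inl S.rootD
  · intro v; have := S.disj v; tauto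
  · intro v
    have := S.rootX v
    have := S.disj r S.rootD
    grind
  · intro a ha; exact S.rootW a ha.1
  · intro u hu
    by_cases h : A u ∧ ¬ (W u x ↔ W u y)
    · obtain ⟨x', y', h1, h2, h3, h4, h5, -, h7⟩ := key u h.1 h.2
      simp only [if_pos h, h7]
      exact S.isMatch_cross hE h1 h2 h3 h.1 h4 h5
    · simp only [if_neg h]
      exact S.isMatch u (by tauto)
  · intro u hu
    have := S.fixed u
    grind
  · intro u v hu hv hne
    by_cases h : A u ∧ ¬ (W u x ↔ W u y)
    · obtain ⟨x', y', h1, h2, h3, h4, h5, -, h7⟩ := key u h.1 h.2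
      simp only [if_pos h, h7]
      exact S.cross_cover h1 h2 h4 h5 (by tauto) hne
    · simp only [if_neg h]
      exact S.cover u v (by tauto) (by tauto) hne
  · intro u v hu hv
    suffices h : ∀ w, D w ∨ A w → (D w ∨ A w ∧ ¬ (W w x ↔ W w y)) ∨ A w ∧ (W w x ↔ W w y) by
      apply h
      by_cases h : A u ∧ ¬ (W u x ↔ W u y)
      · obtain ⟨x', y', h1, h2, h3, h4, h5, -, h7⟩ := key u h.1 h.2
        simp only [if_pos h, h7]
        exact S.cross_closed h1 h2 (by tauto)
      · simp only [if_neg h]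
        exact S.closed u v (by tauto) (by tauto)
    intro w; tauto
  · intro u v hu hv hv'
    by_cases h : A u ∧ ¬ (W u x ↔ W u y)
    · obtain ⟨x', y', h1, h2, h3, h4, h5, -, h7⟩ := key u h.1 h.2
      simp only [if_pos h, h7]
      exact S.cross_outside h1 h2 h.1 (by tauto) (by tauto)
    · simp only [if_neg h]
      exact S.outside u v (by tauto) (by tauto) (by tauto)
  · intro u b hu hb
    left
    by_cases h : A u ∧ ¬ (W u x ↔ W u y)
    · obtain ⟨x', y', h1, h2, h3, h4, h5, -, h7⟩ := key u h.1 h.2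
      simp only [if_pos h, h7]
      exact S.cross_inner h1 h2 hb.1 (by rintro rfl; tauto)
    · simp only [if_neg h]
      exact S.inner u b (by tauto) hb.1
  · intro a v ha hv
    have := S.W_sub a v ha.1 hv
    tauto
  · intro a ha; exact S.W_self a ha.1
  · intro b u v hb hu hbu hbv
    by_cases h : A u ∧ ¬ (W u x ↔ W u y)
    · obtain ⟨x', y', h1, h2, h3, h4, h5, h6, h7⟩ := key u h.1 h.2
      simp only [if_pos h, h7]
      exact S.cross_below h1 h2 h.1 h4 h5 hb.1 ((h6 b).1 hb.2) hbu hbv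
    · simp only [if_neg h]
      exact S.W_below b u v hb.1 (by tauto) hbu hbv
  · intro b u hb hu hbu
    by_cases h : A u ∧ ¬ (W u x ↔ W u y)
    · obtain ⟨x', y', h1, h2, h3, h4, h5, h6, h7⟩ := key u h.1 h.2
      simp only [if_pos h, h7]
      exact S.cross_part h1 h2 h.1 h4 h5 hb.1 ((h6 b).1 hb.2) hbu
    · simp only [if_neg h]
      exact S.W_part b u hb.1 (by tauto) hbu
  · intro b u v hb hu hbu hbv
    by_cases h : A u ∧ ¬ (W u x ↔ W u y)
    · obtain ⟨x', y', h1, h2, h3, h4, h5, h6, h7⟩ := key u h.1 h.2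
      simp only [if_pos h, h7]
      exact S.cross_above h1 h2 h.1 h4 h5 hb.1 ((h6 b).1 hb.2) hbu hbv
    · simp only [if_neg h]
      exact S.W_above b u v hb.1 (by tauto) hbu hbv
  · intro a b v ha hb; exact S.W_trans a b v ha.1 hb.1
  · intro a b v ha hb; exact S.W_laminar a b v ha.1 hb.1

/-! ### Odd classes of outer vertices -/

/-- The outer vertices lying in the same contracted set as `u`. -/
def SameClass (D A : V → Prop) (W : V → V → Prop) (u v : V) : Prop :=
  D v ∧ ∀ a, A a → (W a v ↔ W a u)

/-- Suppose the partner `b` of `v` under `X u` were inner. If `u ∈ W b`, then `v ∈ W b` and so `b ∈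
W b`, which is impossible. If `u ∉ W b`, then `v ∈ W b` although `u` and `v` have the same inner
vertices above them. The partner also has the same inner vertices above it, because `X u` preserves
every `W a` containing `u` and every `W a ∪ {a}` with `u ∉ W a`. -/
theorem Search.sameClass_map (S : Search E M r D A W X) {u v : V} (hu : D u)
    (hv : SameClass D A W u v) : SameClass D A W u (X u v) := by
  obtain ⟨hvD, hva⟩ := hv
  have hinv := (S.isMatch u hu).invol v
  have hD : D (X u v) := by
    refine (S.closed u v hu (Or.inl hvD)).resolve_right fun ha => ?_
    by_cases h : W (X u v) u
    · exact S.W_self _ ha (S.W_below _ u v ha hu h ((hva _ ha).2 h))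
    · have := S.W_part _ u ha hu h
      rw [hinv] at this
      exact h ((hva _ ha).1 this)
  refine ⟨hD, fun a ha => ?_⟩
  by_cases h : W a u
  · simp only [h, iff_true]
    exact S.W_below a u v ha hu h ((hva a ha).2 h)
  · simp only [h, iff_false]
    intro h'
    have := S.W_above a u _ ha hu h h'
    rw [hinv] at this
    rcases this with h1 | rfl
    · exact h ((hva a ha).1 h1)
    · exact S.disj _ hvD ha

/-- A finite set with an involution that has no fixed point is even. -/
theorem even_card_of_involution (s : Finset V) (φ : V → V)
    (hφ : ∀ v ∈ s, φ v ∈ s ∧ φ v ≠ v ∧ φ (φ v) = v) : Even s.card := by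
  have : ∑ _v ∈ s, (1 : ZMod 2) = 0 :=
    Finset.sum_involution (fun v _ => φ v) (fun _ _ => by decide) (fun v hv _ => (hφ v hv).2.1)
      (fun v hv => (hφ v hv).1) (fun v hv => (hφ v hv).2.2)
  rw [Finset.sum_const, nsmul_one, ZMod.natCast_eq_zero_iff] at this
  exact even_iff_two_dvd.2 this

/-- On its class without `u` itself, `X u` is an involution without fixed points. -/
theorem Search.odd_class (S : Search E M r D A W X) {u : V} (hu : D u) (s : Finset V)
    (hs : ∀ v, v ∈ s ↔ SameClass D A W u v) : Odd s.card := by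
  classical
  have hus : u ∈ s := (hs u).2 ⟨hu, fun _ _ => Iff.rfl⟩
  rw [← Finset.card_erase_add_one hus]
  refine (even_card_of_involution (s.erase u) (X u) fun v hv => ?_).add_one
  rw [Finset.mem_erase] at hv
  have h1 := S.sameClass_map hu ((hs v).1 hv.2)
  have hm := S.isMatch u hu
  refine ⟨Finset.mem_erase.2 ⟨fun h => hv.1 ?_, (hs _).2 h1⟩, ?_, hm.invol v⟩
  · rw [hm.eq_iff, S.fixed u hu] at h; exact h.symm
  · exact S.cover u v hu (Or.inl ((hs v).1 hv.2).1) hv.1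

/-- When the search is stuck, every matching leaves many outer vertices without an outer
partner. -/
theorem Search.deficient [DecidableEq V] (S : Search E M r D A W X)
    (hstuck : ∀ x y, D x → D y → E x y → ∀ a, A a → (W a x ↔ W a y))
    {Ds As : Finset V} (hD : ∀ v, v ∈ Ds ↔ D v) (hA : ∀ v, v ∈ As ↔ A v) {N : V → V}
    (hN : IsMatch E N) :
    ∃ H ⊆ Ds, H.card = As.card + 1 ∧ ∀ v ∈ H, N v = v ∨ ¬ D (N v) := by
  classical
  have hMM : ∀ v, M (M v) = v := fun v => by
    rw [← S.rootX, ← S.rootX]; exact (S.isMatch r S.rootD).invol v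
  -- If `N` matched every vertex of the class of `u` to an outer vertex, the partners would lie in
  -- the same class because the search is stuck, and `N` would be a fixed-point-free involution of
  -- an odd set.
  have hex : ∀ u, D u → ∃ v, SameClass D A W u v ∧ (N v = v ∨ ¬ D (N v)) := by
    intro u hu
    by_contra! hcon
    have hmem : ∀ v, v ∈ Ds.filter (SameClass D A W u) ↔ SameClass D A W u v := by
      intro v; rw [Finset.mem_filter, hD]; exact ⟨fun h => h.2, fun h => ⟨h.1, h⟩⟩
    refine (Nat.not_odd_iff_even.2 (even_card_of_involution _ N fun v hv => ?_))
      (S.odd_class hu _ hmem)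
    rw [hmem] at hv ⊢
    obtain ⟨h1, h2⟩ := hcon v hv
    refine ⟨⟨h2, fun a ha => ?_⟩, h1, hN.invol v⟩
    rw [← hv.2 a ha]
    exact (hstuck v (N v) hv.1 h2 (hN.edge v h1) a ha).symm
  choose! h hh using hex
  -- The root and the partners `M a` of the inner vertices represent `|A| + 1` different classes: `M
  -- a` lies in `W a` while the root does not, and if `M a` and `M b` shared a class, `a` and `b`
  -- would each be below the other.
  let f : V → V := fun a => if a ∈ As then M a else r
  have hrA : r ∉ As := fun h' => S.disj r S.rootD ((hA r).1 h')
  have hfA : ∀ a, A a → f a = M a := fun a ha => if_pos ((hA a).2 ha)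
  have hfr : f r = r := if_neg hrA
  have hfD : ∀ a ∈ insert r As, D (f a) := by
    intro a ha
    rw [Finset.mem_insert] at ha
    rcases ha with rfl | ha
    · rw [hfr]; exact S.rootD
    · have := S.inner r a S.rootD ((hA a).1 ha)
      rwa [hfA a ((hA a).1 ha), ← S.rootX]
  have hpart : ∀ a, A a → W a (M a) := fun a ha => by
    rw [← S.rootX]; exact S.W_part a r ha S.rootD (S.rootW a ha)
  have habove : ∀ a b, A a → W a (M b) → W a b ∨ b = a := fun a b ha hab => by
    have := S.W_above a r (M b) ha S.rootD (S.rootW a ha) hab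
    rwa [S.rootX, hMM] at this
  have hinj : Set.InjOn (fun a => h (f a)) (insert r As : Finset V) := by
    intro a ha b hb hab
    have h1 := hh (f a) (hfD a ha)
    have h2 := hh (f b) (hfD b hb)
    have hab' : h (f a) = h (f b) := hab
    rw [hab'] at h1
    have h3 : ∀ c, A c → (W c (f a) ↔ W c (f b)) := fun c hc =>
      (h1.1.2 c hc).symm.trans (h2.1.2 c hc)
    have ha' : a = r ∨ A a := by simpa [hA] using ha
    have hb' : b = r ∨ A b := by simpa [hA] using hb
    rcases ha' with rfl | ha' <;> rcases hb' with rfl | hb'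
    · rfl
    · have := h3 b hb'
      rw [hfr, hfA b hb'] at this
      exact absurd (this.2 (hpart b hb')) (S.rootW b hb')
    · have := h3 a ha'
      rw [hfr, hfA a ha'] at this
      exact absurd (this.1 (hpart a ha')) (S.rootW a ha')
    · rw [hfA a ha', hfA b hb'] at h3
      by_contra hne
      have h4 := (habove a b ha' ((h3 a ha').1 (hpart a ha'))).resolve_right (Ne.symm hne)
      have h5 := (habove b a hb' ((h3 b hb').2 (hpart b hb'))).resolve_right hne
      exact S.W_self a ha' (S.W_trans a b a ha' hb' h4 h5)
  refine ⟨(insert r As).image fun a => h (f a), ?_, ?_, ?_⟩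
  · intro v hv
    obtain ⟨a, ha, rfl⟩ := Finset.mem_image.1 hv
    exact (hD _).2 (hh _ (hfD a ha)).1.1
  · rw [Finset.card_image_of_injOn hinj, Finset.card_insert_of_notMem hrA]
  · intro v hv
    obtain ⟨a, ha, rfl⟩ := Finset.mem_image.1 hv
    exact (hh _ (hfD a ha)).2

/-! ### Certificates for the number of exposed vertices -/

/-- A certificate that every matching exposes at least `c` vertices. -/
structure Frozen (E : V → V → Prop) (Ds As : Finset V) (c : ℕ) : Prop where
  disj : Disjoint Ds As
  nbrs : ∀ x ∈ Ds, ∀ y, E x y → y ∈ Ds ∨ y ∈ As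
  deficient : ∀ N, IsMatch E N → ∃ H ⊆ Ds, H.card = As.card + c ∧ ∀ v ∈ H, N v = v ∨ N v ∈ As

/-- The matched vertices of `H` have distinct partners in `As`, so at most `|As|` of the `|As| + c`
vertices of `H` are matched. -/
theorem Frozen.le_card {Ds As : Finset V} {c : ℕ} [DecidableEq V] (F : Frozen E Ds As c)
    {N : V → V} (hN : IsMatch E N) : c ≤ (Ds.filter fun v => N v = v).card := by
  obtain ⟨H, hH, hc, h⟩ := F.deficient N hN
  have h1 := Finset.card_filter_add_card_filter_not (s := H) fun v => N v = v
  have h2 : (H.filter fun v => N v = v).card ≤ (Ds.filter fun v => N v = v).card :=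
    Finset.card_le_card (Finset.filter_subset_filter _ hH)
  have h3 : (H.filter fun v => ¬ N v = v).card ≤ As.card := by
    refine Finset.card_le_card_of_injOn N (fun v hv => ?_) fun u _ v _ h => hN.inj h
    rw [Finset.coe_filter] at hv
    exact (h v hv.1).resolve_left hv.2
  omega

theorem frozen_empty : Frozen E ∅ ∅ 0 :=
  ⟨by simp, by simp, fun _ _ => ⟨∅, by simp, by simp, by simp⟩⟩

/-- The sets `H` of the old certificate and of the stuck tree are disjoint, and so are the sets of
inner vertices, so the two deficiencies add. What has to be excluded is that a new outer vertex is
matched to a frozen outer one. -/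
theorem Frozen.extend [DecidableEq V] {Ds As Dn An : Finset V} {c : ℕ} (F : Frozen E Ds As c)
    (hE : ∀ u v, E u v → E v u) (S : Search E M r D A W X)
    (hD : ∀ v, v ∈ Dn ↔ D v) (hA : ∀ v, v ∈ An ↔ A v)
    (hstuck : ∀ x y, D x → D y → E x y → ∀ a, A a → (W a x ↔ W a y))
    (hnbrs : ∀ x y, D x → E x y → D y ∨ A y ∨ y ∈ Ds ∨ y ∈ As)
    (hDf : ∀ v, D v → v ∉ Ds ∧ v ∉ As) (hAf : ∀ v, A v → v ∉ Ds ∧ v ∉ As) :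
    Frozen E (Ds ∪ Dn) (As ∪ An) (c + 1) := by
  constructor
  · have h1 := F.disj
    rw [Finset.disjoint_left] at h1 ⊢
    intro v hv hv'
    have := S.disj v
    have := hDf v
    have := hAf v
    have := @h1 v
    simp only [Finset.mem_union, hD, hA] at hv hv'
    tauto
  · intro x hx y hxy
    simp only [Finset.mem_union, hD, hA] at hx ⊢
    rcases hx with hx | hx
    · have := F.nbrs x hx y hxy; tauto
    · have := hnbrs x y hx hxy; tauto
  · intro N hN
    obtain ⟨H₁, h1, h2, h3⟩ := F.deficient N hN
    obtain ⟨H₂, h4, h5, h6⟩ := S.deficient hstuck hD hA hN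
    refine ⟨H₁ ∪ H₂, Finset.union_subset_union h1 h4, ?_, ?_⟩
    · rw [Finset.card_union_of_disjoint, h2, h5, Finset.card_union_of_disjoint]
      · omega
      · rw [Finset.disjoint_left]
        intro v hv hv'
        exact (hAf v ((hA v).1 hv')).2 hv
      · rw [Finset.disjoint_left]
        intro v hv hv'
        exact (hDf v ((hD v).1 (h4 hv'))).1 (h1 hv)
    · intro v hv
      simp only [Finset.mem_union, hA] at hv ⊢
      rcases hv with hv | hv
      · have := h3 v hv; tauto
      · rcases h6 v hv with h | h
        · exact Or.inl h
        · by_cases hNv : N v = v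
          · exact Or.inl hNv
          have hvD := (hD v).1 (h4 hv)
          have hedge := hN.edge v hNv
          rcases hnbrs v (N v) hvD hedge with h' | h' | h' | h'
          · exact absurd h' h
          · tauto
          -- A frozen outer vertex has only frozen neighbours, so it cannot be the partner of `v`.
          · have := F.nbrs _ h' v (hE _ _ hedge)
            have := hDf v hvD
            tauto
          · tauto

end
end CapDom

namespace CapDom

theorem State.set_apply {σ : State} {a L : ℕ} {g : ℕ → ℕ} {b j : ℕ} :
    σ.set a L g b j = if b = a then (if j < L then g j else σ b j) else σ b j := rfl

theorem Expr.val_cond_lt {σ : State} {j c : ℕ} {b x y : Expr} (hx : x.val σ j < c)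
    (hy : y.val σ j < c) : (Expr.cond b x y).val σ j < c := by
  rw [val_cond]; split_ifs <;> assumption

theorem GoodS.get_lt {B : ℕ} {σ : State} (h : GoodS B σ) {a j : ℕ} {i : Expr} (ha : a ≠ 5) :
    (Expr.get a i).val σ j < 2 ^ B := by rw [Expr.val_get ha]; exact h _ _

theorem Expr.lit_lt {B : ℕ} (hB : 2 ≤ B) {σ : State} {j x : ℕ} (hx : x < 4) :
    (Expr.lit x).val σ j < 2 ^ B :=
  lt_of_lt_of_le hx (by calc 4 = 2 ^ 2 := rfl
                          _ ≤ 2 ^ B := Nat.pow_le_pow_right (by simp) hB)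

/-! ## A program for maximum matchings

The program works on the `N` vertices `0, …, N - 1`.  It uses array `6` for `N`, `7` for the
adjacency matrix, `8` for the matching, `9` for the status of the vertices (`0` free, `1` outer,
`2` inner, `3` frozen), `10` for the matchings `X x` and `11` for the sets `W a`; the scalars `12` to
`17` are the root, a flag, the result of the scan for a possible step, and the vertices taking part
in that step. -/

namespace Matching

open CapDom.Expr

/-- Entry `(x, y)` of the matrix stored in array `a`. -/
abbrev mat (a : ℕ) (x y : Expr) : Expr := .get a (.add (.mul x (.var 6)) y)
/-- Number of vertices. -/
abbrev eN : Expr := .var 6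
/-- Number of pairs of vertices. -/
abbrev eNN : Expr := .mul eN eN
/-- Row index of the loop counter. -/
abbrev row : Expr := .div ctr eN
/-- Column index of the loop counter. -/
abbrev col : Expr := .mod ctr eN

/-- The new matrix of matchings when the search starts. -/
def initX : Expr := .cond (.eq row (.var 12)) (.get 8 col) (.get 10 ctr)
/-- The new status when the search starts. -/
def initS : Expr := .cond (.eq ctr (.var 12)) (.lit 1) (.get 9 ctr)
/-- Start the search. -/
def initP : Prog := .seq (.assign 10 eNN initX) (.seq (.assign 9 eN initS) (.put 13 (.lit 1)))
/-- Time bound for `initP`. -/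
def initTime (N : ℕ) : ℕ := assignTime eNN initX (N * N) + (assignTime eN initS N +
  (1 + (Expr.lit 1).cw + 1))

/-- The new status when the search fails. -/
def freezeS : Expr := .cond (.get 9 ctr) (.lit 3) (.lit 0)
/-- Freeze the search tree. -/
def freezeP : Prog := .seq (.assign 9 eN freezeS) (.put 13 (.lit 0))
/-- Time bound for `freezeP`. -/
def freezeTime (N : ℕ) : ℕ := assignTime eN freezeS N + (1 + (Expr.lit 0).cw + 1)

/-- The new matching when the search succeeds. -/
def augmentM : Expr := .cond (.eq ctr (.var 15)) (.var 16) (.cond (.eq ctr (.var 16)) (.var 15)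
  (mat 10 (.var 15) ctr))
/-- The new status when the search succeeds. -/
def augmentS : Expr := .cond (.eq (.get 9 ctr) (.lit 3)) (.lit 3) (.lit 0)
/-- Augment the matching. -/
def augmentP : Prog := .seq (.assign 8 eN augmentM) (.seq (.assign 9 eN augmentS)
  (.put 13 (.lit 0)))
/-- Time bound for `augmentP`. -/
def augmentTime (N : ℕ) : ℕ := assignTime eN augmentM N + (assignTime eN augmentS N +
  (1 + (Expr.lit 0).cw + 1))

/-- The new matrix of matchings when the tree grows. -/
def growX : Expr := .cond (.eq row (.var 17)) (.cond (.eq col (.var 17)) (.var 17)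
  (.cond (.eq col (.var 15)) (.var 16) (.cond (.eq col (.var 16)) (.var 15)
  (mat 10 (.var 15) col)))) (.get 10 ctr)
/-- The new sets of descendants when the tree grows. -/
def growW : Expr := .cond (.eq row (.var 16)) (.cond (.eq col (.var 17)) (.lit 1) (.lit 0))
  (.cond (.and (mat 11 row (.var 15)) (.or (.eq col (.var 16)) (.eq col (.var 17)))) (.lit 1)
  (.get 11 ctr))
/-- The new status when the tree grows. -/
def growS : Expr := .cond (.eq ctr (.var 16)) (.lit 2) (.cond (.eq ctr (.var 17)) (.lit 1)
  (.get 9 ctr))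
/-- Grow the tree. -/
def growP : Prog := .seq (.assign 10 eNN growX) (.seq (.assign 11 eNN growW) (.assign 9 eN growS))
/-- Time bound for `growP`. -/
def growTime (N : ℕ) : ℕ := assignTime eNN growX (N * N) + (assignTime eNN growW (N * N) +
  assignTime eN growS N)

/-- The new matrix of matchings when parts of the tree are merged. -/
def mergeX : Expr := .cond (.and (.eq (.get 9 row) (.lit 2))
    (.not (.iff (mat 11 row (.var 15)) (mat 11 row (.var 16)))))
  (.cond (.eq col row) row (.cond (.iff (mat 11 row col) (mat 11 row (.var 15)))
    (.cond (.eq col (.var 15)) (.var 16) (mat 10 (.var 15) col))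
    (.cond (.eq col (.var 16)) (.var 15) (mat 10 (.var 16) col)))) (.get 10 ctr)
/-- The new status when parts of the tree are merged. -/
def mergeS : Expr := .cond (.and (.eq (.get 9 ctr) (.lit 2))
    (.not (.iff (mat 11 ctr (.var 15)) (mat 11 ctr (.var 16))))) (.lit 1) (.get 9 ctr)
/-- Merge parts of the tree. -/
def mergeP : Prog := .seq (.assign 10 eNN mergeX) (.assign 9 eN mergeS)
/-- Time bound for `mergeP`. -/
def mergeTime (N : ℕ) : ℕ := assignTime eNN mergeX (N * N) + assignTime eN mergeS N

/-- First component of the loop counter, read as a triple. -/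
abbrev fst3 : Expr := .div ctr eNN
/-- Second component of the loop counter, read as a triple. -/
abbrev snd3 : Expr := .mod (.div ctr eN) eN
/-- The loop counter encodes a possible step. -/
def scanE : Expr := .and (.eq (.get 9 fst3) (.lit 1)) (.and (mat 7 fst3 snd3)
  (.or (.eq (.get 9 snd3) (.lit 0)) (.and (.and (.eq (.get 9 snd3) (.lit 1))
    (.eq (.get 9 col) (.lit 2))) (.not (.iff (mat 11 col fst3) (mat 11 col snd3))))))
/-- Scan for a possible step. -/
def scanP : Prog := .find 14 (.mul eNN eN) scanE
/-- Time bound for `scanP`. -/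
def scanTime (N : ℕ) : ℕ := findTime 14 (.mul eNN eN) scanE (N * N * N)

/-- The first vertex of the step found. -/
def decX : Expr := .div (.sub (.var 14) (.lit 1)) eNN
/-- The second vertex of the step found. -/
def decY : Expr := .mod (.div (.sub (.var 14) (.lit 1)) eN) eN
/-- The partner of the second vertex of the step found. -/
def decZ : Expr := .get 8 (.var 16)
/-- Decode the step found. -/
def decP : Prog := .seq (.put 15 decX) (.seq (.put 16 decY) (.put 17 decZ))
/-- Time bound for `decP`. -/
def decTime : ℕ := (1 + decX.cw + 1) + ((1 + decY.cw + 1) + (1 + decZ.cw + 1))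

/-- The second vertex is free. -/
def freeE : Expr := .eq (.get 9 (.var 16)) (.lit 0)
/-- The second vertex is exposed. -/
def exposedE : Expr := .eq (.var 17) (.var 16)

/-- One step of the search. -/
def stepP : Prog := .seq scanP (.ite (.var 14)
  (.seq decP (.ite freeE (.ite exposedE augmentP growP) mergeP)) freezeP)
/-- Time bound for `stepP`. -/
def stepTime (N : ℕ) : ℕ := scanTime N + ((Expr.var 14).cw + 1 + ((decTime + (freeE.cw + 1 +
  ((exposedE.cw + 1 + (augmentTime N + growTime N)) + mergeTime N))) + freezeTime N))

/-- Search for an augmenting path. -/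
def searchP : Prog := .seq initP (.loop (.var 13) stepP)
/-- Time bound for `searchP`. -/
def searchTime (N : ℕ) : ℕ := initTime N + ((N + 1) * ((Expr.var 13).cw + 1 + stepTime N) +
  ((Expr.var 13).cw + 1))

/-! ### Reading the state -/

/-- The adjacency relation. -/
def vE (N : ℕ) (σ : State) (u v : ℕ) : Prop := (u < N ∧ v < N) ∧ σ 7 (u * N + v) ≠ 0
/-- The matching. -/
def vM (N : ℕ) (σ : State) (v : ℕ) : ℕ := if v < N then σ 8 v else v
/-- The vertices of status `s`. -/
def vS (N : ℕ) (σ : State) (s v : ℕ) : Prop := v < N ∧ σ 9 v = s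
/-- The stored matchings. -/
def vX (N : ℕ) (σ : State) (x v : ℕ) : ℕ := if x < N ∧ v < N then σ 10 (x * N + v) else v
/-- The sets of descendants. -/
def vW (N : ℕ) (σ : State) (a v : ℕ) : Prop := (a < N ∧ v < N) ∧ σ 11 (a * N + v) ≠ 0

theorem index_lt {N u v : ℕ} (hu : u < N) (hv : v < N) : u * N + v < N * N := by nlinarith
theorem index_div {N u v : ℕ} (hv : v < N) : (u * N + v) / N = u := by
  rw [mul_comm, Nat.mul_add_div (by omega), Nat.div_eq_of_lt hv, add_zero]
theorem index_mod {N u v : ℕ} (hv : v < N) : (u * N + v) % N = v := by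
  rw [mul_comm, Nat.mul_add_mod, Nat.mod_eq_of_lt hv]

/-- The arrays that are not touched by the search. -/
def Frame (σ σ' : State) : Prop := ∀ b, b < 8 ∨ b = 12 ∨ 17 < b → σ' b = σ b

theorem Frame.refl (σ : State) : Frame σ σ := fun _ _ => rfl
theorem Frame.trans {σ σ' σ'' : State} (h : Frame σ σ') (h' : Frame σ' σ'') : Frame σ σ'' :=
  fun b hb => (h' b hb).trans (h b hb)
theorem Frame.set {σ : State} {a L : ℕ} {g : ℕ → ℕ} (ha : 8 ≤ a ∧ a ≤ 17 ∧ a ≠ 12) :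
    Frame σ (σ.set a L g) := fun b hb => State.set_of_ne (by omega)
theorem Frame.vE {N : ℕ} {σ σ' : State} (h : Frame σ σ') : vE N σ' = vE N σ := by
  unfold Matching.vE; rw [h 7 (by simp)]

/-- The part of the invariant that concerns the frozen vertices; `r` is the current root. -/
def Cert (N r : ℕ) (σ : State) : Prop :=
  ∃ Ds As : Finset ℕ, Frozen (vE N σ) Ds As ((Finset.range r).filter fun v => vM N σ v = v).card ∧
    (∀ v, vS N σ 3 v ↔ v ∈ Ds ∨ v ∈ As) ∧ (∀ v ∈ As, vM N σ v ≠ v) ∧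
    (∀ v, vS N σ 3 v → vS N σ 3 (vM N σ v)) ∧ (∀ v ∈ Ds, vM N σ v = v → v < r) ∧
    ∀ v < r, vM N σ v = v → vS N σ 3 v

/-- The invariant between two searches. -/
structure Inv (N r : ℕ) (σ : State) : Prop where
  size : σ 6 0 = N
  symm : ∀ u v, vE N σ u v → vE N σ v u
  isMatch : IsMatch (vE N σ) (vM N σ)
  status : ∀ v < N, σ 9 v = 0 ∨ σ 9 v = 3
  cert : Cert N r σ

/-- The invariant during a search. -/
structure SInv (N r : ℕ) (σ : State) : Prop where
  size : σ 6 0 = N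
  root : r < N
  root' : σ 12 0 = r
  symm : ∀ u v, vE N σ u v → vE N σ v u
  isMatch : IsMatch (vE N σ) (vM N σ)
  exposed : vM N σ r = r
  status : ∀ v < N, σ 9 v < 4
  cert : Cert N r σ
  search : Search (vE N σ) (vM N σ) r (vS N σ 1) (vS N σ 2) (vW N σ) (vX N σ)

/-! ### Starting and ending a search -/

theorem Cert.congr {N r : ℕ} {σ σ' : State} (h : Cert N r σ) (hE : vE N σ' = vE N σ)
    (hM : vM N σ' = vM N σ) (hS : vS N σ' 3 = vS N σ 3) : Cert N r σ' := by
  unfold Cert; rw [hE, hM, hS]; exact h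

theorem run_init {B N r : ℕ} {σ : State} (hB : 2 ≤ B) (hNB : N * N ≤ B) (h : Inv N r σ)
    (hr : r < N) (hr' : σ 12 0 = r) (hM : vM N σ r = r) :
    Run B initP (initTime N) σ fun σ' => SInv N r σ' ∧ Frame σ σ' ∧ σ' 13 0 = 1 := by
  have hN := h.size
  have hNB' : N ≤ B := by nlinarith
  refine Run.good fun hg => ?_
  refine Run.assign_then (fun i => if i / N = r then σ 8 (i % N) else σ 10 i)
    (by simp [Expr.val, hN]) hNB (by omega) (by simp) (by rfl) (by rfl) (by rfl)
    (fun i hi => val_cond_lt (hg.get_lt (by simp)) (hg.get_lt (by simp)))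
    (fun i hi => ?_) fun hg => ?_
  · simp [initX, val_cond, tt_eq, val_ctr, val_lit, val_get, val_div, val_mod, hr', hN]
  refine Run.assign_then (fun i => if i = r then 1 else σ 9 i)
    (by simp [Expr.val, hN, State.set]) hNB' (by omega) (by simp) (by rfl) (by rfl) (by rfl)
    (fun i hi => val_cond_lt (lit_lt hB (by simp)) (hg.get_lt (by simp)))
    (fun i hi => ?_) fun hg => ?_
  · simp [initS, val_cond, tt_eq, val_ctr, val_lit, val_get, hr', State.set_apply]
  refine Run.put_to 1 (by simp) (by rfl) (by omega) (lit_lt (x := 1) hB (σ := σ) (j := 0) (by simp))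
    rfl fun hg => ?_
  clear hg
  set σ' := State.set _ 13 1 _ with hσ'
  have hF : Frame σ σ' :=
    ((Frame.set (by simp)).trans (Frame.set (by simp))).trans (Frame.set (by simp))
  have hE : vE N σ' = vE N σ := hF.vE
  have hM' : vM N σ' = vM N σ := by
    funext v; simp [vM, hσ', State.set_apply]
  -- The root is not frozen: an exposed frozen vertex is outer and smaller than the current root.
  have hr0 : σ 9 r = 0 := by
    refine (h.status r hr).resolve_right fun h3 => ?_
    obtain ⟨Ds, As, -, h1, h2, -, h4, -⟩ := h.cert
    rcases (h1 r).1 ⟨hr, h3⟩ with h5 | h5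
    · exact absurd (h4 r h5 hM) (lt_irrefl _)
    · exact h2 r h5 hM
  have hS : ∀ v < N, σ' 9 v = if v = r then 1 else σ 9 v := by
    intro v hv; simp [hσ', State.set_apply, hv]
  have hS1 : ∀ v, vS N σ' 1 v ↔ v = r := by
    intro v
    unfold vS
    constructor
    · rintro ⟨hv, h1⟩
      rw [hS v hv] at h1
      have := h.status v hv
      by_contra h'
      rw [if_neg h'] at h1; omega
    · rintro rfl; exact ⟨hr, by simp [hS v hr]⟩
  have hS2 : ∀ v, ¬ vS N σ' 2 v := by
    rintro v ⟨hv, h1⟩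
    rw [hS v hv] at h1
    have := h.status v hv
    split_ifs at h1 <;> omega
  have hS3 : vS N σ' 3 = vS N σ 3 := by
    funext v
    refine propext (and_congr_right fun hv => ?_)
    rw [hS v hv]
    split_ifs with hvr
    · subst hvr; simp [hr0]
    · rfl
  have hX : ∀ v, vX N σ' r v = vM N σ v := by
    intro v
    by_cases hv : v < N
    · simp [vX, vM, hσ', State.set_apply, hv, hr, index_lt hr hv, index_div hv, index_mod hv]
    · simp [vX, vM, hv]
  refine ⟨⟨?_, hr, ?_, by rw [hE]; exact h.symm, by rw [hE, hM']; exact h.isMatch, by rw [hM', hM],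
    ?_, h.cert.congr hE hM' hS3, ?_⟩, hF, ?_⟩
  · rw [hF 6 (by simp), hN]
  · rw [hF 12 (by simp), hr']
  · intro v hv
    rw [hS v hv]
    have := h.status v hv
    split_ifs <;> omega
  · rw [hE, hM']
    constructor
    all_goals try simp only [hS1, hS2]
    · intro v _ hv; exact hv
    · exact hX
    · simp
    · rintro x rfl
      convert h.isMatch using 1
      funext v; exact hX v
    · rintro x rfl; rw [hX, hM]
    · rintro x v rfl (rfl | hv) hne <;> tauto
    · rintro x v rfl (rfl | hv)
      · rw [hX, hM]; simp
      · tauto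
    · rintro x v rfl - -; exact hX v
    all_goals simp
  · simp [hσ', State.set_apply]

/-- The hypotheses `h1` and `h2` say that no step is possible. The whole tree joins the certificate,
and the root is one more exposed vertex below `r + 1`, matching the increase of the deficiency by
one. -/
theorem run_freeze {B N r : ℕ} {σ : State} (hB : 2 ≤ B) (hNB : N * N ≤ B) (h : SInv N r σ)
    (h1 : ∀ x y, vS N σ 1 x → vE N σ x y → ¬ vS N σ 0 y)
    (h2 : ∀ x y, vS N σ 1 x → vS N σ 1 y → vE N σ x y → ∀ a, vS N σ 2 a →
      (vW N σ a x ↔ vW N σ a y)) :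
    Run B freezeP (freezeTime N) σ fun σ' => Inv N (r + 1) σ' ∧ Frame σ σ' ∧ σ' 13 0 = 0 := by
  have hN := h.size
  have hNB' : N ≤ B := by nlinarith
  refine Run.good fun hg => ?_
  refine Run.assign_then (fun i => if σ 9 i = 0 then 0 else 3)
    (by simp [Expr.val, hN]) hNB' (by omega) (by simp) (by rfl) (by rfl) (by rfl)
    (fun i hi => val_cond_lt (lit_lt hB (by simp)) (lit_lt hB (by simp)))
    (fun i hi => ?_) fun hg => ?_
  · simp [freezeS, val_cond, tt_get, val_ctr, val_lit]
  refine Run.put_to 0 (by simp) (by rfl) (by omega) (by positivity) rfl fun hg => ?_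
  clear hg
  set σ' := State.set _ 13 1 _ with hσ'
  have hF : Frame σ σ' := (Frame.set (by simp)).trans (Frame.set (by simp))
  have hE : vE N σ' = vE N σ := hF.vE
  have hM' : vM N σ' = vM N σ := by
    funext v; simp [vM, hσ', State.set_apply]
  have hS : ∀ v < N, σ' 9 v = if σ 9 v = 0 then 0 else 3 := by
    intro v hv; simp [hσ', State.set_apply, hv]
  have hS3 : ∀ v, vS N σ' 3 v ↔ vS N σ 1 v ∨ vS N σ 2 v ∨ vS N σ 3 v := by
    intro v
    unfold vS
    by_cases hv : v < N
    · have := h.status v hv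
      by_cases h0 : σ 9 v = 0
      · simp [h0, hS v hv]
      · simp only [hv, hS v hv, true_and, if_neg h0, true_iff]
        omega
    · simp [hv]
  have hS' := h.search
  refine ⟨⟨by rw [hF 6 (by simp), hN], by rw [hE]; exact h.symm,
    by rw [hE, hM']; exact h.isMatch, fun v hv => ?_, ?_⟩, hF, ?_⟩
  · rw [hS v hv]; split_ifs <;> simp
  · obtain ⟨Ds, As, c1, c2, c3, c4, c5, c6⟩ := h.cert
    let Dn := (Finset.range N).filter fun v => σ 9 v = 1
    let An := (Finset.range N).filter fun v => σ 9 v = 2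
    have hD : ∀ v, v ∈ Dn ↔ vS N σ 1 v := by simp [Dn, vS]
    have hA : ∀ v, v ∈ An ↔ vS N σ 2 v := by simp [An, vS]
    have hnot : ∀ s v, s ≠ 3 → vS N σ s v → v ∉ Ds ∧ v ∉ As := by
      intro s v hs hv
      have := c2 v
      have h3 : ¬ vS N σ 3 v := fun h3 => hs (hv.2.symm.trans h3.2)
      tauto
    have hcard : ((Finset.range (r + 1)).filter fun v => vM N σ v = v).card =
        ((Finset.range r).filter fun v => vM N σ v = v).card + 1 := by
      rw [Finset.range_add_one, Finset.filter_insert, if_pos h.exposed,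
        Finset.card_insert_of_notMem (by simp)]
    refine ⟨Ds ∪ Dn, As ∪ An, ?_, ?_, ?_, ?_, ?_, ?_⟩
    · rw [hE, hM', hcard]
      refine c1.extend h.symm hS' hD hA h2 ?_ (fun v => hnot 1 v (by simp))
        (fun v => hnot 2 v (by simp))
      intro x y hx hxy
      have h3 := h1 x y hx hxy
      have hy : y < N := hxy.1.2
      have := h.status y hy
      have h4 := c2 y
      unfold vS at h3 h4 ⊢
      simp only [hy, true_and] at *
      rw [← h4]; omega
    · intro v
      rw [hS3, Finset.mem_union, Finset.mem_union, hD, hA, c2]; tauto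
    · rw [hM']
      intro v hv
      rw [Finset.mem_union, hA] at hv
      rcases hv with hv | hv
      · exact c3 v hv
      · rw [← hS'.rootX]
        exact hS'.cover r v hS'.rootD (Or.inr hv) fun hvr => hS'.disj r hS'.rootD (hvr ▸ hv)
    · intro v
      rw [hM', hS3, hS3]
      have h3 := hS'.closed r v hS'.rootD
      rw [hS'.rootX] at h3
      have := c4 v
      tauto
    · rw [hM']
      intro v hv hvM
      rw [Finset.mem_union, hD] at hv
      rcases hv with hv | hv
      · have := c5 v hv hvM; omega
      · rw [← hS'.rootX] at hvM
        by_contra hlt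
        exact hS'.cover r v hS'.rootD (Or.inl hv) (by omega) hvM
    · rw [hM']
      intro v hv hvM
      rw [hS3]
      rcases Nat.lt_succ_iff_lt_or_eq.1 hv with hv | rfl
      · exact Or.inr (Or.inr (c6 v hv hvM))
      · exact Or.inl hS'.rootD
  · simp [hσ', State.set_apply]

/-- Adding the edge `x y` to `X x` covers the root and `y`. Frozen vertices keep their partners, so
the old certificate remains valid. -/
theorem run_augment {B N r x y : ℕ} {σ : State} (hB : 2 ≤ B) (hNB : N * N ≤ B) (h : SInv N r σ)
    (hx' : σ 15 0 = x) (hy' : σ 16 0 = y) (hx : vS N σ 1 x) (hy : vS N σ 0 y)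
    (hxy : vE N σ x y) (hMy : vM N σ y = y) :
    Run B augmentP (augmentTime N) σ fun σ' => Inv N (r + 1) σ' ∧ Frame σ σ' ∧ σ' 13 0 = 0 := by
  have hN := h.size
  have hNB' : N ≤ B := by nlinarith
  refine Run.good fun hg => ?_
  refine Run.assign_then (fun i => if i = x then y else if i = y then x else σ 10 (x * N + i))
    (by simp [Expr.val, hN]) hNB' (by omega) (by simp) (by rfl) (by rfl) (by rfl)
    (fun i hi => val_cond_lt (hg.get_lt (by simp)) (val_cond_lt (hg.get_lt (by simp))
      (hg.get_lt (by simp)))) (fun i hi => ?_) fun hg => ?_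
  · simp [augmentM, val_cond, tt_eq, val_ctr, val_get, val_add, val_mul, val_lit, hx', hy', hN]
  refine Run.assign_then (fun i => if σ 9 i = 3 then 3 else 0)
    (by simp [Expr.val, hN, State.set]) hNB' (by omega) (by simp) (by rfl) (by rfl) (by rfl)
    (fun i hi => val_cond_lt (lit_lt hB (by simp)) (lit_lt hB (by simp)))
    (fun i hi => ?_) fun hg => ?_
  · simp [augmentS, val_cond, tt_eq, val_get, val_ctr, val_lit, State.set_apply]
  refine Run.put_to 0 (by simp) (by rfl) (by omega) (by positivity) rfl fun hg => ?_
  clear hg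
  set σ' := State.set _ 13 1 _ with hσ'
  have hF : Frame σ σ' :=
    ((Frame.set (by simp)).trans (Frame.set (by simp))).trans (Frame.set (by simp))
  have hE : vE N σ' = vE N σ := hF.vE
  have hS' := h.search
  have hM' : ∀ v, vM N σ' v = if v = x then y else if v = y then x else vX N σ x v := by
    intro v
    have := hx.1
    have := hy.1
    by_cases hv : v < N
    · simp [vM, vX, hσ', State.set_apply, hv, hx.1]
    · have : v ≠ x := by omega
      have : v ≠ y := by omega
      simp [vM, vX, *]
  have hS : ∀ v < N, σ' 9 v = if σ 9 v = 3 then 3 else 0 := by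
    intro v hv; simp [hσ', State.set_apply, hv]
  have hS3 : ∀ v, vS N σ' 3 v ↔ vS N σ 3 v := by
    intro v
    refine and_congr_right fun hv => ?_
    rw [hS v hv]; split_ifs <;> simp [*]
  have hne : x ≠ y := by rintro rfl; exact absurd (hx.2.symm.trans hy.2) (by simp)
  have hryne : r ≠ y := by rintro rfl; exact absurd (hS'.rootD.2.symm.trans hy.2) (by simp)
  have hdiff : ∀ {s t v}, s ≠ t → vS N σ s v → ¬ vS N σ t v := fun hst h1 h2 =>
    hst (h1.2.symm.trans h2.2)
  have hXy : vX N σ x y = y := by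
    rw [hS'.outside x y hx (hdiff (by simp) hy) (hdiff (by simp) hy), hMy]
  have hMx : ∀ v, vS N σ 3 v → vM N σ' v = vM N σ v := by
    intro v hv
    have h1 : v ≠ x := by rintro rfl; exact hdiff (by simp) hx hv
    have h2 : v ≠ y := by rintro rfl; exact hdiff (by simp) hy hv
    rw [hM', if_neg h1, if_neg h2, hS'.outside x v hx (hdiff (by simp) hv) (hdiff (by simp) hv)]
  refine ⟨⟨by rw [hF 6 (by simp), hN], by rw [hE]; exact h.symm, ?_, fun v hv => ?_, ?_⟩, hF, ?_⟩
  · rw [hE]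
    have := (hS'.isMatch x hx).swap h.symm (hS'.fixed x hx) hxy hne
    convert this using 1
    funext v
    rw [hM', hXy]
    grind
  · rw [hS v hv]; split_ifs <;> simp
  · obtain ⟨Ds, As, c1, c2, c3, c4, c5, c6⟩ := h.cert
    -- No new exposed vertex below `r + 1` appears or disappears: the root becomes covered, `y` is
    -- not below `r` since it was exposed but not frozen, the other tree vertices are covered before
    -- and after, and everything else is unchanged.
    have hfix : ((Finset.range (r + 1)).filter fun v => vM N σ' v = v) =
        (Finset.range r).filter fun v => vM N σ v = v := by
      have hr' : vM N σ' r ≠ r := by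
        rw [hM']
        have := hS'.cover x r hx (Or.inl hS'.rootD)
        grind
      rw [Finset.range_add_one, Finset.filter_insert, if_neg hr']
      refine Finset.filter_congr fun v hv => ?_
      have hvr : v < r := Finset.mem_range.1 hv
      have hvN : v < N := hvr.trans h.root
      by_cases h3 : vS N σ 3 v
      · rw [hMx v h3]
      by_cases hvy : v = y
      · subst hvy; exact absurd (c6 v hvr hMy) h3
      have hT : vS N σ 1 v ∨ vS N σ 2 v → (vM N σ' v = v ↔ vM N σ v = v) := by
        intro hT
        have e1 := hS'.cover x v hx hT
        have e2 := hS'.cover r v hS'.rootD hT (by omega)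
        rw [hS'.rootX] at e2
        rw [hM']
        grind
      by_cases hT' : vS N σ 1 v ∨ vS N σ 2 v
      · exact hT hT'
      · rw [hM', if_neg (by rintro rfl; exact hT' (Or.inl hx)), if_neg hvy,
          hS'.outside x v hx (by tauto) (by tauto)]
    refine ⟨Ds, As, by rw [hE, hfix]; exact c1, fun v => (hS3 v).trans (c2 v), ?_, ?_, ?_, ?_⟩
    · intro v hv
      rw [hMx v ((c2 v).2 (Or.inr hv))]; exact c3 v hv
    · intro v hv
      rw [hS3] at hv ⊢
      rw [hMx v hv]; exact c4 v hv
    · intro v hv hv'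
      rw [hMx v ((c2 v).2 (Or.inl hv))] at hv'
      have := c5 v hv hv'; omega
    · intro v hv hv'
      have : v ∈ (Finset.range (r + 1)).filter fun v => vM N σ' v = v := by
        simp [hv, hv']
      rw [hfix] at this
      simp only [Finset.mem_filter, Finset.mem_range] at this
      exact (hS3 v).2 (c6 v this.1 this.2)
  · simp [hσ', State.set_apply]

end Matching
end CapDom

namespace CapDom
namespace Matching
open CapDom.Expr

/-! ### Growing, merging and the termination of a search -/

/-- The number of outer vertices. -/
def outerCard (N : ℕ) (σ : State) : ℕ := ((Finset.range N).filter fun v => σ 9 v = 1).card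

theorem outerCard_lt {N : ℕ} {σ σ' : State} (h : ∀ v, vS N σ 1 v → vS N σ' 1 v) {v : ℕ}
    (hv : vS N σ' 1 v) (hv' : ¬ vS N σ 1 v) : outerCard N σ < outerCard N σ' := by
  refine Finset.card_lt_card (Finset.ssubset_iff_of_subset ?_ |>.2 ⟨v, ?_, ?_⟩)
  · intro u hu
    have := h u (by simpa [vS] using hu)
    simpa [vS] using this
  · simpa [vS] using hv
  · simpa [vS] using hv'

theorem run_grow {B N r x y : ℕ} {σ : State} (hB : 2 ≤ B) (hNB : N * N ≤ B) (h : SInv N r σ)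
    (hx' : σ 15 0 = x) (hy' : σ 16 0 = y) (hz' : σ 17 0 = vM N σ y) (hx : vS N σ 1 x)
    (hy : vS N σ 0 y) (hxy : vE N σ x y) (hMy : vM N σ y ≠ y) :
    Run B growP (growTime N) σ fun σ' => SInv N r σ' ∧ Frame σ σ' ∧ σ' 13 0 = σ 13 0 ∧
      outerCard N σ < outerCard N σ' := by
  have hN := h.size
  have hNB' : N ≤ B := by nlinarith
  have hS' := h.search
  have hdiff : ∀ {s t v}, s ≠ t → vS N σ s v → ¬ vS N σ t v := fun hst h1 h2 =>
    hst (h1.2.symm.trans h2.2)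
  set z := vM N σ y with hz
  have hMz : vM N σ z = y := h.isMatch.invol y
  have hzN : z < N := (h.isMatch.edge y hMy).1.2
  -- The tree and the frozen part are both closed under the matching, so the partner of a free
  -- vertex is free.
  have hz0 : vS N σ 0 z := by
    refine ⟨hzN, ?_⟩
    have h1 := hS'.closed r z hS'.rootD
    rw [hS'.rootX, hMz] at h1
    have h2 : ¬ vS N σ 3 z := fun h3 => by
      obtain ⟨Ds, As, -, -, -, c4, -⟩ := h.cert
      have := c4 z h3
      rw [hMz] at this
      exact hdiff (by simp) hy this
    have h3 := h.status z hzN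
    have h4 := hy.2
    unfold vS at h1 h2
    simp only [hzN, true_and, h4] at h1 h2
    omega
  refine Run.good fun hg => ?_
  refine Run.assign_then (fun i => if i / N = z then (if i % N = z then z else if i % N = x then y
      else if i % N = y then x else σ 10 (x * N + i % N)) else σ 10 i)
    (by simp [Expr.val, hN]) hNB (by omega) (by simp) (by rfl) (by rfl) (by rfl)
    (fun i hi => ?_) (fun i hi => ?_) fun hg => ?_
  · refine val_cond_lt (val_cond_lt ?_ (val_cond_lt ?_ (val_cond_lt ?_ ?_))) ?_ <;>
    exact hg.get_lt (by simp)
  · simp [growX, val_cond, tt_eq, val_ctr, val_lit, val_get, val_div, val_mod, val_add, val_mul,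
      hx', hy', hz', hN]
  refine Run.assign_then (fun i => if i / N = y then (if i % N = z then 1 else 0) else
      if σ 11 (i / N * N + x) ≠ 0 ∧ (i % N = y ∨ i % N = z) then 1 else σ 11 i)
    (by simp [Expr.val, hN, State.set]) hNB (by omega) (by simp) (by rfl) (by rfl) (by rfl)
    (fun i hi => ?_) (fun i hi => ?_) fun hg => ?_
  · refine val_cond_lt (val_cond_lt ?_ ?_) (val_cond_lt ?_ ?_) <;>
    first | exact hg.get_lt (by simp) | exact lit_lt hB (by simp)
  · simp [growW, val_cond, tt_eq, val_ctr, val_lit, val_get, val_div, val_mod, val_add, val_mul,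
      tt_and, tt_or, tt_get, hx', hy', hz', hN, State.set_apply]
  refine Run.assign_to (fun i => if i = y then 2 else if i = z then 1 else σ 9 i)
    (by simp [Expr.val, hN, State.set]) hNB' (by omega) (by simp) (by rfl) (by rfl) (by rfl)
    (fun i hi => ?_) (fun i hi => ?_) fun hg => ?_
  · refine val_cond_lt ?_ (val_cond_lt ?_ ?_) <;>
    first | exact hg.get_lt (by simp) | exact lit_lt hB (by simp)
  · simp [growS, val_cond, tt_eq, val_ctr, val_lit, val_get, hy', hz', State.set_apply]
  clear hg
  set σ' := State.set _ 9 N _ with hσ'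
  have hF : Frame σ σ' :=
    ((Frame.set (by simp)).trans (Frame.set (by simp))).trans (Frame.set (by simp))
  have hE : vE N σ' = vE N σ := hF.vE
  have hM' : vM N σ' = vM N σ := by
    funext v; simp [vM, hσ', State.set_apply]
  have hS : ∀ v < N, σ' 9 v = if v = y then 2 else if v = z then 1 else σ 9 v := by
    intro v hv; simp [hσ', State.set_apply, hv]
  have hS1 : vS N σ' 1 = fun v => vS N σ 1 v ∨ v = z := by
    funext v
    have := hy.2
    by_cases hv : v < N
    · simp only [vS, hv, hS v hv, true_and]; grind
    · have : v ≠ z := by omega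
      simp [vS, hv, this]
  have hS2 : vS N σ' 2 = fun v => vS N σ 2 v ∨ v = y := by
    funext v
    have := hz0.2
    by_cases hv : v < N
    · simp only [vS, hv, hS v hv, true_and]; grind
    · have : v ≠ y := by have := hy.1; omega
      simp [vS, hv, this]
  have hS3 : vS N σ' 3 = vS N σ 3 := by
    funext v
    have := hz0.2
    have := hy.2
    refine propext (and_congr_right fun hv => ?_)
    rw [hS v hv]; grind
  have hX : vX N σ' = fun u v => if u = z then (if v = z then z else if v = x then y else
      if v = y then x else vX N σ x v) else vX N σ u v := by
    funext u v
    have := hx.1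
    have := hy.1
    by_cases huv : u < N ∧ v < N
    · obtain ⟨hu, hv⟩ := huv
      simp [vX, hσ', State.set_apply, hu, hv, hx.1, index_lt hu hv, index_div hv, index_mod hv]
    · simp only [vX, if_neg huv]
      split_ifs <;> omega
  have hW : vW N σ' = fun u v => if u = y then v = z else
      vW N σ u v ∨ (vW N σ u x ∧ (v = y ∨ v = z)) := by
    funext u v
    have := hx.1
    have := hy.1
    by_cases huv : u < N ∧ v < N
    · obtain ⟨hu, hv⟩ := huv
      simp only [vW, hσ', State.set_apply, hu, hv, hx.1, index_lt hu hv, index_div hv, index_mod hv]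
      grind
    · simp only [vW, huv, false_and, false_or]
      grind
  refine ⟨⟨by rw [hF 6 (by simp), hN], h.root, by rw [hF 12 (by simp), h.root'],
    by rw [hE]; exact h.symm, by rw [hE, hM']; exact h.isMatch, by rw [hM', h.exposed], ?_,
    h.cert.congr hE hM' hS3, ?_⟩, hF, by simp [hσ', State.set_apply], ?_⟩
  · intro v hv
    rw [hS v hv]
    have := h.status v hv
    split_ifs <;> omega
  · rw [hE, hM', hS1, hS2, hX, hW]
    exact hS'.grow h.isMatch h.symm hx (hdiff (by simp) hy) (hdiff (by simp) hy) hxy hMy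
  · refine outerCard_lt (v := z) (fun v hv => ?_) ?_ (hdiff (by simp) hz0)
    · rw [hS1]; exact Or.inl hv
    · rw [hS1]; exact Or.inr rfl

theorem run_merge {B N r x y a : ℕ} {σ : State} (hB : 2 ≤ B) (hNB : N * N ≤ B) (h : SInv N r σ)
    (hx' : σ 15 0 = x) (hy' : σ 16 0 = y) (hx : vS N σ 1 x)
    (hy : vS N σ 1 y) (hxy : vE N σ x y) (ha : vS N σ 2 a) (hax : ¬ (vW N σ a x ↔ vW N σ a y)) :
    Run B mergeP (mergeTime N) σ fun σ' => SInv N r σ' ∧ Frame σ σ' ∧ σ' 13 0 = σ 13 0 ∧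
      outerCard N σ < outerCard N σ' := by
  classical
  have hN := h.size
  have hNB' : N ≤ B := by nlinarith
  have hS' := h.search
  have hdiff : ∀ {s t v}, s ≠ t → vS N σ s v → ¬ vS N σ t v := fun hst h1 h2 =>
    hst (h1.2.symm.trans h2.2)
  refine Run.good fun hg => ?_
  refine Run.assign_then (fun i => if σ 9 (i / N) = 2 ∧
      ¬ (σ 11 (i / N * N + x) ≠ 0 ↔ σ 11 (i / N * N + y) ≠ 0) then
      (if i % N = i / N then i / N else
        if σ 11 (i / N * N + i % N) ≠ 0 ↔ σ 11 (i / N * N + x) ≠ 0 then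
        (if i % N = x then y else σ 10 (x * N + i % N)) else
        (if i % N = y then x else σ 10 (y * N + i % N))) else σ 10 i)
    (by simp [Expr.val, hN]) hNB (by omega) (by simp) (by rfl) (by rfl) (by rfl)
    (fun i hi => ?_) (fun i hi => ?_) fun hg => ?_
  · refine val_cond_lt (val_cond_lt ?_ (val_cond_lt (val_cond_lt ?_ ?_) (val_cond_lt ?_ ?_))) ?_ <;>
    first
    | exact hg.get_lt (by simp)
    | (rw [val_div]
       exact (Nat.div_le_self _ _).trans_lt (hi.trans_le (hNB.trans B.lt_two_pow_self.le)))
  · simp only [mergeX, val_cond, tt_eq, val_ctr, val_lit, val_get, val_div, val_mod, val_add,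
      val_mul, tt_and, tt_get, tt_not, tt_iff, hx', hy', hN, ne_eq, not_false_eq_true,
      Nat.reduceEqDiff]
  refine Run.assign_to (fun i => if σ 9 i = 2 ∧
      ¬ (σ 11 (i * N + x) ≠ 0 ↔ σ 11 (i * N + y) ≠ 0) then 1 else σ 9 i)
    (by simp [Expr.val, hN, State.set]) hNB' (by omega) (by simp) (by rfl) (by rfl) (by rfl)
    (fun i hi => ?_) (fun i hi => ?_) fun hg => ?_
  · refine val_cond_lt ?_ ?_ <;>
    first | exact hg.get_lt (by simp) | exact lit_lt hB (by simp)
  · simp [mergeS, val_cond, tt_eq, val_ctr, val_lit, val_get, val_add, val_mul, tt_and, tt_not,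
      tt_iff, tt_get, hx', hy', hN, State.set_apply]
  clear hg
  set σ' := State.set _ 9 N _ with hσ'
  have hF : Frame σ σ' := (Frame.set (by simp)).trans (Frame.set (by simp))
  have hE : vE N σ' = vE N σ := hF.vE
  have hM' : vM N σ' = vM N σ := by
    funext v; simp [vM, hσ', State.set_apply]
  have hWx : ∀ u v, u < N → v < N → (σ 11 (u * N + v) ≠ 0 ↔ vW N σ u v) := by
    intro u v hu hv; simp [vW, hu, hv]
  have hW : vW N σ' = vW N σ := by
    funext u v; simp [vW, hσ', State.set_apply]
  have hS : ∀ v < N, σ' 9 v = if vS N σ 2 v ∧ ¬ (vW N σ v x ↔ vW N σ v y) then 1 else σ 9 v := by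
    intro v hv
    simp only [← hWx v x hv hx.1, ← hWx v y hv hy.1, vS, hv, true_and]
    simp [hσ', State.set_apply, hv]
  have hS1 : vS N σ' 1 = fun v => vS N σ 1 v ∨ (vS N σ 2 v ∧ ¬ (vW N σ v x ↔ vW N σ v y)) := by
    funext v
    by_cases hv : v < N
    · simp only [show vS N σ' 1 v = (v < N ∧ σ' 9 v = 1) from rfl, hv, hS v hv, true_and]
      split_ifs with h1
      · simp [h1]
      · simp only [h1, or_false]; simp [vS, hv]
    · simp [vS, hv]
  have hS2 : vS N σ' 2 = fun v => vS N σ 2 v ∧ (vW N σ v x ↔ vW N σ v y) := by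
    funext v
    by_cases hv : v < N
    · simp only [show vS N σ' 2 v = (v < N ∧ σ' 9 v = 2) from rfl, hv, hS v hv, true_and]
      split_ifs with h1
      · simp [h1]
      · have : σ 9 v = 2 ↔ vS N σ 2 v := by simp [vS, hv]
        rw [this]
        simp only [eq_iff_iff]; tauto
    · simp [vS, hv]
  have hS3 : vS N σ' 3 = vS N σ 3 := by
    funext v
    refine propext (and_congr_right fun hv => ?_)
    rw [hS v hv]
    split_ifs with h1
    · simp [h1.1.2]
    · rfl
  have hX : vX N σ' = fun u v => if vS N σ 2 u ∧ ¬ (vW N σ u x ↔ vW N σ u y) then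
      (if v = u then u else if vW N σ u v ↔ vW N σ u x then (if v = x then y else vX N σ x v)
        else (if v = y then x else vX N σ y v)) else vX N σ u v := by
    funext u v
    have := hx.1
    have := hy.1
    by_cases huv : u < N ∧ v < N
    · obtain ⟨hu, hv⟩ := huv
      simp only [← hWx u v hu hv, ← hWx u x hu hx.1, ← hWx u y hu hy.1, vS, hu, true_and]
      simp [vX, hσ', State.set_apply, hu, hv, hx.1, hy.1, index_lt hu hv, index_div hv,
        index_mod hv]
    · simp only [vX, if_neg huv, vS]
      split_ifs <;> omega
  refine ⟨⟨by rw [hF 6 (by simp), hN], h.root, by rw [hF 12 (by simp), h.root'],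
    by rw [hE]; exact h.symm, by rw [hE, hM']; exact h.isMatch, by rw [hM', h.exposed], ?_,
    h.cert.congr hE hM' hS3, ?_⟩, hF, by simp [hσ', State.set_apply], ?_⟩
  · intro v hv
    rw [hS v hv]
    have := h.status v hv
    split_ifs <;> omega
  · rw [hE, hM', hS1, hS2, hX, hW]
    exact hS'.merge h.symm hx hy hxy
  · refine outerCard_lt (v := a) (fun v hv => ?_) ?_ (hdiff (by simp) ha)
    · rw [hS1]; exact Or.inl hv
    · rw [hS1]; exact Or.inr ⟨ha, hax⟩

theorem run_step {B N r : ℕ} {σ : State} (hB : 2 ≤ B) (hNB : N * N * N ≤ B) (h : SInv N r σ)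
    (hgo : σ 13 0 ≠ 0) :
    Run B stepP (stepTime N) σ fun σ' => Frame σ σ' ∧
      ((SInv N r σ' ∧ σ' 13 0 ≠ 0 ∧ outerCard N σ < outerCard N σ') ∨
        (Inv N (r + 1) σ' ∧ σ' 13 0 = 0)) := by
  have hN := h.size
  have hN0 : 0 < N := by have := h.root; omega
  have hNB2 : N * N ≤ B := le_trans (Nat.le_mul_of_pos_right _ hN0) hNB
  have hNB1 : N ≤ B := le_trans (Nat.le_mul_of_pos_right _ hN0) hNB2
  have hS' := h.search
  -- In base `N`, the number `q` encodes a triple: an outer vertex, the other end of the edge, and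
  -- an inner vertex that the edge separates. The last digit matters only for merging.
  have hscan : ∀ q < N * N * N, scanE.tt σ q ↔ vS N σ 1 (q / (N * N)) ∧
      vE N σ (q / (N * N)) (q / N % N) ∧ (vS N σ 0 (q / N % N) ∨ (vS N σ 1 (q / N % N) ∧
        vS N σ 2 (q % N) ∧
        ¬ (vW N σ (q % N) (q / (N * N)) ↔ vW N σ (q % N) (q / N % N)))) := by
    intro q hq
    have h1 : q / (N * N) < N := by
      rw [Nat.div_lt_iff_lt_mul (by positivity)]; nlinarith
    have h2 : q / N % N < N := Nat.mod_lt _ hN0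
    have h3 : q % N < N := Nat.mod_lt _ hN0
    simp [scanE, tt_and, tt_eq, tt_or, tt_get, tt_not, tt_iff, val_get, val_div, val_mod, val_mul,
      val_add, val_ctr, val_lit, hN, vS, vE, vW, h1, h2, h3, and_assoc]
  have hdec : ∀ x y a, x < N → y < N → a < N → (x * (N * N) + (y * N + a)) < N * N * N ∧
      (x * (N * N) + (y * N + a)) / (N * N) = x ∧ (x * (N * N) + (y * N + a)) / N % N = y ∧
      (x * (N * N) + (y * N + a)) % N = a := by
    intro x y a hx hy ha
    have h1 := index_lt hy ha
    refine ⟨?_, ?_, ?_, ?_⟩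
    · nlinarith
    · rw [mul_comm, Nat.mul_add_div (by positivity), Nat.div_eq_of_lt h1, add_zero]
    · rw [show x * (N * N) + (y * N + a) = (x * N + y) * N + a by ring, index_div ha, index_mod hy]
    · rw [show x * (N * N) + (y * N + a) = (x * N + y) * N + a by ring, index_mod ha]
  refine Run.good fun hg => ?_
  refine Run.seq (R := fun σ' => (σ' = σ.set 14 1 (fun _ => 0) ∧ ∀ q < N * N * N, ¬ scanE.tt σ q) ∨
    ∃ q < N * N * N, σ' = σ.set 14 1 (fun _ => q + 1) ∧ scanE.tt σ q) ?_ ?_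
  · refine Run.find (by simp [Expr.val, hN]) hNB (by omega) (by simp) (by rfl) (by rfl) (by rfl)
      (by rfl) (fun h => Or.inl ⟨rfl, h⟩) (fun q hq h => Or.inr ⟨q, hq, rfl, h⟩)
  intro σ₁ hg₁ hσ₁
  refine Run.ite (by rfl) (fun hb => ?_) (fun hb => ?_)
  · obtain ⟨q, hq, rfl, hs⟩ : ∃ q < N * N * N, σ₁ = σ.set 14 1 (fun _ => q + 1) ∧ scanE.tt σ q := by
      refine hσ₁.resolve_left ?_
      rintro ⟨rfl, -⟩
      exact hb (by simp [State.set, Expr.val])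
    obtain ⟨hx, hxy, hcase⟩ := (hscan q hq).1 hs
    set x := q / (N * N) with hxd
    set y := q / N % N with hyd
    have hyN := hxy.1.2
    have hxB : x < 2 ^ B := hxy.1.1.trans_le (hNB1.trans B.lt_two_pow_self.le)
    have hyB : y < 2 ^ B := hyN.trans_le (hNB1.trans B.lt_two_pow_self.le)
    refine Run.mono (T := decTime + (freeE.cw + 1 +
      ((exposedE.cw + 1 + (augmentTime N + growTime N)) + mergeTime N))) ?_ (Nat.le_add_right _ _)
      fun _ _ h => h
    have hM8 : vM N σ y = σ 8 y := by simp [vM, hyN]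
    refine Run.seq (R := fun σ' => σ' = (((σ.set 14 1 fun _ => q + 1).set 15 1 fun _ => x).set 16 1
      fun _ => y).set 17 1 fun _ => vM N σ y) ?_ ?_
    · refine Run.put_then x (by simp) (by rfl) (by omega) hxB ?_ fun hg => ?_
      · simp [decX, val_div, val_sub, val_mul, val_lit, val_get, State.set_apply, hN, hxd]
      refine Run.put_then y (by simp) (by rfl) (by omega) hyB ?_ fun hg => ?_
      · simp [decY, val_div, val_mod, val_sub, val_lit, val_get, State.set_apply, hN, hyd]
      refine Run.put_to (vM N σ y) (by simp) (by rfl) (by omega) (hM8 ▸ hg 8 y) ?_ fun hg => rfl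
      simp [decZ, val_lit, val_get, State.set_apply, hM8]
    rintro σ₂ hg₂ hσ₂
    have hF : Frame σ σ₂ := hσ₂ ▸ (((Frame.set (by simp)).trans (Frame.set (by simp))).trans
      (Frame.set (by simp))).trans (Frame.set (by simp))
    have heq : ∀ b, b ≠ 14 → b ≠ 15 → b ≠ 16 → b ≠ 17 → σ₂ b = σ b := by
      intro b h1 h2 h3 h4
      rw [hσ₂, State.set_of_ne h4, State.set_of_ne h3, State.set_of_ne h2, State.set_of_ne h1]
    have hE : vE N σ₂ = vE N σ := hF.vE
    have hM : vM N σ₂ = vM N σ := by unfold vM; rw [heq 8] <;> simp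
    have hS : ∀ s, vS N σ₂ s = vS N σ s := by intro s; unfold vS; rw [heq 9] <;> simp
    have hX : vX N σ₂ = vX N σ := by unfold vX; rw [heq 10] <;> simp
    have hW : vW N σ₂ = vW N σ := by unfold vW; rw [heq 11] <;> simp
    have hO : outerCard N σ₂ = outerCard N σ := by unfold outerCard; rw [heq 9] <;> simp
    have h15 : σ₂ 15 0 = x := by rw [hσ₂]; simp [State.set_apply]
    have h16 : σ₂ 16 0 = y := by rw [hσ₂]; simp [State.set_apply]
    have h17 : σ₂ 17 0 = vM N σ y := by rw [hσ₂]; simp [State.set_apply]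
    have h13 : σ₂ 13 0 = σ 13 0 := by rw [heq 13] <;> simp
    have hI : SInv N r σ₂ := by
      refine ⟨by rw [heq 6, hN] <;> simp, h.root, by rw [heq 12, h.root'] <;> simp,
        by rw [hE]; exact h.symm, by rw [hE, hM]; exact h.isMatch, by rw [hM, h.exposed],
        by rw [heq 9 (by simp) (by simp) (by simp) (by simp)]; exact h.status,
        h.cert.congr hE hM (hS 3), by rw [hE, hM, hS, hS, hX, hW]; exact hS'⟩
    have hpost : ∀ σ', SInv N r σ' ∧ Frame σ₂ σ' ∧ σ' 13 0 = σ₂ 13 0 ∧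
        outerCard N σ₂ < outerCard N σ' → Frame σ σ' ∧
      ((SInv N r σ' ∧ σ' 13 0 ≠ 0 ∧ outerCard N σ < outerCard N σ') ∨
        (Inv N (r + 1) σ' ∧ σ' 13 0 = 0)) := by
      rintro σ' ⟨h1, h2, h3, h4⟩
      exact ⟨hF.trans h2, Or.inl ⟨h1, by rwa [h3, h13], hO ▸ h4⟩⟩
    refine Run.ite (by rfl) (fun hb => ?_) (fun hb => ?_)
    · refine Run.mono (T := exposedE.cw + 1 + (augmentTime N + growTime N)) ?_
        (Nat.le_add_right _ _) fun _ _ h => h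
      have hb' : σ 9 y = 0 := by
        have : freeE.tt σ₂ 0 := hb
        simpa [freeE, tt_eq, val_get, val_lit, h16, heq 9] using this
      have hy0 : vS N σ 0 y := ⟨hyN, hb'⟩
      refine Run.ite (by rfl) (fun hb => ?_) (fun hb => ?_)
      · have hb' : vM N σ y = y := by
          have : exposedE.tt σ₂ 0 := hb
          simpa [exposedE, tt_eq, val_get, val_lit, h16, h17] using this
        refine (run_augment hB hNB2 hI h15 h16 (by rwa [hS]) (by rwa [hS]) (by rwa [hE])
          (by rwa [hM])).mono (Nat.le_add_right _ _) ?_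
        rintro σ' - ⟨h1, h2, h3⟩
        exact ⟨hF.trans h2, Or.inr ⟨h1, h3⟩⟩
      · have hb' : vM N σ y ≠ y := by
          have : ¬ exposedE.tt σ₂ 0 := fun h => h hb
          simpa [exposedE, tt_eq, val_get, val_lit, h16, h17] using this
        exact (run_grow hB hNB2 hI h15 h16 (by rw [hM, h17]) (by rwa [hS]) (by rwa [hS])
          (by rwa [hE]) (by rwa [hM])).mono (Nat.le_add_left _ _) fun σ' _ h => hpost σ' h
    · have hb' : σ 9 y ≠ 0 := by
        have : ¬ freeE.tt σ₂ 0 := fun h => h hb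
        simpa [freeE, tt_eq, val_get, val_lit, h16, heq 9] using this
      obtain ⟨hy1, ha, hax⟩ := hcase.resolve_left fun h => hb' h.2
      exact (run_merge hB hNB2 hI h15 h16 (by rwa [hS]) (by rwa [hS]) (by rwa [hE])
        (by rwa [hS]) (by rwa [hW])).mono (Nat.le_add_left _ _) fun σ' _ h => hpost σ' h
  · obtain ⟨rfl, hs⟩ : σ₁ = σ.set 14 1 (fun _ => 0) ∧ ∀ q < N * N * N, ¬ scanE.tt σ q := by
      refine hσ₁.resolve_right ?_
      rintro ⟨q, -, rfl, -⟩
      simp [State.set, Expr.val] at hb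
    have hF : Frame σ (σ.set 14 1 fun _ => 0) := Frame.set (by simp)
    have hE : vE N (σ.set 14 1 fun _ => 0) = vE N σ := hF.vE
    have hI : SInv N r (σ.set 14 1 fun _ => 0) :=
      ⟨hN, h.root, h.root', by rw [hE]; exact h.symm, by rw [hE]; exact h.isMatch, h.exposed,
        h.status, h.cert.congr hE rfl rfl, by rw [hE]; exact hS'⟩
    refine (run_freeze hB hNB2 hI ?_ ?_).mono (Nat.le_add_left _ _) ?_
    · intro x y hx hxy hy
      -- For a free `y` any third digit would do.
      obtain ⟨e1, e2, e3, e4⟩ := hdec x y 0 hx.1 hy.1 hN0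
      refine hs _ e1 ((hscan _ e1).2 ?_)
      rw [e2, e3]
      exact ⟨hx, hE ▸ hxy, Or.inl hy⟩
    · intro x y hx hy hxy a ha
      by_contra hcon
      obtain ⟨e1, e2, e3, e4⟩ := hdec x y a hx.1 hy.1 ha.1
      refine hs _ e1 ((hscan _ e1).2 ?_)
      rw [e2, e3, e4]
      exact ⟨hx, hE ▸ hxy, Or.inr ⟨hy, ha, hcon⟩⟩
    · rintro σ' - ⟨h1, h2, h3⟩
      exact ⟨hF.trans h2, Or.inr ⟨h1, h3⟩⟩

theorem run_search {B N r : ℕ} {σ : State} (hB : 2 ≤ B) (hNB : N * N * N ≤ B) (h : Inv N r σ)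
    (hr : r < N) (hr' : σ 12 0 = r) (hM : vM N σ r = r) :
    Run B searchP (searchTime N) σ fun σ' => Inv N (r + 1) σ' ∧ Frame σ σ' := by
  have hN0 : 0 < N := by omega
  have hNB2 : N * N ≤ B := le_trans (Nat.le_mul_of_pos_right _ hN0) hNB
  refine Run.seq (run_init hB hNB2 h hr hr' hM) ?_
  rintro σ₁ - ⟨h1, h2, h3⟩
  refine (Run.loop (by rfl) (fun σ' => Frame σ σ' ∧ ((SInv N r σ' ∧ σ' 13 0 ≠ 0) ∨
    (Inv N (r + 1) σ' ∧ σ' 13 0 = 0)))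
    -- Every unfinished step creates an outer vertex, and there are at most `N` of them. Starting
    -- from `N + 1` keeps the measure positive until the flag ends the search.
    (fun σ' => if σ' 13 0 = 0 then 0 else N + 1 - outerCard N σ') ?_
    ⟨h2, Or.inl ⟨h1, by omega⟩⟩ (K := N + 1) ?_).mono le_rfl ?_
  · rintro σ' - ⟨hF, hI⟩ hb
    have hb' : σ' 13 0 ≠ 0 := by simpa [Expr.val] using hb
    have hI' := hI.resolve_right fun h => hb' h.2
    refine (run_step hB hNB hI'.1 hb').mono le_rfl ?_
    have hle : ∀ σ'', outerCard N σ'' ≤ N := fun σ'' =>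
      (Finset.card_filter_le _ _).trans (by simp)
    rintro σ'' - ⟨hF', ⟨e1, e2, e3⟩ | ⟨e1, e2⟩⟩
    · refine ⟨⟨hF.trans hF', Or.inl ⟨e1, e2⟩⟩, ?_⟩
      rw [if_neg e2, if_neg hb']
      have := hle σ''
      omega
    · refine ⟨⟨hF.trans hF', Or.inr ⟨e1, e2⟩⟩, ?_⟩
      rw [if_pos e2, if_neg hb']
      have := hle σ'
      omega
  · split_ifs <;> omega
  · rintro σ' - ⟨⟨hF, hI⟩, hb⟩
    have hb' : σ' 13 0 = 0 := by simpa [Expr.val] using hb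
    exact ⟨(hI.resolve_left fun h => h.2 hb').1, hF⟩

/-! ### The loop over all roots -/

/-- The root is exposed. -/
def rootE : Expr := .eq (.get 8 (.var 12)) (.var 12)
/-- The next root. -/
def nextE : Expr := .add (.var 12) (.lit 1)
/-- The search for one root. -/
def rootP : Prog := .seq (.ite rootE searchP .nop) (.put 12 nextE)
/-- Time bound for `rootP`. -/
def rootTime (N : ℕ) : ℕ := (rootE.cw + 1 + (searchTime N + 1)) + (1 + nextE.cw + 1)
/-- There are roots left. -/
def leftE : Expr := .lt (.var 12) eN
/-- Compute a maximum matching, given the number of vertices and the adjacency matrix. -/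
def matchP : Prog := .seq (.assign 8 eN ctr) (.seq (.assign 9 eN (.lit 0))
  (.seq (.put 12 (.lit 0)) (.loop leftE rootP)))
/-- Time bound for `matchP`. -/
def matchTime (N : ℕ) : ℕ := assignTime eN ctr N + (assignTime eN (.lit 0) N +
  ((1 + (Expr.lit 0).cw + 1) + (N * (leftE.cw + 1 + rootTime N) + (leftE.cw + 1))))

/-- The arrays that are not touched by the computation of a maximum matching. -/
def Frame' (σ σ' : State) : Prop := ∀ b, b < 8 ∨ 17 < b → σ' b = σ b

theorem Frame'.trans {σ σ' σ'' : State} (h : Frame' σ σ') (h' : Frame' σ' σ'') : Frame' σ σ'' :=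
  fun b hb => (h' b hb).trans (h b hb)

theorem Frame'.set {σ : State} {a L : ℕ} {g : ℕ → ℕ} (ha : 8 ≤ a ∧ a ≤ 17) :
    Frame' σ (σ.set a L g) := fun b hb => State.set_of_ne (by omega)

theorem Frame.weaken {σ σ' : State} (h : Frame σ σ') : Frame' σ σ' := fun b hb => h b (by omega)

/-- One search per root suffices: once root `r` has been handled, every exposed vertex up to `r` is
frozen for good. After the last root the certificate counts all exposed vertices, and by
`Frozen.le_card` no matching exposes fewer. -/
theorem run_match {B N : ℕ} {σ : State} (hB : 2 ≤ B) (hNB : N * N * N ≤ B) (hNB' : N < B)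
    (hN : σ 6 0 = N) (hsymm : ∀ u v, vE N σ u v → vE N σ v u) :
    Run B matchP (matchTime N) σ fun σ' => Frame' σ σ' ∧ IsMatch (vE N σ) (vM N σ') ∧
      ∀ M, IsMatch (vE N σ) M → ((Finset.range N).filter fun v => vM N σ' v = v).card ≤
        ((Finset.range N).filter fun v => M v = v).card := by
  have hB2 := B.lt_two_pow_self
  refine Run.good fun hg => ?_
  refine Run.assign_then (fun i => i) (by simp [Expr.val, hN]) hNB'.le (by omega) (by simp) (by rfl)
    (by rfl) (by rfl) (fun i hi => by rw [val_ctr]; omega) (fun i hi => rfl) fun _ => ?_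
  refine Run.assign_then (fun i => 0) (by simp [Expr.val, hN, State.set]) hNB'.le (by omega)
    (by simp) (by rfl) (by rfl) (by rfl) (fun i hi => lit_lt hB (by simp)) (fun i hi => rfl)
    fun _ => ?_
  refine Run.put_then 0 (by simp) (by rfl) (by omega) (by positivity) rfl fun _ => ?_
  set σ₁ := State.set _ 12 1 _ with hσ₁
  have hF : Frame' σ σ₁ :=
    ((Frame'.set (by simp)).trans (Frame'.set (by simp))).trans (Frame'.set (by simp))
  have hvE : ∀ {σ'}, Frame' σ σ' → vE N σ' = vE N σ := fun h => by
    unfold vE; rw [h 7 (by simp)]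
  have hM₁ : ∀ v, vM N σ₁ v = v := by
    intro v; simp only [vM, hσ₁, State.set_apply]; simp +contextual
  refine (Run.loop (by rfl) (fun σ' => Frame' σ σ' ∧ σ' 12 0 ≤ N ∧ Inv N (σ' 12 0) σ')
    (fun σ' => N - σ' 12 0) ?_ ⟨hF, ?_, ?_⟩ (Nat.sub_le _ _)).mono le_rfl ?_
  · rintro σ' hg ⟨hF', hle, hI⟩ hb
    have hN' : σ' 6 0 = N := hI.size
    have hr : σ' 12 0 < N := by
      have : leftE.tt σ' 0 := hb
      simpa [leftE, tt_lt, val_get, val_lit, hN'] using this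
    have hvM : vM N σ' (σ' 12 0) = σ' 8 (σ' 12 0) := by simp [vM, hr]
    refine Run.seq (R := fun σ'' => Inv N (σ' 12 0 + 1) σ'' ∧ Frame σ' σ'') ?_ ?_
    · refine Run.ite (by rfl) (fun hb => ?_) (fun hb => ?_)
      · refine (run_search hB hNB hI hr rfl ?_).mono (Nat.le_add_right _ _) fun _ _ h => h
        have : rootE.tt σ' 0 := hb
        rw [hvM]
        simpa [rootE, tt_eq, val_get, val_lit] using this
      · refine (Run.nop ⟨⟨hN', hI.symm, hI.isMatch, hI.status, ?_⟩, Frame.refl _⟩).mono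
          (Nat.le_add_left _ _) fun _ _ h => h
        have hb' : vM N σ' (σ' 12 0) ≠ σ' 12 0 := by
          have : ¬ rootE.tt σ' 0 := fun h => h hb
          rw [hvM]
          simpa [rootE, tt_eq, val_get, val_lit] using this
        obtain ⟨Ds, As, c1, c2, c3, c4, c5, c6⟩ := hI.cert
        refine ⟨Ds, As, ?_, c2, c3, c4, fun v hv h => (c5 v hv h).trans (Nat.lt_succ_self _), ?_⟩
        · rw [Finset.range_add_one, Finset.filter_insert, if_neg hb']; exact c1
        · intro v hv h
          rcases Nat.lt_succ_iff_lt_or_eq.1 hv with hv | rfl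
          exacts [c6 v hv h, absurd h hb']
    · rintro σ'' - ⟨hI'', hF''⟩
      have h12 : σ'' 12 0 = σ' 12 0 := by rw [hF'' 12 (by simp)]
      refine Run.put_to (σ' 12 0 + 1) (by simp) (by rfl) (by omega) (by omega)
        (by simp [nextE, val_add, val_get, val_lit, h12]) fun _ => ?_
      set σ₃ := State.set _ 12 1 _ with hσ₃
      have h3 : σ₃ 12 0 = σ' 12 0 + 1 := by simp [hσ₃, State.set]
      have hEq : vE N σ₃ = vE N σ'' := rfl
      refine ⟨⟨(hF'.trans hF''.weaken).trans (Frame'.set (by simp)), by omega, ?_⟩, by omega⟩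
      rw [h3]
      exact ⟨hI''.size, hI''.symm, hI''.isMatch, hI''.status, hI''.cert.congr hEq rfl rfl⟩
  · simp [hσ₁, State.set]
  · have h0 : σ₁ 12 0 = 0 := by simp [hσ₁, State.set]
    rw [h0]
    refine ⟨by rw [hF 6 (by simp), hN], by rw [hvE hF]; exact hsymm,
      ⟨fun v => by rw [hM₁, hM₁], fun v hv => absurd (hM₁ v) hv⟩, fun v hv => Or.inl ?_, ?_⟩
    · simp [hσ₁, State.set_apply, hv]
    · refine ⟨∅, ∅, by simpa using frozen_empty, fun v => ?_, by simp, fun v hv => ?_, by simp,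
        by simp⟩
      · simp only [vS, hσ₁, State.set_apply]; simp +contextual
      · simp only [vS, hσ₁, State.set_apply] at hv
        obtain ⟨h1, h2⟩ := hv
        simp [h1] at h2
  · rintro σ' - ⟨⟨hF', hle, hI⟩, hb⟩
    have hr : σ' 12 0 = N := by
      have hN' : σ' 6 0 = N := hI.size
      have : ¬ leftE.tt σ' 0 := fun h => h hb
      have : ¬ σ' 12 0 < N := by simpa [leftE, tt_lt, val_get, val_lit, hN'] using this
      omega
    rw [hr] at hI
    refine ⟨hF', hvE hF' ▸ hI.isMatch, fun M hM => ?_⟩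
    obtain ⟨Ds, As, c1, c2, -⟩ := hI.cert
    rw [← hvE hF'] at hM
    refine (c1.le_card hM).trans (Finset.card_le_card (Finset.filter_subset_filter _ ?_))
    intro v hv
    exact Finset.mem_range.2 ((c2 v).2 (Or.inl hv)).1

end Matching
end CapDom

namespace CapDom

/-! ## Simplified instances as matching problems

The pair `(w, i)` with `w, i < n` is encoded by `w * n + i`.  A vertex `w ∉ U` is represented by
`(w, 0)`, a vertex `w ∈ U` by its copies `(w, i)` with `i < cap w`. -/

section

variable {n : ℕ} (G : SimpleGraph (Fin n)) (cap : Fin n → ℕ) (U : Finset (Fin n))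

/-- The pair `(w, i)` is a vertex of the matching problem. -/
def Alive (w : Fin n) (i : ℕ) : Prop := if w ∈ U then i < cap w else i = 0

/-- The adjacency relation of the matching problem. -/
def CopyAdj (x y : ℕ) : Prop :=
  ∃ (u v : Fin n) (i j : ℕ), (i < n ∧ j < n ∧ x = u * n + i ∧ y = v * n + j) ∧
    Alive cap U u i ∧ Alive cap U v j ∧ G.Adj u v ∧ ¬ (u ∈ U ∧ v ∈ U) ∧ 0 < cap u + cap v

variable {G cap U}

theorem CopyAdj.symm {x y : ℕ} (h : CopyAdj G cap U x y) : CopyAdj G cap U y x := by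
  obtain ⟨u, v, i, j, ⟨h1, h2, h3, h4⟩, h5, h6, h7, h8, h9⟩ := h
  exact ⟨v, u, j, i, ⟨h2, h1, h4, h3⟩, h6, h5, h7.symm, fun h => h8 h.symm, by omega⟩

theorem code_inj {u v : Fin n} {i j : ℕ} (hi : i < n) (hj : j < n)
    (h : (u : ℕ) * n + i = v * n + j) : u = v ∧ i = j := by
  have h1 := Matching.index_div (N := n) (u := u) hi
  have h2 := Matching.index_mod (N := n) (u := u) hi
  rw [h, Matching.index_div hj] at h1
  rw [h, Matching.index_mod hj] at h2
  exact ⟨Fin.ext h1.symm, h2.symm⟩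

theorem CopyAdj.lt {x y : ℕ} (h : CopyAdj G cap U x y) : x < n * n := by
  obtain ⟨u, v, i, j, ⟨h1, h2, h3, h4⟩, -⟩ := h
  exact h3 ▸ Matching.index_lt u.2 h1

/-! ### From a simplified solution to a matching -/

/-- A family of disjoint edges extends to a matching. -/
theorem exists_isMatch {V ι : Type*} {E : V → V → Prop} (hE : ∀ u v, E u v → E v u) (s t : ι → V)
    (hs : Function.Injective s) (ht : Function.Injective t) (hst : ∀ a b, s a ≠ t b)
    (h : ∀ a, E (s a) (t a)) :
    ∃ M, IsMatch E M ∧ (∀ a, M (s a) = t a) ∧ ∀ a, M (t a) = s a := by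
  classical
  let M : V → V := fun x => if h : ∃ a, s a = x then t h.choose else
    if h : ∃ a, t a = x then s h.choose else x
  have h1 : ∀ a, M (s a) = t a := by
    intro a
    have h : ∃ b, s b = s a := ⟨a, rfl⟩
    simp only [M, dif_pos h]
    rw [hs h.choose_spec]
  have h2 : ∀ a, M (t a) = s a := by
    intro a
    have h : ∃ b, t b = t a := ⟨a, rfl⟩
    have h' : ¬ ∃ b, s b = t a := fun ⟨b, hb⟩ => hst b a hb
    simp only [M, dif_neg h', dif_pos h]
    rw [ht h.choose_spec]
  refine ⟨M, ⟨fun v => ?_, fun v hv => ?_⟩, h1, h2⟩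
  all_goals
    by_cases hs' : ∃ a, s a = v
    · obtain ⟨a, rfl⟩ := hs'
      first | rw [h1, h2] | (rw [h1]; exact h a)
    by_cases ht' : ∃ a, t a = v
    · obtain ⟨a, rfl⟩ := ht'
      first | rw [h2, h1] | (rw [h2]; exact hE _ _ (h a))
    have : M v = v := by simp only [M, dif_neg hs', dif_neg ht']
    first | rw [this, this] | exact absurd this hv

/-- Each dominated vertex is matched to a copy of its dominator. The vertices dominated by the same
`w ∈ U` are numbered in increasing order and receive different copies of `w`; a dominator outside
`U` has just one preimage and one copy. -/
theorem IsSimplifiedSolution.exists_isMatch {T : Finset (Fin n)}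
    (h : IsSimplifiedSolution G cap U T) :
    ∃ M, IsMatch (CopyAdj G cap U) M ∧
      2 * (n - T.card) ≤ ((Finset.range (n * n)).filter fun x => M x ≠ x).card := by
  classical
  obtain ⟨hUT, f, ⟨hadj, hcap⟩, hone⟩ := h
  let ι := {v : Fin n // v ∉ T}
  let rank : ι → ℕ := fun v => (Finset.univ.filter fun v' : ι => f v' = f v ∧ v' < v).card
  have hrank : ∀ v, rank v < (f ⁻¹' {f v}).ncard := by
    intro v
    rw [Set.ncard_eq_toFinset_card']
    refine Finset.card_lt_card (Finset.ssubset_iff_of_subset ?_ |>.2 ⟨v, ?_, ?_⟩)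
    · intro u hu
      simp only [Finset.mem_filter] at hu
      simpa using hu.2.1
    · simp
    · exact fun h => lt_irrefl _ (Finset.mem_filter.1 h).2.2
  have hrank_inj : ∀ u v, f u = f v → rank u = rank v → u = v := by
    have hlt : ∀ u v, f u = f v → u < v → rank u < rank v := by
      intro u v huv hlt
      refine Finset.card_lt_card (Finset.ssubset_iff_of_subset ?_ |>.2 ⟨u, ?_, ?_⟩)
      · intro w hw
        simp only [Finset.mem_filter, Finset.mem_univ, true_and] at hw ⊢
        exact ⟨hw.1.trans huv, hw.2.trans hlt⟩
      · simp [huv, hlt]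
      · simp
    intro u v huv hr
    rcases lt_trichotomy u v with h | h | h
    · exact absurd hr (hlt u v huv h).ne
    · exact h
    · exact absurd hr.symm (hlt v u huv.symm h).ne
  have hpos : ∀ v : ι, 0 < n := fun v => v.1.pos
  have hrank_n : ∀ v, rank v < n := by
    intro v
    refine (hrank v).trans_le ?_
    have := Set.ncard_le_card (f ⁻¹' {f v})
    refine this.trans ?_
    rw [Nat.card_eq_fintype_card]
    exact (Fintype.card_subtype_le _).trans (by simp)
  let j : ι → ℕ := fun v => if (f v : Fin n) ∈ U then rank v else 0
  have hj : ∀ v, j v < n := by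
    intro v; dsimp only [j]; split_ifs
    exacts [hrank_n v, hpos v]
  let s : ι → ℕ := fun v => (v.1 : ℕ) * n + 0
  let t : ι → ℕ := fun v => ((f v).1 : ℕ) * n + j v
  have hsinj : Function.Injective s := fun u v huv =>
    Subtype.ext (code_inj (hpos u) (hpos u) huv).1
  have htinj : Function.Injective t := by
    intro u v huv
    obtain ⟨h1, h2⟩ := code_inj (hj u) (hj v) huv
    have h1' : f u = f v := Subtype.ext h1
    by_cases hU : (f u : Fin n) ∈ U
    · refine hrank_inj u v h1' ?_
      simpa [j, hU, h1 ▸ hU] using h2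
    · have := hone (f u) hU
      have h3 := Set.ncard_le_one (Set.toFinite _) |>.1 this
      exact h3 u (by simp) v (by simp [h1'])
  have hst : ∀ u v, s u ≠ t v := by
    intro u v huv
    obtain ⟨h1, -⟩ := code_inj (hpos u) (hj v) huv
    exact u.2 (h1 ▸ (f v).2)
  have hcappos : ∀ v : ι, 0 < cap (f v) := fun v =>
    lt_of_lt_of_le (Nat.zero_le _ |>.trans_lt (hrank v)) (hcap (f v))
  obtain ⟨M, hM, hM1, hM2⟩ := CapDom.exists_isMatch (E := CopyAdj G cap U)
    (fun _ _ => CopyAdj.symm) s t hsinj htinj hst (by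
      intro v
      have hvU : v.1 ∉ U := fun h => v.2 (hUT h)
      refine ⟨v.1, f v, 0, j v, ⟨hpos v, hj v, rfl, rfl⟩, by simp [Alive, hvU], ?_, hadj v,
        fun h => hvU h.1, by have := hcappos v; omega⟩
      unfold Alive
      dsimp only [j]
      split_ifs with h
      · exact (hrank v).trans_le (hcap (f v))
      · rfl)
  refine ⟨M, hM, ?_⟩
  have hcard : Fintype.card ι = n - T.card := by
    rw [Fintype.card_subtype_compl, Fintype.card_fin, Fintype.card_coe]
  have hdisj : Disjoint (Finset.univ.image s) (Finset.univ.image t) := by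
    rw [Finset.disjoint_left]
    simp only [Finset.mem_image, Finset.mem_univ, true_and]
    rintro _ ⟨u, rfl⟩ ⟨v, hv⟩
    exact hst u v hv.symm
  calc 2 * (n - T.card) = (Finset.univ.image s ∪ Finset.univ.image t).card := by
        rw [Finset.card_union_of_disjoint hdisj, Finset.card_image_of_injective _ hsinj,
          Finset.card_image_of_injective _ htinj, Finset.card_univ, hcard]; ring
    _ ≤ _ := by
        refine Finset.card_le_card fun x hx => ?_
        simp only [Finset.mem_union, Finset.mem_image, Finset.mem_univ, true_and] at hx
        rw [Finset.mem_filter, Finset.mem_range]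
        rcases hx with ⟨v, rfl⟩ | ⟨v, rfl⟩
        · exact ⟨Matching.index_lt v.1.2 (hpos v), by rw [hM1]; exact (hst v v).symm⟩
        · exact ⟨Matching.index_lt (f v).1.2 (hj v), by rw [hM2]; exact hst v v⟩

/-! ### From a matching to a simplified solution -/

variable (cap U) in
/-- The vertices that are dominated in the solution read off from the matching `M`. -/
def Dominated (M : ℕ → ℕ) (v : Fin n) : Prop :=
  v ∉ U ∧ M (v * n) ≠ v * n ∧ ∃ w : Fin n, (w : ℕ) = M (v * n) / n ∧
    (w ∈ U ∨ (0 < cap w ∧ (cap v = 0 ∨ v < w)))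

/-- A partner in `U` is never dominated. For a matched pair outside `U` the rule in `Dominated`
selects one end: the one of capacity zero if there is one, and otherwise the smaller vertex. So the
partner of a dominated vertex is kept and has positive capacity. -/
theorem Dominated.partner {M : ℕ → ℕ} (hM : IsMatch (CopyAdj G cap U) M) {v : Fin n}
    (hv : Dominated cap U M v) :
    ∃ (w : Fin n) (j : ℕ), j < n ∧ M (v * n) = w * n + j ∧ Alive cap U w j ∧ G.Adj v w ∧
      ¬ Dominated cap U M w ∧ 0 < cap w := by
  obtain ⟨hvU, hne, w, hw, hcase⟩ := hv
  obtain ⟨u, w', i, j, ⟨h1, h2, h3, h4⟩, h5, h6, h7, h8, h9⟩ := hM.edge _ hne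
  have hn : 0 < n := v.pos
  obtain ⟨rfl, rfl⟩ := code_inj hn h1 (by rw [add_zero]; exact h3)
  have hww : w = w' := by
    rw [h4, Matching.index_div h2] at hw
    exact Fin.ext hw
  subst hww
  refine ⟨w, j, h2, h4, h6, h7, ?_, ?_⟩
  · rintro ⟨hwU, -, v', hv', hcase'⟩
    have hj : j = 0 := by simpa [Alive, hwU] using h6
    subst hj
    have hMw : M (w * n) = v * n := by
      rw [show (w : ℕ) * n = M (v * n) by rw [h4, add_zero], hM.invol]
    have hvv : v' = v := by
      rw [hMw, Nat.mul_div_cancel _ hn] at hv'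
      exact Fin.ext hv'
    subst hvv
    have e1 := hcase.resolve_left hwU
    have e2 := hcase'.resolve_left hvU
    have : ¬ (v' < w ∧ w < v') := fun h => lt_asymm h.1 h.2
    omega
  · rcases hcase with hwU | h
    · have : j < cap w := by simpa [Alive, hwU] using h6
      omega
    · exact h.1

/-- Every dominated vertex is assigned to the vertex whose copy is its partner. Distinct dominated
vertices use distinct copies, so `w ∈ U` gets at most `cap w` preimages and any other vertex at most
one. -/
theorem IsMatch.isSimplifiedSolution {M : ℕ → ℕ} (hM : IsMatch (CopyAdj G cap U) M)
    {S : Finset (Fin n)} (hS : ∀ v, v ∈ S ↔ ¬ Dominated cap U M v) :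
    IsSimplifiedSolution G cap U S := by
  classical
  have hpart : ∀ v : {v : Fin n // v ∉ S}, Dominated cap U M v.1 := fun v => by
    have := v.2; rw [hS, not_not] at this; exact this
  choose f j hj hMf halive hadj hdom hcap using fun v => (hpart v).partner hM
  have hinj : ∀ u v : {v : Fin n // v ∉ S}, M (u.1 * n) = M (v.1 * n) → u = v := by
    intro u v huv
    have h1 := hM.inj huv
    have hn : 0 < n := u.1.pos
    exact Subtype.ext (Fin.ext (Nat.eq_of_mul_eq_mul_right hn h1))
  have hfib : ∀ w : Fin n, w ∉ U → ∀ u v, f u = w → f v = w → u = v := by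
    intro w hw u v hu hv
    apply hinj
    have h1 := halive u
    have h2 := halive v
    rw [hu] at h1
    rw [hv] at h2
    have h3 : j u = 0 := by simpa [Alive, hw] using h1
    have h4 : j v = 0 := by simpa [Alive, hw] using h2
    rw [hMf, hMf, hu, hv, h3, h4]
  have hone : ∀ w : {v : Fin n // v ∈ S}, (w : Fin n) ∉ U →
      ((fun v => (⟨f v, (hS _).2 (hdom v)⟩ : {v : Fin n // v ∈ S})) ⁻¹' {w}).ncard ≤ 1 := by
    intro w hw
    refine (Set.ncard_le_one (Set.toFinite _)).2 fun u hu v hv => hfib w hw u v ?_ ?_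
    · exact congrArg Subtype.val hu
    · exact congrArg Subtype.val hv
  refine ⟨fun u hu => (hS u).2 fun h => h.1 hu, fun v => ⟨f v, (hS _).2 (hdom v)⟩,
    ⟨hadj, fun w => ?_⟩, hone⟩
  by_cases hw : (w : Fin n) ∈ U
  · have : (Finset.range (cap w) : Set ℕ).ncard = cap w := by
      rw [Set.ncard_coe_finset, Finset.card_range]
    rw [← this]
    refine Set.ncard_le_ncard_of_injOn j (fun v hv => ?_) (fun u hu v hv huv => ?_)
      (Finset.finite_toSet _)
    · have hv' : f v = w := congrArg Subtype.val hv
      have := halive v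
      rw [hv'] at this
      simpa [Alive, hw] using this
    · have hu' : f u = w := congrArg Subtype.val hu
      have hv' : f v = w := congrArg Subtype.val hv
      apply hinj
      rw [hMf, hMf, hu', hv', huv]
  · rcases Set.eq_empty_or_nonempty
      ((fun v => (⟨f v, (hS _).2 (hdom v)⟩ : {v : Fin n // v ∈ S})) ⁻¹' {w}) with h | ⟨v, hv⟩
    · rw [h]; simp
    · refine (hone w hw).trans ?_
      have hv' : f v = w := congrArg Subtype.val hv
      exact hv' ▸ hcap v

/-- Every edge of the matching has a dominated end: the end outside `U` if the other one is in `U`,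
and otherwise the end selected by capacities and order. Hence each matched vertex is dominated or
the partner of a dominated one. -/
theorem IsMatch.card_le {M : ℕ → ℕ} (hM : IsMatch (CopyAdj G cap U) M)
    {S : Finset (Fin n)} (hS : ∀ v, v ∈ S ↔ ¬ Dominated cap U M v) :
    ((Finset.range (n * n)).filter fun x => M x ≠ x).card ≤ 2 * (n - S.card) := by
  classical
  have hc : n - S.card = Sᶜ.card := by rw [Finset.card_compl, Fintype.card_fin]
  have hsub : ((Finset.range (n * n)).filter fun x => M x ≠ x) ⊆
      Sᶜ.image (fun v : Fin n => (v : ℕ) * n) ∪ Sᶜ.image (fun v : Fin n => M (v * n)) := by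
    intro x hx
    obtain ⟨u, v, i, j, ⟨h1, h2, h3, h4⟩, h5, h6, h7, h8, h9⟩ :=
      hM.edge x (Finset.mem_filter.1 hx).2
    have hn : 0 < n := u.pos
    have hMM := hM.invol x
    rw [Finset.mem_union, Finset.mem_image, Finset.mem_image]
    simp only [Finset.mem_compl, hS, not_not]
    have hu0 : u ∉ U → (u : ℕ) * n = x := fun hu => by
      have : i = 0 := by simpa [Alive, hu] using h5
      omega
    have hv0 : v ∉ U → (v : ℕ) * n = M x := fun hv => by
      have : j = 0 := by simpa [Alive, hv] using h6
      omega
    have hxu : (u : ℕ) = x / n := by rw [h3, Matching.index_div h1]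
    have hxv : (v : ℕ) = M x / n := by rw [h4, Matching.index_div h2]
    have hne := (Finset.mem_filter.1 hx).2
    have left : ∀ _ : u ∉ U, (v ∈ U ∨ (0 < cap v ∧ (cap u = 0 ∨ u < v))) →
        ∃ a, Dominated cap U M a ∧ (a : ℕ) * n = x := fun hu hcase =>
      ⟨u, ⟨hu, by rw [hu0 hu]; exact hne, v, by rw [hu0 hu, hxv], hcase⟩, hu0 hu⟩
    have right : ∀ _ : v ∉ U, (u ∈ U ∨ (0 < cap u ∧ (cap v = 0 ∨ v < u))) →
        ∃ a, Dominated cap U M a ∧ M ((a : ℕ) * n) = x := fun hv hcase =>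
      ⟨v, ⟨hv, by rw [hv0 hv, hMM]; exact hne.symm, u, by rw [hv0 hv, hMM, hxu], hcase⟩,
        by rw [hv0 hv, hMM]⟩
    by_cases hu : u ∈ U
    · exact Or.inr (right (fun hv => h8 ⟨hu, hv⟩) (Or.inl hu))
    by_cases hv : v ∈ U
    · exact Or.inl (left hu (Or.inl hv))
    have huv : u ≠ v := h7.ne
    by_cases hcu : cap u = 0
    · exact Or.inl (left hu (Or.inr ⟨by omega, Or.inl hcu⟩))
    by_cases hcv : cap v = 0
    · exact Or.inr (right hv (Or.inr ⟨by omega, Or.inl hcv⟩))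
    rcases lt_or_gt_of_ne huv with h | h
    · exact Or.inl (left hu (Or.inr ⟨by omega, Or.inr h⟩))
    · exact Or.inr (right hv (Or.inr ⟨by omega, Or.inr h⟩))
  refine (Finset.card_le_card hsub).trans ((Finset.card_union_le _ _).trans ?_)
  rw [hc, two_mul]
  exact add_le_add Finset.card_image_le Finset.card_image_le

/-- A maximum matching gives an optimal solution of the simplified instance. -/
theorem IsMatch.optimal {M : ℕ → ℕ} (hM : IsMatch (CopyAdj G cap U) M)
    (hmax : ∀ M', IsMatch (CopyAdj G cap U) M' →
      ((Finset.range (n * n)).filter fun x => M x = x).card ≤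
        ((Finset.range (n * n)).filter fun x => M' x = x).card)
    {S T : Finset (Fin n)} (hS : ∀ v, v ∈ S ↔ ¬ Dominated cap U M v)
    (hT : IsSimplifiedSolution G cap U T) : S.card ≤ T.card := by
  obtain ⟨M', hM', h1⟩ := hT.exists_isMatch
  have h2 := hM.card_le hS
  have h3 := hmax M' hM'
  have h4 := Finset.card_filter_add_card_filter_not (s := Finset.range (n * n)) fun x => M x = x
  have h5 := Finset.card_filter_add_card_filter_not (s := Finset.range (n * n)) fun x => M' x = x
  have h6 : S.card ≤ n := (Finset.card_le_univ S).trans (by simp)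
  have h7 : T.card ≤ n := (Finset.card_le_univ T).trans (by simp)
  simp only [ne_eq] at h1 h2
  omega

end

end CapDom

namespace CapDom

/-! ## Enumeration of small subsets

A subset of `Fin n` is encoded by a number below `2 ^ n`. -/

/-- The number of ones among the last `n` binary digits of `y`. -/
def pop (n y : ℕ) : ℕ := ∑ i ∈ Finset.range n, y / 2 ^ i % 2

/-- The subset encoded by `y`. -/
def bitSet (n y : ℕ) : Finset (Fin n) := Finset.univ.filter fun i => y / 2 ^ (i : ℕ) % 2 = 1

theorem card_bitSet (n y : ℕ) : (bitSet n y).card = pop n y := by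
  rw [bitSet, Finset.card_filter, pop, ← Fin.sum_univ_eq_sum_range fun i => y / 2 ^ i % 2]
  refine Finset.sum_congr rfl fun i _ => ?_
  have := Nat.mod_two_eq_zero_or_one (y / 2 ^ (i : ℕ))
  split_ifs <;> omega

theorem bitSet_bijective (n : ℕ) : Function.Bijective fun y : Fin (2 ^ n) => bitSet n y := by
  rw [Fintype.bijective_iff_injective_and_card]
  refine ⟨fun x y h => Fin.ext (Nat.eq_of_testBit_eq fun i => ?_), by simp⟩
  by_cases hi : i < n
  · have h1 : (⟨i, hi⟩ : Fin n) ∈ bitSet n x ↔ (⟨i, hi⟩ : Fin n) ∈ bitSet n y := by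
      have h' : bitSet n x = bitSet n y := h
      rw [h']
    simp only [bitSet, Finset.mem_filter, Finset.mem_univ, true_and] at h1
    rw [Nat.testBit_eq_decide_div_mod_eq, Nat.testBit_eq_decide_div_mod_eq, decide_eq_decide]
    exact h1
  · have h2 : 2 ^ n ≤ 2 ^ i := Nat.pow_le_pow_right (by simp) (by omega)
    rw [Nat.testBit_lt_two_pow (x.2.trans_le h2), Nat.testBit_lt_two_pow (y.2.trans_le h2)]

theorem exists_bitSet_eq {n : ℕ} (U : Finset (Fin n)) : ∃ y < 2 ^ n, bitSet n y = U := by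
  obtain ⟨y, hy⟩ := (bitSet_bijective n).2 U
  exact ⟨y, y.2, hy⟩

theorem card_pop_le (n k : ℕ) : ((Finset.range (2 ^ n)).filter fun y => pop n y ≤ k).card ≤
    ∑ i ∈ Finset.range (k + 1), n.choose i := by
  have h1 : ∑ i ∈ Finset.range (k + 1), n.choose i =
      ((Finset.univ : Finset (Finset (Fin n))).filter fun U => U.card ≤ k).card := by
    rw [Finset.card_eq_sum_card_fiberwise (f := Finset.card) (t := Finset.range (k + 1))
      (fun U hU => by
        have := (Finset.mem_filter.1 hU).2
        simp only [Finset.coe_range, Set.mem_Iio]; omega)]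
    refine Finset.sum_congr rfl fun i hi => ?_
    have hi' := Finset.mem_range.1 hi
    rw [Finset.filter_filter]
    have : (Finset.univ.filter fun U : Finset (Fin n) => U.card ≤ k ∧ U.card = i) =
        Finset.powersetCard i Finset.univ := by
      ext U
      simp only [Finset.mem_filter, Finset.mem_univ, true_and, Finset.mem_powersetCard,
        Finset.subset_univ]
      omega
    rw [this, Finset.card_powersetCard, Finset.card_univ, Fintype.card_fin]
  rw [h1]
  refine Finset.card_le_card_of_injOn (bitSet n) (fun y hy => ?_) (fun x hx y hy hxy => ?_)
  · have := (Finset.mem_filter.1 hy).2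
    simpa [card_bitSet] using this
  · have hx' := Finset.mem_range.1 (Finset.mem_filter.1 hx).1
    have hy' := Finset.mem_range.1 (Finset.mem_filter.1 hy).1
    have := (bitSet_bijective n).1 (a₁ := ⟨x, hx'⟩) (a₂ := ⟨y, hy'⟩) hxy
    exact congrArg Fin.val this

/-- Delete the lowest one of `y`. Its position `q` is the exponent of two in `y`. -/
theorem exists_pop_sub {n y : ℕ} (h0 : 0 < y) (hn : y < 2 ^ n) :
    ∃ q < n, 2 ^ q ∣ y ∧ pop n (y - 2 ^ q) + 1 = pop n y := by
  obtain ⟨q, m, hm, rfl⟩ := Nat.exists_eq_two_pow_mul_odd h0.ne'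
  obtain ⟨t, rfl⟩ := hm
  have hq : q < n := by
    refine (Nat.pow_lt_pow_iff_right (a := 2) (by simp)).1 (lt_of_le_of_lt ?_ hn)
    exact Nat.le_mul_of_pos_right _ (by omega)
  refine ⟨q, hq, dvd_mul_right _ _, ?_⟩
  have hsub : 2 ^ q * (2 * t + 1) - 2 ^ q = 2 ^ q * (2 * t) := by
    rw [mul_add, mul_one, Nat.add_sub_cancel]
  rw [hsub]
  unfold pop
  rw [← Finset.add_sum_erase _ _ (Finset.mem_range.2 hq),
    ← Finset.add_sum_erase _ _ (Finset.mem_range.2 hq)]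
  have h1 : 2 ^ q * (2 * t) / 2 ^ q % 2 = 0 := by
    rw [Nat.mul_div_cancel_left _ (by positivity)]; omega
  have h2 : 2 ^ q * (2 * t + 1) / 2 ^ q % 2 = 1 := by
    rw [Nat.mul_div_cancel_left _ (by positivity)]; omega
  have h3 : ∀ i ∈ (Finset.range n).erase q,
      2 ^ q * (2 * t) / 2 ^ i % 2 = 2 ^ q * (2 * t + 1) / 2 ^ i % 2 := by
    intro i hi
    have hne := (Finset.mem_erase.1 hi).1
    rcases lt_or_gt_of_ne hne with h | h
    · obtain ⟨d, rfl⟩ := Nat.exists_eq_add_of_lt h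
      have : ∀ s, 2 ^ (i + d + 1) * s / 2 ^ i % 2 = 0 := by
        intro s
        rw [show 2 ^ (i + d + 1) * s = 2 ^ i * (2 * (2 ^ d * s)) by ring,
          Nat.mul_div_cancel_left _ (by positivity)]
        omega
      rw [this, this]
    · obtain ⟨d, rfl⟩ := Nat.exists_eq_add_of_lt h
      have : ∀ s, 2 ^ q * s / 2 ^ (q + d + 1) = s / 2 / 2 ^ d := by
        intro s
        rw [show 2 ^ (q + d + 1) = 2 ^ q * (2 * 2 ^ d) by ring,
          Nat.mul_div_mul_left _ _ (by positivity), Nat.div_div_eq_div_mul]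
      rw [this, this]
      congr 2
      omega
  rw [h1, h2, Finset.sum_congr rfl h3]
  omega

/-! ### The next number with few ones -/

/-- The smallest multiple of `2 ^ p` above `x`. -/
def cand (x p : ℕ) : ℕ := (x / 2 ^ p + 1) * 2 ^ p

theorem lt_cand (x p : ℕ) : x < cand x p := by
  have := Nat.div_add_mod x (2 ^ p)
  have := Nat.mod_lt x (show 0 < 2 ^ p by positivity)
  unfold cand
  rw [add_mul, one_mul, mul_comm]; omega

theorem cand_le {x p y : ℕ} (h : x < y) (hy : 2 ^ p ∣ y) : cand x p ≤ y := by
  obtain ⟨m, rfl⟩ := hy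
  unfold cand
  rw [mul_comm]
  refine Nat.mul_le_mul_left _ ?_
  exact Nat.div_lt_of_lt_mul h

/-- Delete the lowest one `2 ^ q` of `y`. If the result still exceeds `x`, induction applies to it
and it has fewer ones. Otherwise `y` is the first multiple of `2 ^ q` above `x`: for `q < p` this is
a rejected candidate, and for `q ≥ p` it is a multiple of `2 ^ p`, hence not below `cand x p`. -/
theorem lt_pop_of_lt_cand {n k x p : ℕ} (hp : ∀ q < p, cand x q < 2 ^ n → k < pop n (cand x q))
    {y : ℕ} (h1 : x < y) (h2 : y < cand x p) (h3 : y < 2 ^ n) : k < pop n y := by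
  induction y using Nat.strong_induction_on with
  | _ y ih =>
  obtain ⟨q, hq, hdvd, hpop⟩ := exists_pop_sub (by omega : 0 < y) h3
  have hpow : 0 < 2 ^ q := by positivity
  by_cases hz : x < y - 2 ^ q
  · have := ih (y - 2 ^ q) (by omega) hz (by omega) (by omega)
    omega
  · have hy : cand x q = y := by
      refine le_antisymm (cand_le h1 hdvd) ?_
      obtain ⟨m, rfl⟩ := hdvd
      have hm : 0 < m := Nat.pos_of_ne_zero (by rintro rfl; omega)
      have h4 : 2 ^ q * m - 2 ^ q = 2 ^ q * (m - 1) := by rw [Nat.mul_sub, mul_one]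
      have h5 : m - 1 ≤ x / 2 ^ q := by
        rw [Nat.le_div_iff_mul_le hpow, mul_comm]; omega
      unfold cand
      rw [mul_comm]
      exact Nat.mul_le_mul_right _ (by omega)
    by_cases hqp : q < p
    · have := hp q hqp (by omega)
      rwa [hy] at this
    · have := cand_le h1 ((pow_dvd_pow 2 (by omega : p ≤ q)).trans hdvd)
      omega

theorem cand_le_two_pow {n x p : ℕ} (hx : x < 2 ^ n) (hp : p ≤ n) : cand x p ≤ 2 ^ n :=
  cand_le hx (pow_dvd_pow 2 hp)

end CapDom

namespace CapDom

theorem Expr.tt_cond {σ : State} {j : ℕ} {b x y : Expr} : (Expr.cond b x y).tt σ j ↔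
    (b.tt σ j ∧ x.tt σ j) ∨ (¬ b.tt σ j ∧ y.tt σ j) := by
  unfold tt
  rw [val_cond]
  unfold tt
  split_ifs with h
  · simp [h]
  · simp [h]

/-! ## The program for the scheme

Array `6` contains `n * n`, array `18` the current set `U`, array `19` its number, array `20` the
powers of two, array `21` the size of the best solution so far, arrays `22` and `23` the current
solution and its size, arrays `24` to `26` a candidate for the next set, a power of two and the size
of the candidate, array `27` contains `2 ^ n`. -/

namespace Scheme

open CapDom.Expr

/-- The number of vertices of the input graph. -/
abbrev en : Expr := .var 0
/-- The bound on the size of `U`. -/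
abbrev ek : Expr := .get 0 (.lit 1)
/-- Number of vertices of the matching problem. -/
abbrev eN : Expr := .var 6
/-- Size of its adjacency matrix. -/
abbrev eNN : Expr := .mul eN eN
/-- Binary digit `i` of `y`. -/
abbrev bitE (y i : Expr) : Expr := .mod (.div y (.get 20 i)) (.lit 2)

/-- The current set. -/
def setU : Expr := bitE (.var 19) ctr

/-- The pair `(u, i)` is a vertex of the matching problem. -/
abbrev aliveE (u i : Expr) : Expr := .cond (.get 18 u) (.lt i (.get 1 u)) (.eq i (.lit 0))

/-- The row index. -/
abbrev rowE : Expr := .div ctr eN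
/-- The column index. -/
abbrev colE : Expr := .mod ctr eN

/-- Adjacency of two pairs. -/
abbrev pairE (u i v j : Expr) : Expr := .and (aliveE u i) (.and (aliveE v j)
  (.and (.get 2 (.add (.mul u en) v)) (.and (.not (.and (.get 18 u) (.get 18 v)))
    (.or (.get 1 u) (.get 1 v)))))

/-- The adjacency matrix of the matching problem. -/
def adjE : Expr := .cond (pairE (.div rowE en) (.mod rowE en) (.div colE en) (.mod colE en))
  (.lit 1) (.lit 0)

/-- The partner of the vertex given by the counter. -/
abbrev partnerE : Expr := .div (.get 8 (.mul ctr en)) en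

/-- The vertex given by the counter is dominated. -/
def domE : Expr := .and (.not (.get 18 ctr)) (.and
  (.not (.eq (.get 8 (.mul ctr en)) (.mul ctr en)))
  (.or (.get 18 partnerE) (.and (.get 1 partnerE) (.or (.eq (.get 1 ctr) (.lit 0))
    (.lt ctr partnerE)))))

/-- The solution read off from the matching. -/
def solE : Expr := .cond domE (.lit 0) (.lit 1)

/-- Solve the instance given by the current set. -/
def evalP : Prog := .seq (.assign 18 en setU) (.seq (.assign 7 eNN adjE) (.seq Matching.matchP
  (.seq (.assign 22 en solE) (.sum 23 en (.get 22 ctr)))))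
/-- Time bound for `evalP`. -/
def evalTime (n : ℕ) : ℕ := assignTime en setU n + (assignTime eNN adjE (n * n * (n * n)) +
  (Matching.matchTime (n * n) + (assignTime en solE n + sumTime 23 en (.get 22 ctr) n)))

/-- Compare with the best solution so far. -/
def updateP : Prog := .ite (.lt (.var 23) (.var 21))
  (.seq (.assign 3 en (.get 22 ctr)) (.put 21 (.var 23))) .nop
/-- Time bound for `updateP`. -/
def updateTime (n : ℕ) : ℕ := (Expr.lt (.var 23) (.var 21)).cw + 1 +
  (assignTime en (.get 22 ctr) n + (1 + (Expr.var 23).cw + 1) + 1)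

/-- The size of the candidate. -/
def popP : Prog := .sum 26 en (bitE (.var 24) ctr)
/-- Time bound for `popP`. -/
def popTime (n : ℕ) : ℕ := sumTime 26 en (bitE (.var 24) ctr) n

/-- The next power of two. -/
def doubleE : Expr := .mul (.lit 2) (.var 25)
/-- The next candidate. -/
def candE : Expr := .mul (.add (.div (.var 19) (.var 25)) (.lit 1)) (.var 25)
/-- The candidate is too large. -/
def largeE : Expr := .and (.lt (.var 24) (.var 27)) (.lt ek (.var 26))
/-- The first candidate. -/
def firstE : Expr := .add (.var 19) (.lit 1)

/-- Compute the next set. -/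
def nextP : Prog := .seq (.put 25 (.lit 1)) (.seq (.put 24 firstE) (.seq popP
  (.seq (.loop largeE (.seq (.put 25 doubleE) (.seq (.put 24 candE) popP))) (.put 19 (.var 24)))))
/-- Time bound for `nextP`. -/
def nextTime (n : ℕ) : ℕ := (1 + (Expr.lit 1).cw + 1) + ((1 + firstE.cw + 1) + (popTime n +
  ((n * (largeE.cw + 1 + ((1 + doubleE.cw + 1) + ((1 + candE.cw + 1) + popTime n))) +
    (largeE.cw + 1)) + (1 + (Expr.var 24).cw + 1))))

/-- Process one set. -/
def bodyP : Prog := .seq evalP (.seq updateP nextP)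
/-- Time bound for `bodyP`. -/
def bodyTime (n : ℕ) : ℕ := evalTime n + (updateTime n + nextTime n)

/-- There are sets left. -/
def moreE : Expr := .lt (.var 19) (.var 27)

/-- The state contains the input. -/
structure Input {n : ℕ} (G : SimpleGraph (Fin n)) (cap : Fin n → ℕ) (k : ℕ) (σ : State) :
    Prop where
  size : σ 0 0 = n
  bound : σ 0 1 = k
  cap : ∀ v : Fin n, σ 1 v = cap v
  adj : ∀ u v : Fin n, σ 2 (u * n + v) ≠ 0 ↔ G.Adj u v

/-- The state contains the input and the precomputed data. -/
structure Ready {n : ℕ} (G : SimpleGraph (Fin n)) (cap : Fin n → ℕ) (k : ℕ) (σ : State) : Prop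
    extends Input G cap k σ where
  sq : σ 6 0 = n * n
  pow : ∀ j ≤ n, σ 20 j = 2 ^ j
  top : σ 27 0 = 2 ^ n

/-- The arrays containing the input and the precomputed data are not changed. -/
def Keeps (σ σ' : State) : Prop :=
  ∀ b, b = 0 ∨ b = 1 ∨ b = 2 ∨ b = 6 ∨ b = 20 ∨ b = 27 → σ' b = σ b

variable {n k : ℕ} {G : SimpleGraph (Fin n)} {cap : Fin n → ℕ}

theorem Ready.keeps {σ σ' : State} (h : Ready G cap k σ) (hk : Keeps σ σ') :
    Ready G cap k σ' := by
  refine ⟨⟨?_, ?_, ?_, ?_⟩, ?_, ?_, ?_⟩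
  · rw [hk 0 (by simp)]; exact h.size
  · rw [hk 0 (by simp)]; exact h.bound
  · rw [hk 1 (by simp)]; exact h.cap
  · rw [hk 2 (by simp)]; exact h.adj
  · rw [hk 6 (by simp)]; exact h.sq
  · rw [hk 20 (by simp)]; exact h.pow
  · rw [hk 27 (by simp)]; exact h.top

theorem div_lt_of_lt_mul_self {n x : ℕ} (h : x < n * n) : x / n < n :=
  Nat.div_lt_of_lt_mul h

theorem pos_of_lt_mul_self {n x : ℕ} (h : x < n * n) : 0 < n :=
  Nat.pos_of_ne_zero (by rintro rfl; simp at h)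

/-- The expression for adjacency describes the relation `CopyAdj`. -/
theorem tt_pairE {σ : State} (h : Ready G cap k σ) {U : Finset (Fin n)}
    (hU : ∀ v : Fin n, σ 18 v ≠ 0 ↔ v ∈ U) {x y : ℕ} (hx : x < n * n) (hy : y < n * n) {q : ℕ}
    (hq : q / (n * n) = x) (hq' : q % (n * n) = y) :
    (pairE (.div rowE en) (.mod rowE en) (.div colE en) (.mod colE en)).tt σ q ↔
      CopyAdj G cap U x y := by
  have hn : 0 < n := pos_of_lt_mul_self hx
  have hxu := div_lt_of_lt_mul_self hx
  have hyu := div_lt_of_lt_mul_self hy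
  have e1 := hU ⟨_, hxu⟩
  have e2 := hU ⟨_, hyu⟩
  have e3 := h.cap ⟨_, hxu⟩
  have e4 := h.cap ⟨_, hyu⟩
  have e5 := h.adj ⟨_, hxu⟩ ⟨_, hyu⟩
  simp only at e1 e2 e3 e4 e5
  have key : (pairE (.div rowE en) (.mod rowE en) (.div colE en) (.mod colE en)).tt σ q ↔
      Alive cap U ⟨_, hxu⟩ (x % n) ∧ Alive cap U ⟨_, hyu⟩ (y % n) ∧
        G.Adj ⟨_, hxu⟩ ⟨_, hyu⟩ ∧ ¬ (⟨_, hxu⟩ ∈ U ∧ ⟨_, hyu⟩ ∈ U) ∧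
        0 < cap ⟨_, hxu⟩ + cap ⟨_, hyu⟩ := by
    simp only [tt_and, tt_not, tt_or, tt_cond, tt_get, tt_lt, tt_eq, val_get, val_div, val_mod,
      val_mul, val_add, val_ctr, val_lit, h.size, h.sq, hq, hq', ne_eq, Nat.reduceEqDiff,
      not_false_eq_true, OfNat.zero_ne_ofNat, OfNat.one_ne_ofNat, e3, e4]
    rw [← ne_eq, e1, ← ne_eq (σ 18 (y / n)), e2, ← ne_eq (σ 2 _), e5]
    unfold Alive
    have : (¬ cap ⟨_, hxu⟩ = 0 ∨ ¬ cap ⟨_, hyu⟩ = 0) ↔ 0 < cap ⟨_, hxu⟩ + cap ⟨_, hyu⟩ := by omega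
    rw [this]
    split_ifs <;> simp [*]
  rw [key]
  constructor
  · rintro ⟨h1, h2, h3, h4, h5⟩
    refine ⟨_, _, x % n, y % n, ⟨Nat.mod_lt _ hn, Nat.mod_lt _ hn, ?_, ?_⟩, h1, h2, h3, h4, h5⟩
    · exact (Nat.div_add_mod' x n).symm
    · exact (Nat.div_add_mod' y n).symm
  · rintro ⟨u, v, i, j, ⟨h1, h2, rfl, rfl⟩, h3⟩
    have e1 : (⟨_, hxu⟩ : Fin n) = u := Fin.ext (Matching.index_div h1)
    have e2 : (⟨_, hyu⟩ : Fin n) = v := Fin.ext (Matching.index_div h2)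
    rw [e1, e2, Matching.index_mod h1, Matching.index_mod h2]
    exact h3

theorem tt_domE {σ : State} (h : Ready G cap k σ) {U : Finset (Fin n)}
    (hU : ∀ v : Fin n, σ 18 v ≠ 0 ↔ v ∈ U)
    (hM : IsMatch (CopyAdj G cap U) (Matching.vM (n * n) σ)) (v : Fin n) :
    domE.tt σ v ↔ Dominated cap U (Matching.vM (n * n) σ) v := by
  have hn : 0 < n := v.pos
  have hvn : (v : ℕ) * n < n * n := Nat.mul_lt_mul_of_pos_right v.2 hn
  have hMv : Matching.vM (n * n) σ (v * n) = σ 8 (v * n) := by simp [Matching.vM, hvn]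
  have e1 := hU v
  simp only [domE, tt_and, tt_not, tt_or, tt_get, tt_lt, tt_eq, val_get, val_div,
      val_mul, val_ctr, val_lit, h.size, ne_eq, Nat.reduceEqDiff,
      not_false_eq_true, OfNat.zero_ne_ofNat, OfNat.one_ne_ofNat, h.cap]
  rw [← ne_eq (σ 18 v), e1]
  unfold Dominated
  rw [hMv]
  refine and_congr_right fun _ => and_congr_right fun hne => ?_
  have hw : σ 8 (v * n) / n < n := by
    rw [← hMv] at hne ⊢
    exact div_lt_of_lt_mul_self (hM.edge _ hne).symm.lt
  have e2 := hU ⟨_, hw⟩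
  have e3 := h.cap ⟨_, hw⟩
  simp only at e2 e3
  rw [← ne_eq (σ 18 _), e2, e3]
  constructor
  · intro hc
    refine ⟨⟨_, hw⟩, rfl, ?_⟩
    rcases hc with hc | ⟨h1, h2⟩
    · exact Or.inl hc
    · exact Or.inr ⟨by omega, h2⟩
  · rintro ⟨w, hw', hc⟩
    obtain rfl : w = ⟨_, hw⟩ := Fin.ext hw'
    rcases hc with hc | ⟨h1, h2⟩
    · exact Or.inl hc
    · exact Or.inr ⟨by omega, h2⟩

/-! ### Solving the instance of the current set -/

/-- The arrays changed by `evalP`. -/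
def EvalKeeps (σ σ' : State) : Prop :=
  ∀ b, b < 7 ∨ (18 < b ∧ b ≠ 22 ∧ b ≠ 23) → σ' b = σ b

theorem EvalKeeps.trans {σ σ' σ'' : State} (h : EvalKeeps σ σ') (h' : EvalKeeps σ' σ'') :
    EvalKeeps σ σ'' := fun b hb => (h' b hb).trans (h b hb)

theorem EvalKeeps.set {σ : State} {a L : ℕ} {g : ℕ → ℕ}
    (ha : 7 ≤ a ∧ (a ≤ 18 ∨ a = 22 ∨ a = 23)) : EvalKeeps σ (σ.set a L g) :=
  fun b hb => State.set_of_ne (by omega)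

theorem EvalKeeps.keeps {σ σ' : State} (h : EvalKeeps σ σ') : Keeps σ σ' :=
  fun b hb => h b (by omega)

/-- A bound that is sufficient for all indices used by the program. -/
def Suffices (n B : ℕ) : Prop := n * n * (n * n) * (n * n) + n + 2 ≤ B

theorem Suffices.facts {n B : ℕ} (h : Suffices n B) : 2 ≤ B ∧ n + 1 < B ∧ n * n < B ∧
    n * n * (n * n) ≤ B ∧ n * n * (n * n) * (n * n) ≤ B := by
  unfold Suffices at h
  have h1 : n * n ≤ n * n * (n * n) := by
    rcases Nat.eq_zero_or_pos n with rfl | hn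
    · simp
    · exact Nat.le_mul_of_pos_right _ (by positivity)
  have h2 : n * n * (n * n) ≤ n * n * (n * n) * (n * n) := by
    rcases Nat.eq_zero_or_pos n with rfl | hn
    · simp
    · exact Nat.le_mul_of_pos_right _ (by positivity)
  omega

/-- With `N = n * n`, the matrix written to array `7` is the relation `CopyAdj`, so the matching
program followed by the rule `Dominated` produces an optimal solution for `U`. -/
theorem run_eval {B : ℕ} {σ : State} (hB : Suffices n B) (h : Ready G cap k σ) :
    Run B evalP (evalTime n) σ fun σ' => EvalKeeps σ σ' ∧ ∃ S : Finset (Fin n),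
      (∀ v : Fin n, σ' 22 v = if v ∈ S then 1 else 0) ∧ σ' 23 0 = S.card ∧
      IsSimplifiedSolution G cap (bitSet n (σ 19 0)) S ∧
      ∀ T, IsSimplifiedSolution G cap (bitSet n (σ 19 0)) T → S.card ≤ T.card := by
  classical
  obtain ⟨hB2, hnB, hNB, hNNB, hNNNB⟩ := hB.facts
  have hBB := B.lt_two_pow_self
  set U := bitSet n (σ 19 0) with hUdef
  refine Run.good fun hg => ?_
  have hbit : ∀ i < n, setU.val σ i = σ 19 0 / 2 ^ i % 2 := by
    intro i hi
    simp [setU, val_mod, val_div, val_get, val_lit, val_ctr, h.pow i hi.le]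
  refine Run.assign_then (fun i => σ 19 0 / 2 ^ i % 2) (by simp [Expr.val, h.size]) (by omega)
    (by omega) (by simp) (by rfl) (by rfl) (by rfl)
    (fun i hi => by rw [hbit i hi]; have := Nat.mod_lt (σ 19 0 / 2 ^ i) (show 0 < 2 by simp); omega)
    hbit fun _ => ?_
  set σ₁ := State.set _ 18 n _ with hσ₁
  have hK₁ : EvalKeeps σ σ₁ := EvalKeeps.set (by simp)
  have h₁ := h.keeps hK₁.keeps
  have hU₁ : ∀ v : Fin n, σ₁ 18 v ≠ 0 ↔ v ∈ U := by
    intro v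
    simp only [hσ₁, State.set_apply, if_true, v.2, hUdef, bitSet, Finset.mem_filter,
      Finset.mem_univ, true_and]
    have := Nat.mod_two_eq_zero_or_one (σ 19 0 / 2 ^ (v : ℕ))
    omega
  refine Run.assign_then (fun q => if CopyAdj G cap U (q / (n * n)) (q % (n * n)) then 1 else 0)
    (by simp [Expr.val, h₁.sq]) hNNB
    (by omega) (by simp) (by rfl) (by rfl) (by rfl)
    (fun i hi => val_cond_lt (lit_lt hB2 (by simp)) (lit_lt hB2 (by simp))) ?_ fun _ => ?_
  · intro q hq
    have hN0 : 0 < n * n := pos_of_lt_mul_self hq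
    have := tt_pairE h₁ hU₁ (Nat.div_lt_of_lt_mul hq) (Nat.mod_lt q hN0) rfl rfl
    simp only [adjE, val_cond, val_lit]
    rw [if_congr this rfl rfl]
  set σ₂ := State.set _ 7 _ _ with hσ₂
  have hK₂ : EvalKeeps σ σ₂ := hK₁.trans (EvalKeeps.set (by simp))
  have h₂ := h.keeps hK₂.keeps
  have hE₂ : ∀ x y, Matching.vE (n * n) σ₂ x y ↔ CopyAdj G cap U x y := by
    intro x y
    unfold Matching.vE
    constructor
    · rintro ⟨⟨hx, hy⟩, hne⟩
      by_contra hcon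
      apply hne
      simp [hσ₂, State.set_apply, Matching.index_lt hx hy, Matching.index_div hy,
        Matching.index_mod hy, hcon]
    · intro hxy
      have hx := hxy.lt
      have hy := hxy.symm.lt
      refine ⟨⟨hx, hy⟩, ?_⟩
      simp [hσ₂, State.set_apply, Matching.index_lt hx hy, Matching.index_div hy,
        Matching.index_mod hy, hxy]
  have hE₂' : Matching.vE (n * n) σ₂ = CopyAdj G cap U := by
    funext x y; exact propext (hE₂ x y)
  refine Run.seq (Matching.run_match hB2 hNNNB hNB h₂.sq
    (by rw [hE₂']; exact fun _ _ => CopyAdj.symm))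
    ?_
  rintro σ₃ hg₃ ⟨hF, hM, hmax⟩
  rw [hE₂'] at hM hmax
  have hK₃ : EvalKeeps σ σ₃ := hK₂.trans fun b hb => hF b (by omega)
  have h₃ := h.keeps hK₃.keeps
  have hU₃ : ∀ v : Fin n, σ₃ 18 v ≠ 0 ↔ v ∈ U := by
    intro v; rw [hF 18 (by simp)]; exact hU₁ v
  let S : Finset (Fin n) := Finset.univ.filter fun v => ¬ Dominated cap U (Matching.vM (n * n) σ₃) v
  have hS : ∀ v, v ∈ S ↔ ¬ Dominated cap U (Matching.vM (n * n) σ₃) v := by simp [S]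
  refine Run.assign_then (fun i => if domE.tt σ₃ i then 0 else 1)
    (by simp [Expr.val, h₃.size]) (by omega) (by omega) (by simp) (by rfl) (by rfl) (by rfl)
    (fun i hi => val_cond_lt (lit_lt hB2 (by simp)) (lit_lt hB2 (by simp)))
    (fun i hi => by simp only [solE, val_cond, val_lit]) fun _ => ?_
  set σ₄ := State.set _ 22 _ _ with hσ₄
  have hK₄ : EvalKeeps σ σ₄ := hK₃.trans (EvalKeeps.set (by simp))
  have h₄ := h.keeps hK₄.keeps
  have hout : ∀ v : Fin n, σ₄ 22 v = if v ∈ S then 1 else 0 := by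
    intro v
    have h5 := tt_domE h₃ hU₃ hM v
    simp only [hσ₄, State.set_apply, if_true, v.2, hS, ← h5]
    split_ifs <;> rfl
  have hsum : ∑ i ∈ Finset.range n, (Expr.get 22 ctr).val σ₄ i = S.card := by
    rw [← Fin.sum_univ_eq_sum_range (fun i => (Expr.get 22 ctr).val σ₄ i)]
    simp only [val_get, val_ctr, ne_eq, Nat.reduceEqDiff, not_false_eq_true, hout]
    simp
  have hSn : S.card ≤ n := (Finset.card_le_univ S).trans (by simp)
  refine Run.sum (by simp [Expr.val, h₄.size]) (by omega) (by omega) (by simp) (by rfl) (by rfl)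
    (by rfl) (by rfl) (by rw [hsum]; omega) ?_
  rw [hsum]
  refine ⟨hK₄.trans (EvalKeeps.set (by simp)), S, hout, by simp [State.set_apply],
    hM.isSimplifiedSolution hS, fun T hT => hM.optimal hmax hS hT⟩

theorem run_pop {B : ℕ} {σ : State} (hB : Suffices n B) (h : Ready G cap k σ)
    {Q : State → Prop} (hQ : Q (σ.set 26 1 fun _ => pop n (σ 24 0))) :
    Run B popP (popTime n) σ Q := by
  obtain ⟨hB2, hnB, -⟩ := hB.facts
  have hBB := B.lt_two_pow_self
  have hval : ∑ i ∈ Finset.range n, (bitE (.var 24) ctr).val σ i = pop n (σ 24 0) := by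
    refine Finset.sum_congr rfl fun i hi => ?_
    simp [val_mod, val_div, val_get, val_lit, val_ctr, h.pow i (Finset.mem_range.1 hi).le]
  have hle : pop n (σ 24 0) ≤ n := by
    rw [← card_bitSet]; exact (Finset.card_le_univ _).trans (by simp)
  exact Run.sum (by simp [Expr.val, h.size]) (by omega) (by omega) (by simp) (by rfl) (by rfl)
    (by rfl) (by rfl) (by rw [hval]; omega) (by rwa [hval])

/-! ### Moving to the next set -/

/-- The arrays changed by `nextP`. -/
def NextKeeps (σ σ' : State) : Prop :=
  ∀ b, b ≠ 19 → b ≠ 24 → b ≠ 25 → b ≠ 26 → σ' b = σ b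

theorem NextKeeps.trans {σ σ' σ'' : State} (h : NextKeeps σ σ') (h' : NextKeeps σ' σ'') :
    NextKeeps σ σ'' := fun b h1 h2 h3 h4 => (h' b h1 h2 h3 h4).trans (h b h1 h2 h3 h4)

theorem NextKeeps.set {σ : State} {a L : ℕ} {g : ℕ → ℕ}
    (ha : a = 19 ∨ a = 24 ∨ a = 25 ∨ a = 26) : NextKeeps σ (σ.set a L g) :=
  fun b h1 h2 h3 h4 => State.set_of_ne (by omega)

theorem NextKeeps.keeps {σ σ' : State} (h : NextKeeps σ σ') : Keeps σ σ' :=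
  fun b hb => h b (by omega) (by omega) (by omega) (by omega)

theorem run_next {B : ℕ} {σ : State} (hB : Suffices n B) (h : Ready G cap k σ)
    (hx : σ 19 0 < 2 ^ n) :
    Run B nextP (nextTime n) σ fun σ' => NextKeeps σ σ' ∧ σ 19 0 < σ' 19 0 ∧ σ' 19 0 ≤ 2 ^ n ∧
      (σ' 19 0 < 2 ^ n → pop n (σ' 19 0) ≤ k) ∧
      ∀ y, σ 19 0 < y → y < σ' 19 0 → k < pop n y := by
  obtain ⟨hB2, hnB, -⟩ := hB.facts
  have hBB := B.lt_two_pow_self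
  have h2nB : 2 ^ n < 2 ^ B := Nat.pow_lt_pow_right (by simp) (by omega)
  set x := σ 19 0 with hxdef
  have hcand : ∀ p ≤ n, cand x p < 2 ^ B := fun p hp => (cand_le_two_pow hx hp).trans_lt h2nB
  have hcand0 : cand x 0 = x + 1 := by simp [cand]
  refine Run.put_then 1 (by simp) (by rfl) (by omega) (by omega) rfl fun _ => ?_
  refine Run.put_then (x + 1) (by simp) (by rfl) (by omega)
    (hcand0 ▸ hcand 0 (by omega))
    (by simp [firstE, val_add, val_get, val_lit, State.set_apply, hxdef])
    fun _ => ?_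
  set σ₁ := State.set _ 24 _ _ with hσ₁
  have hK₁ : NextKeeps σ σ₁ := (NextKeeps.set (by simp)).trans (NextKeeps.set (by simp))
  -- The exponent of the current candidate is `p`; all candidates with smaller exponents that are
  -- below `2 ^ n` had too many ones.
  let I : State → Prop := fun σ' => NextKeeps σ σ' ∧ σ' 19 0 = x ∧ ∃ p ≤ n, σ' 25 0 = 2 ^ p ∧
    σ' 24 0 = cand x p ∧ σ' 26 0 = pop n (cand x p) ∧
    ∀ q < p, cand x q < 2 ^ n → k < pop n (cand x q)
  have hlarge : ∀ σ', Ready G cap k σ' → (largeE.tt σ' 0 ↔ σ' 24 0 < 2 ^ n ∧ k < σ' 26 0) := by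
    intro σ' h'
    simp [largeE, tt_and, tt_lt, val_get, val_lit, h'.top, h'.bound]
  refine Run.seq (R := I) ?_ fun σ₂ _ hI₂ => ?_
  · refine run_pop hB (h.keeps hK₁.keeps) ?_
    refine ⟨hK₁.trans (NextKeeps.set (by simp)), by simp [hσ₁, State.set_apply, hxdef], 0, by simp,
      by simp [hσ₁, State.set_apply], by simp [hσ₁, State.set_apply, hcand0],
      by simp [hσ₁, State.set_apply, hcand0], by simp⟩
  refine Run.seq (Run.loop (by rfl) I (fun σ' => n - Nat.log 2 (σ' 25 0)) ?_ hI₂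
    (Nat.sub_le _ _)) ?_
  · rintro σ' - ⟨hK, hx', p, hp, h25, h24, h26, hmin⟩ hb
    have hr := h.keeps hK.keeps
    obtain ⟨hb1, hb2⟩ := (hlarge σ' hr).1 hb
    rw [h24] at hb1
    rw [h26] at hb2
    -- The candidate for `p = n` is at least `2 ^ n` and stops the loop, so there are at most `n`
    -- rounds.
    have hpn : p < n := by
      refine lt_of_le_of_ne hp ?_
      rintro rfl
      have : 2 ^ p ≤ cand x p := Nat.le_mul_of_pos_left _ (Nat.succ_pos _)
      omega
    refine Run.put_then (2 ^ (p + 1)) (by simp) (by rfl) (by omega)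
      (Nat.pow_lt_pow_right (by simp) (by omega))
      (by simp [doubleE, val_mul, val_lit, val_get, h25, pow_succ, mul_comm]) fun _ => ?_
    refine Run.put_then (cand x (p + 1)) (by simp) (by rfl) (by omega) (hcand _ hpn)
      (by simp [candE, val_mul, val_div, val_add, val_lit, val_get, State.set_apply, hx', cand])
      fun _ => ?_
    set σ₃ := State.set _ 24 _ _ with hσ₃
    have hK₃ : NextKeeps σ σ₃ :=
      (hK.trans (NextKeeps.set (by simp))).trans (NextKeeps.set (by simp))
    refine run_pop hB (h.keeps hK₃.keeps) ⟨⟨hK₃.trans (NextKeeps.set (by simp)),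
      by simp [hσ₃, State.set_apply, hx'], p + 1, hpn, by simp [hσ₃, State.set_apply],
      by simp [hσ₃, State.set_apply], by simp [hσ₃, State.set_apply], ?_⟩, ?_⟩
    · intro q hq hq'
      rcases Nat.lt_succ_iff_lt_or_eq.1 hq with hq | rfl
      exacts [hmin q hq hq', hb2]
    · simp [hσ₃, State.set_apply, h25, Nat.log_pow]
      omega
  · rintro σ₃ - ⟨⟨hK, hx', p, hp, h25, h24, h26, hmin⟩, hb⟩
    have hr := h.keeps hK.keeps
    have hb' : ¬ (σ₃ 24 0 < 2 ^ n ∧ k < σ₃ 26 0) := fun h' => (hlarge σ₃ hr).2 h' hb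
    rw [h24, h26] at hb'
    refine Run.put_to (cand x p) (by simp) (by rfl) (by omega) (hcand p hp)
      (by simp [val_get, val_lit, h24]) fun _ => ?_
    have h19 : (σ₃.set 19 1 fun _ => cand x p) 19 0 = cand x p := by simp [State.set_apply]
    rw [h19]
    have hle := cand_le_two_pow hx hp
    refine ⟨hK.trans (NextKeeps.set (by simp)), lt_cand x p, hle, fun h' => by omega, ?_⟩
    exact fun y h1 h2 => lt_pop_of_lt_cand hmin h1 h2 (by omega)

/-! ### The main loop -/

/-- The invariant of the main loop. -/
structure MainInv {n : ℕ} (G : SimpleGraph (Fin n)) (cap : Fin n → ℕ) (k : ℕ) (σ : State) :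
    Prop where
  ready : Ready G cap k σ
  le : σ 19 0 ≤ 2 ^ n
  pop_le : σ 19 0 < 2 ^ n → pop n (σ 19 0) ≤ k
  best : ∃ S : Finset (Fin n), (∀ v : Fin n, σ 3 v = if v ∈ S then 1 else 0) ∧ σ 21 0 = S.card ∧
    (∃ U : Finset (Fin n), U.card ≤ k ∧ IsSimplifiedSolution G cap U S) ∧
    ∀ y < σ 19 0, pop n y ≤ k → ∀ T, IsSimplifiedSolution G cap (bitSet n y) T → S.card ≤ T.card

theorem run_update {B : ℕ} {σ : State} (hB : Suffices n B) (h : Ready G cap k σ) :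
    Run B updateP (updateTime n) σ fun σ' => (∀ b, b ≠ 3 → b ≠ 21 → σ' b = σ b) ∧
      ((σ 21 0 ≤ σ 23 0 ∧ σ' 3 = σ 3 ∧ σ' 21 0 = σ 21 0) ∨
        (σ 23 0 < σ 21 0 ∧ (∀ v : Fin n, σ' 3 v = σ 22 v) ∧ σ' 21 0 = σ 23 0)) := by
  obtain ⟨hB2, hnB, -⟩ := hB.facts
  refine Run.good fun hg => ?_
  have hcond : (Expr.lt (.var 23) (.var 21)).tt σ 0 ↔ σ 23 0 < σ 21 0 := by
    simp [tt_lt, val_get, val_lit]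
  refine Run.ite (by rfl) (fun hb => ?_) fun hb => ?_
  · have hb' := hcond.1 hb
    refine Run.mono (T := assignTime en (.get 22 ctr) n + (1 + (Expr.var 23).cw + 1)) ?_
      (Nat.le_add_right _ _) fun _ _ h => h
    refine Run.assign_then (fun i => σ 22 i) (by simp [Expr.val, h.size]) (by omega) (by omega)
      (by simp) (by rfl) (by rfl) (by rfl) (fun i hi => hg.get_lt (by simp))
      (fun i hi => by simp [val_get, val_ctr]) fun _ => ?_
    refine Run.put_to (σ 23 0) (by simp) (by rfl) (by omega) (hg 23 0)
      (by simp [val_get, val_lit, State.set_apply]) fun _ => ?_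
    refine ⟨fun b h1 h2 => ?_, Or.inr ⟨hb', fun v => ?_, ?_⟩⟩
    · rw [State.set_of_ne h2, State.set_of_ne h1]
    · simp [State.set_apply]
    · simp [State.set_apply]
  · have hb' : ¬ σ 23 0 < σ 21 0 := fun h' => hcond.2 h' hb
    exact (Run.nop ⟨fun _ _ _ => rfl, Or.inl ⟨by omega, rfl, rfl⟩⟩).mono (Nat.le_add_left _ _)
      fun _ _ h => h

theorem run_body {B : ℕ} {σ : State} (hB : Suffices n B) (h : MainInv G cap k σ)
    (hx : σ 19 0 < 2 ^ n) :
    Run B bodyP (bodyTime n) σ fun σ' => MainInv G cap k σ' ∧ σ 19 0 < σ' 19 0 := by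
  refine Run.seq (run_eval hB h.ready) ?_
  rintro σ₁ - ⟨hK₁, S₁, hout, hcard, hsol, hopt⟩
  have h₁ := h.ready.keeps hK₁.keeps
  refine Run.seq (run_update hB h₁) ?_
  rintro σ₂ - ⟨hK₂, hcase⟩
  have h₂ : Ready G cap k σ₂ := h₁.keeps fun b hb => hK₂ b (by omega) (by omega)
  have h19 : σ₂ 19 0 = σ 19 0 := by rw [hK₂ 19 (by simp) (by simp), hK₁ 19 (by simp)]
  refine (run_next hB h₂ (h19 ▸ hx)).mono le_rfl ?_
  rintro σ₃ - ⟨hK₃, h1, h2, h3, h4⟩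
  rw [h19] at h1 h4
  have e3 : σ₃ 3 = σ₂ 3 := hK₃ 3 (by simp) (by simp) (by simp) (by simp)
  have e21 : σ₃ 21 = σ₂ 21 := hK₃ 21 (by simp) (by simp) (by simp) (by simp)
  refine ⟨⟨h₂.keeps hK₃.keeps, h2, h3, ?_⟩, h1⟩
  obtain ⟨S, g1, g2, g3, g4⟩ := h.best
  -- The numbers skipped by the successor step have more than `k` ones, so the only new admissible
  -- number is the one just processed.
  have hy : ∀ y < σ₃ 19 0, pop n y ≤ k → y < σ 19 0 ∨ y = σ 19 0 := by
    intro y hy hp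
    by_contra hcon
    have := h4 y (by omega) hy
    omega
  have f3 : σ₁ 3 = σ 3 := hK₁ 3 (by simp)
  have f21 : σ₁ 21 = σ 21 := hK₁ 21 (by simp)
  rw [f21, hcard, g2, f3] at hcase
  rcases hcase with ⟨c1, c2, c3⟩ | ⟨c1, c2, c3⟩
  · refine ⟨S, by rw [e3, c2]; exact g1, by rw [e21, c3], g3, fun y hy' hp T hT => ?_⟩
    rcases hy y hy' hp with h' | rfl
    · exact g4 y h' hp T hT
    · exact c1.trans (hopt T hT)
  · refine ⟨S₁, fun v => by rw [e3, c2, hout], by rw [e21, c3],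
      ⟨_, ?_, hsol⟩, fun y hy' hp T hT => ?_⟩
    · rw [card_bitSet]; exact h.pop_le hx
    · rcases hy y hy' hp with h' | rfl
      · exact c1.le.trans (g4 y h' hp T hT)
      · exact hopt T hT

/-! ### Initialization and the whole program -/

/-- The table of powers of two, extended by one entry. -/
def powE : Expr := .cond (.eq ctr (.lit 0)) (.lit 1)
  (.mul (.lit 2) (.get 20 (.sub ctr (.lit 1))))
/-- Length of the table of powers of two. -/
def lenE : Expr := .add en (.lit 1)
/-- The number of entries left. -/
def predE : Expr := .sub (.var 26) (.lit 1)
/-- Compute the powers of two. -/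
def powP : Prog := .seq (.put 26 lenE) (.loop (.var 26) (.seq (.assign 20 lenE powE)
  (.put 26 predE)))
/-- Time bound for `powP`. -/
def powTime (n : ℕ) : ℕ := (1 + lenE.cw + 1) + ((n + 1) * ((Expr.var 26).cw + 1 +
  (assignTime lenE powE (n + 1) + (1 + predE.cw + 1))) + ((Expr.var 26).cw + 1))

theorem run_pow {B : ℕ} {σ : State} (hB : Suffices n B) (h : Input G cap k σ)
    (h0 : ∀ j, σ 20 j = 0) :
    Run B powP (powTime n) σ fun σ' => (∀ b, b ≠ 20 → b ≠ 26 → σ' b = σ b) ∧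
      ∀ j ≤ n, σ' 20 j = 2 ^ j := by
  obtain ⟨hB2, hnB, -⟩ := hB.facts
  have hBB := B.lt_two_pow_self
  refine Run.put_then (n + 1) (by simp) (by rfl) (by omega) (by omega)
    (by simp [lenE, val_add, val_get, val_lit, h.size]) fun _ => ?_
  -- Each round shifts the table by one place and doubles it, with `1` entering at the front. After
  -- `t` rounds scalar `26` is `n + 1 - t`, the first `t` entries are correct and the rest are still
  -- zero.
  refine (Run.loop (by rfl) (fun σ' => (∀ b, b ≠ 20 → b ≠ 26 → σ' b = σ b) ∧ σ' 26 0 ≤ n + 1 ∧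
    ∀ j ≤ n, σ' 20 j = if j + σ' 26 0 < n + 1 then 2 ^ j else 0) (fun σ' => σ' 26 0) ?_ ⟨?_, ?_, ?_⟩
    (K := n + 1) ?_).mono le_rfl ?_
  · rintro σ' - ⟨hK, hle, hpow⟩ hb
    have hb' : σ' 26 0 ≠ 0 := by simpa [Expr.val] using hb
    have hn : σ' 0 0 = n := by rw [hK 0 (by simp) (by simp), h.size]
    have hval : ∀ i < n + 1, powE.val σ' i = if i + (σ' 26 0 - 1) < n + 1 then 2 ^ i else 0 := by
      intro i hi
      simp only [powE, val_cond, tt_eq, val_ctr, val_lit, val_mul, val_get, val_sub, ne_eq,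
        Nat.reduceEqDiff, not_false_eq_true]
      rcases i with _ | i
      · rw [if_pos rfl, if_pos (by omega)]; simp
      · rw [if_neg (by omega), Nat.add_sub_cancel, hpow i (by omega)]
        by_cases hc : i + σ' 26 0 < n + 1
        · rw [if_pos hc, if_pos (by omega), pow_succ, mul_comm]
        · rw [if_neg hc, if_neg (by omega)]
    refine Run.assign_then (fun i => if i + (σ' 26 0 - 1) < n + 1 then 2 ^ i else 0)
      (by simp [lenE, Expr.val, hn]) (by omega) (by omega) (by simp) (by rfl) (by rfl) (by rfl)
      (fun i hi => ?_) hval fun _ => ?_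
    · rw [hval i hi]
      split_ifs
      · exact Nat.pow_lt_pow_right (by simp) (by omega)
      · positivity
    refine Run.put_to (σ' 26 0 - 1) (by simp) (by rfl) (by omega) (by omega)
      (by simp [predE, val_sub, val_get, val_lit, State.set_apply]) fun _ => ?_
    refine ⟨⟨fun b h1 h2 => ?_, ?_, fun j hj => ?_⟩, ?_⟩
    · rw [State.set_of_ne h2, State.set_of_ne h1, hK b h1 h2]
    · simp [State.set_apply]; omega
    · have : j < n + 1 := by omega
      simp [State.set_apply, this]
    · simp [State.set_apply]; omega
  · intro b h1 h2; rw [State.set_of_ne h2]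
  · simp [State.set_apply]
  · intro j hj; simp [State.set_apply, h0]; omega
  · simp [State.set_apply]
  · rintro σ' - ⟨⟨hK, hle, hpow⟩, hb⟩
    have hb' : σ' 26 0 = 0 := by simpa [Expr.val] using hb
    refine ⟨hK, fun j hj => ?_⟩
    rw [hpow j hj, if_pos (by omega)]

/-- The number of vertices of the matching problem. -/
def sqE : Expr := .mul en en
/-- The power `2 ^ n`. -/
def topE : Expr := .get 20 en
/-- Initialization. -/
def startP : Prog := .seq powP (.seq (.put 6 sqE) (.seq (.put 27 topE) (.seq (.put 21 en)
  (.seq (.assign 3 en (.lit 1)) (.put 19 (.lit 0))))))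
/-- Time bound for `startP`. -/
def startTime (n : ℕ) : ℕ := powTime n + ((1 + sqE.cw + 1) + ((1 + topE.cw + 1) + ((1 + en.cw + 1) +
  (assignTime en (.lit 1) n + (1 + (Expr.lit 0).cw + 1)))))

/-- The whole program. -/
def schemeP : Prog := .seq startP (.loop moreE bodyP)
/-- Time bound for `schemeP`, if `K` sets are processed. -/
def schemeTime (n K : ℕ) : ℕ := startTime n + (K * (moreE.cw + 1 + bodyTime n) + (moreE.cw + 1))

/-- The initial value of the best solution: the whole vertex set, feasible already for `U = ∅`. -/
theorem isSimplifiedSolution_univ : IsSimplifiedSolution G cap ∅ Finset.univ := by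
  have : IsEmpty {v : Fin n // v ∉ (Finset.univ : Finset (Fin n))} :=
    ⟨fun v => v.2 (Finset.mem_univ v.1)⟩
  refine ⟨by simp, isEmptyElim, ⟨fun v => isEmptyElim v, fun w => ?_⟩, fun w _ => ?_⟩
  all_goals
    rw [Set.eq_empty_of_isEmpty (_ ⁻¹' {w}), Set.ncard_empty]
    exact Nat.zero_le _

theorem run_scheme {B : ℕ} {σ : State} (hB : Suffices n B) (h : Input G cap k σ)
    (h0 : ∀ j, σ 20 j = 0) :
    Run B schemeP (schemeTime n (∑ i ∈ Finset.range (k + 1), n.choose i)) σ fun σ' =>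
      ∃ S : Finset (Fin n), (∀ v : Fin n, σ' 3 v = if v ∈ S then 1 else 0) ∧
        IsSchemeOutput G cap k S := by
  obtain ⟨hB2, hnB, hNB, -⟩ := hB.facts
  have hBB := B.lt_two_pow_self
  refine Run.seq (R := MainInv G cap k) ?_ ?_
  · refine Run.seq (run_pow hB h h0) ?_
    rintro σ₁ - ⟨hK, hpow⟩
    have h₁ : Input G cap k σ₁ := by
      constructor
      · rw [hK 0 (by simp) (by simp)]; exact h.size
      · rw [hK 0 (by simp) (by simp)]; exact h.bound
      · rw [hK 1 (by simp) (by simp)]; exact h.cap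
      · rw [hK 2 (by simp) (by simp)]; exact h.adj
    refine Run.put_then (n * n) (by simp) (by rfl) (by omega) (by omega)
      (by simp [sqE, val_mul, val_get, val_lit, h₁.size]) fun _ => ?_
    refine Run.put_then (2 ^ n) (by simp) (by rfl) (by omega)
      (Nat.pow_lt_pow_right (by simp) (by omega))
      (by simp [topE, val_get, val_lit, State.set_apply, h₁.size, hpow n le_rfl]) fun _ => ?_
    refine Run.put_then n (by simp) (by rfl) (by omega) (by omega)
      (by simp [val_get, val_lit, State.set_apply, h₁.size]) fun _ => ?_
    refine Run.assign_then (fun _ => 1) (by simp [Expr.val, State.set_apply, h₁.size]) (by omega)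
      (by omega) (by simp) (by rfl) (by rfl) (by rfl) (fun i hi => lit_lt hB2 (by simp))
      (fun i hi => rfl) fun _ => ?_
    refine Run.put_to 0 (by simp) (by rfl) (by omega) (by positivity) rfl fun _ => ?_
    set σ₂ := State.set _ 19 _ _ with hσ₂
    have h19 : σ₂ 19 0 = 0 := by simp [hσ₂, State.set_apply]
    refine ⟨⟨⟨?_, ?_, ?_, ?_⟩, ?_, ?_, ?_⟩, by rw [h19]; exact Nat.zero_le _, fun _ => ?_, Finset.univ,
      ?_, ?_, ⟨∅, by simp, isSimplifiedSolution_univ⟩, ?_⟩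
    · simp [hσ₂, State.set_apply, h₁.size]
    · simp [hσ₂, State.set_apply, h₁.bound]
    · simp [hσ₂, State.set_apply, h₁.cap]
    · intro u v
      rw [← h₁.adj]; simp [hσ₂, State.set_apply]
    · simp [hσ₂, State.set_apply]
    · intro j hj; simp [hσ₂, State.set_apply, hpow j hj]
    · simp [hσ₂, State.set_apply]
    · rw [h19]; simp [pop]
    · simp [hσ₂, State.set_apply]
    · simp [hσ₂, State.set_apply]
    · rw [h19]; simp
  · intro σ₁ _ hI
    have hmore : ∀ σ', MainInv G cap k σ' → (moreE.tt σ' 0 ↔ σ' 19 0 < 2 ^ n) := by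
      intro σ' h'
      simp [moreE, tt_lt, val_get, val_lit, h'.ready.top]
    -- The measure counts the admissible numbers that have not been processed. The number of rounds
    -- is therefore the number of sets with at most `k` elements, and not `2 ^ n`.
    refine (Run.loop (by rfl) (MainInv G cap k) (fun σ' => ((Finset.range (2 ^ n)).filter fun y =>
      pop n y ≤ k ∧ σ' 19 0 ≤ y).card) ?_ hI (le_trans ?_ (card_pop_le n k))).mono le_rfl ?_
    · intro σ' _ hI' hb
      have hx := (hmore σ' hI').1 hb
      refine (run_body hB hI' hx).mono le_rfl ?_
      rintro σ'' - ⟨h1, h2⟩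
      refine ⟨h1, Finset.card_lt_card (Finset.ssubset_iff_of_subset ?_ |>.2 ⟨σ' 19 0, ?_, ?_⟩)⟩
      · intro y hy
        simp only [Finset.mem_filter, Finset.mem_range] at hy ⊢
        exact ⟨hy.1, hy.2.1, by omega⟩
      · simp only [Finset.mem_filter, Finset.mem_range]
        exact ⟨hx, hI'.pop_le hx, le_rfl⟩
      · simp only [Finset.mem_filter, Finset.mem_range, not_and, not_le]
        exact fun _ _ => h2
    · refine Finset.card_le_card fun y hy => ?_
      simp only [Finset.mem_filter] at hy ⊢
      exact ⟨hy.1, hy.2.1⟩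
    · rintro σ' - ⟨hI', hb⟩
      have hx : ¬ σ' 19 0 < 2 ^ n := fun h' => (hmore σ' hI').2 h' hb
      obtain ⟨S, g1, g2, g3, g4⟩ := hI'.best
      refine ⟨S, g1, g3, fun U T hU hT => ?_⟩
      obtain ⟨y, hy, rfl⟩ := exists_bitSet_eq U
      exact g4 y (by omega) (by rwa [card_bitSet] at hU) T hT

end Scheme
end CapDom

namespace CapDom

/-! ## Polynomial bounds -/

/-- The function is bounded by a polynomial. -/
def PolyBdd (f : ℕ → ℕ) : Prop := ∃ p : Polynomial ℕ, ∀ n, f n ≤ p.eval n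

theorem PolyBdd.const (a : ℕ) : PolyBdd fun _ => a := ⟨Polynomial.C a, fun n => by simp⟩

theorem PolyBdd.id : PolyBdd fun n => n := ⟨Polynomial.X, fun n => by simp⟩

theorem PolyBdd.add {f g : ℕ → ℕ} (hf : PolyBdd f) (hg : PolyBdd g) :
    PolyBdd fun n => f n + g n := by
  obtain ⟨p, hp⟩ := hf
  obtain ⟨q, hq⟩ := hg
  exact ⟨p + q, fun n => by rw [Polynomial.eval_add]; exact add_le_add (hp n) (hq n)⟩

theorem PolyBdd.mul {f g : ℕ → ℕ} (hf : PolyBdd f) (hg : PolyBdd g) :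
    PolyBdd fun n => f n * g n := by
  obtain ⟨p, hp⟩ := hf
  obtain ⟨q, hq⟩ := hg
  exact ⟨p * q, fun n => by rw [Polynomial.eval_mul]; exact Nat.mul_le_mul (hp n) (hq n)⟩

theorem eval_le_eval (p : Polynomial ℕ) {a b : ℕ} (h : a ≤ b) : p.eval a ≤ p.eval b := by
  rw [Polynomial.eval_eq_sum, Polynomial.eval_eq_sum]
  exact Finset.sum_le_sum fun i _ =>
    Nat.mul_le_mul_left _ (Nat.pow_le_pow_left h i)

/-! ## The input memory -/

theorem inputMem_apply {n : ℕ} (G : SimpleGraph (Fin n)) (cap : Fin n → ℕ) (a i : ℕ) :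
    inputMem G cap (a, i) = (if 0 = a ∧ 0 = i then n else 0) +
      (∑ v : Fin n, if 1 = a ∧ (v : ℕ) = i then cap v else 0) +
      ∑ u : Fin n, ∑ v : Fin n, if 2 = a ∧ (u : ℕ) * n + v = i then
        (open Classical in if G.Adj u v then 1 else 0) else 0 := by
  simp [inputMem, Finsupp.single_apply]

theorem inputMem_size {n : ℕ} (G : SimpleGraph (Fin n)) (cap : Fin n → ℕ) :
    inputMem G cap (0, 0) = n := by simp [inputMem_apply]

theorem inputMem_cap {n : ℕ} (G : SimpleGraph (Fin n)) (cap : Fin n → ℕ) (v : Fin n) :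
    inputMem G cap (1, v) = cap v := by simp [inputMem_apply, ← Fin.ext_iff]

open Classical in
theorem inputMem_adj {n : ℕ} (G : SimpleGraph (Fin n)) (cap : Fin n → ℕ) (u v : Fin n) :
    inputMem G cap (2, (u : ℕ) * n + v) = if G.Adj u v then 1 else 0 := by
  have key : ∀ u' v' : Fin n, (u' : ℕ) * n + v' = u * n + v ↔ u' = u ∧ v' = v := by
    intro u' v'
    refine ⟨fun h => ?_, by rintro ⟨rfl, rfl⟩; rfl⟩
    have hn : 0 < n := u.pos
    have h1 : ∀ x y : Fin n, ((x : ℕ) * n + y) / n = x := fun x y => by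
      rw [mul_comm, Nat.mul_add_div hn, Nat.div_eq_of_lt y.2, add_zero]
    have h2 : (u' : ℕ) = u := by rw [← h1 u' v', h, h1]
    rw [h2] at h
    exact ⟨Fin.ext h2, Fin.ext (Nat.add_left_cancel h)⟩
  simp [inputMem_apply, key, ite_and]

theorem inputMem_ne_zero {n : ℕ} {G : SimpleGraph (Fin n)} {cap : Fin n → ℕ} {a i : ℕ}
    (h : inputMem G cap (a, i) ≠ 0) : (a = 0 ∧ i = 0) ∨ (a = 1 ∧ ∃ v : Fin n, i = v) ∨
      (a = 2 ∧ ∃ u v : Fin n, i = (u : ℕ) * n + v) := by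
  by_contra hc
  push Not at hc
  refine h ?_
  rw [inputMem_apply, if_neg fun h => hc.1 h.1.symm h.2.symm, Finset.sum_eq_zero fun v _ =>
    if_neg fun h => hc.2.1 h.1.symm v h.2.symm, Finset.sum_eq_zero fun u _ =>
    Finset.sum_eq_zero fun v _ => if_neg fun h => hc.2.2 h.1.symm u v h.2.symm, add_zero, add_zero]

/-- An index bound sufficient for the instances of size `s`. -/
def sizeBound (s : ℕ) : ℕ := s * s * (s * s) * (s * s) + s + 2

theorem good_inputMem {n : ℕ} (G : SimpleGraph (Fin n)) (cap : Fin n → ℕ) :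
    Good (sizeBound (inputSize cap)) (inputMem G cap) := by
  set s := inputSize cap with hs
  have hns : n ≤ s := Nat.le_add_right _ _
  have hss : n * n ≤ s * s * (s * s) * (s * s) := by
    rcases Nat.eq_zero_or_pos s with h | h
    · have : n = 0 := by omega
      simp [this]
    · have h1 : 0 < s * s := Nat.mul_pos h h
      have h2 := Nat.le_mul_of_pos_right (s * s) h1
      have h3 := Nat.le_mul_of_pos_right (s * s * (s * s)) h1
      have h4 := Nat.mul_le_mul hns hns
      omega
  have hB : s + 2 ≤ sizeBound s := by unfold sizeBound; omega
  have hB' := (sizeBound s).lt_two_pow_self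
  intro a i h
  rcases inputMem_ne_zero h with ⟨rfl, rfl⟩ | ⟨rfl, v, rfl⟩ | ⟨rfl, u, v, rfl⟩
  · rw [inputMem_size]; omega
  · rw [inputMem_cap]
    refine ⟨by omega, by have := v.2; omega, (Nat.lt_size_self _).trans_le
      (Nat.pow_le_pow_right (by simp) ?_)⟩
    have := Finset.single_le_sum (f := fun v => Nat.size (cap v)) (fun _ _ => Nat.zero_le _)
      (Finset.mem_univ v)
    have : Nat.size (cap v) ≤ s := this.trans (Nat.le_add_left _ _)
    omega
  · rw [inputMem_adj]
    refine ⟨by omega, ?_, by split_ifs <;> omega⟩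
    have h1 : (u + 1 : ℕ) * n ≤ n * n := Nat.mul_le_mul_right _ u.2
    have := v.2
    rw [add_mul] at h1
    unfold sizeBound
    omega

theorem suffices_sizeBound {n s : ℕ} (h : n ≤ s) : Scheme.Suffices n (sizeBound s) := by
  unfold Scheme.Suffices sizeBound
  gcongr

theorem input_of_update {n : ℕ} (G : SimpleGraph (Fin n)) (cap : Fin n → ℕ) (k : ℕ) :
    Scheme.Input G cap k (view ((inputMem G cap).update (0, 1) k)) := by
  constructor
  · simp [view, mem_update_apply, inputMem_size]
  · simp [view, mem_update_apply]
  · simp [view, mem_update_apply, inputMem_cap]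
  · intro u v
    simp [view, mem_update_apply, inputMem_adj]

theorem inputMemWith_eq_update {n : ℕ} (G : SimpleGraph (Fin n)) (cap : Fin n → ℕ) (k : ℕ) :
    inputMemWith G cap k = (inputMem G cap).update (0, 1) k := by
  ext ⟨a, i⟩
  rw [mem_update_apply, inputMemWith, Finsupp.add_apply, Finsupp.single_apply]
  split_ifs with h1 h2 h2
  · rw [← h1, inputMem_apply]; simp
  · exact absurd h1.symm h2
  · exact absurd h2.symm h1
  · simp

/-! ### The scheme started on the input -/

theorem run_scheme_update {n : ℕ} (G : SimpleGraph (Fin n)) (cap : Fin n → ℕ) {k : ℕ}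
    (hk : k ≤ n) :
    RunM (sizeBound (inputSize cap)) Scheme.schemeP
      (Scheme.schemeTime n (∑ i ∈ Finset.range (k + 1), n.choose i))
      ((inputMem G cap).update (0, 1) k) fun m' =>
        ∃ S : Finset (Fin n), HasOutput m' S ∧ IsSchemeOutput G cap k S := by
  have hns : n ≤ inputSize cap := Nat.le_add_right _ _
  have hB : inputSize cap + 2 ≤ sizeBound (inputSize cap) := by unfold sizeBound; omega
  have hB' := (sizeBound (inputSize cap)).lt_two_pow_self
  refine (Scheme.run_scheme (suffices_sizeBound hns) (input_of_update G cap k) (fun j => ?_) _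
    ((good_inputMem G cap).update (by simp) (by omega) (by omega)) rfl).mono le_rfl ?_
  · have : inputMem G cap (20, j) = 0 := by
      by_contra h
      rcases inputMem_ne_zero h with h | h | h <;> omega
    simp [view, mem_update_apply, this]
  · rintro m' - ⟨S, h1, h2⟩
    exact ⟨S, fun v => by simpa [view] using h1 v, h2⟩

theorem polyBdd_schemeTime :
    PolyBdd fun n => Scheme.startTime n + (n + 1) * (Scheme.moreE.cw + 1 + Scheme.bodyTime n) +
      (Scheme.moreE.cw + 1) := by
  unfold Scheme.startTime Scheme.bodyTime
  simp only [Scheme.evalTime, Scheme.updateTime, Scheme.nextTime, Scheme.popTime, Scheme.powTime,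
    Matching.matchTime, Matching.rootTime, Matching.searchTime, Matching.stepTime,
    Matching.decTime, Matching.scanTime, Matching.mergeTime, Matching.growTime,
    Matching.augmentTime, Matching.freezeTime, Matching.initTime, sumTime, findTime, foldTime,
    assignTime, fillTime, forTime]
  -- All time bounds are built from constants and `n` by sums and products. In the statement the
  -- number of sets is replaced by `n + 1`, since the factor `n.choose k` is split off.
  repeat' first
    | with_reducible exact PolyBdd.const _
    | with_reducible exact PolyBdd.id
    | with_reducible refine PolyBdd.add ?_ ?_
    | with_reducible refine PolyBdd.mul ?_ ?_

/-- If started on the input, the program runs the scheme after a preparation of constant cost. -/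
theorem runsScheme_of_runM {P : Prog} {inp : {n : ℕ} → SimpleGraph (Fin n) → (Fin n → ℕ) → Mem}
    {k : ℕ → ℕ} (hkn : ∀ n, k n ≤ n)
    (hk : ∀ n, ∑ i ∈ Finset.range (k n + 1), n.choose i ≤ (n + 1) * n.choose (k n)) (T : ℕ)
    (h : ∀ (n : ℕ) (G : SimpleGraph (Fin n)) (cap : Fin n → ℕ),
      RunM (sizeBound (inputSize cap)) P
        (T + Scheme.schemeTime n (∑ i ∈ Finset.range (k n + 1), n.choose i)) (inp G cap) fun m' =>
          ∃ S : Finset (Fin n), HasOutput m' S ∧ IsSchemeOutput G cap (k n) S) :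
    RunsScheme P inp k fun n => n.choose (k n) := by
  obtain ⟨q, hq⟩ := (PolyBdd.const T).add polyBdd_schemeTime
  obtain ⟨b, hb⟩ : PolyBdd sizeBound := by
    unfold sizeBound
    repeat' first
      | with_reducible exact PolyBdd.const _
      | with_reducible exact PolyBdd.id
      | with_reducible refine PolyBdd.add ?_ ?_
      | with_reducible refine PolyBdd.mul ?_ ?_
  -- The first summand is the factor for the time, the second bounds the space; their sum serves for
  -- both.
  refine ⟨q * (b + 1) + (80 * b ^ 2 + Polynomial.C P.weight * (b + 1)), fun n G cap => ?_⟩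
  obtain ⟨m', t, s, h1, h2, h3, -, S, h4, h5⟩ := h n G cap
  refine ⟨S, m', t, s, h1, h4, h5, ?_, ?_⟩
  · have hC : 1 ≤ n.choose (k n) := Nat.choose_pos (hkn n)
    have hT : T + Scheme.schemeTime n (∑ i ∈ Finset.range (k n + 1), n.choose i) ≤
        q.eval (inputSize cap) * n.choose (k n) := by
      refine le_trans ?_ (Nat.mul_le_mul_right _
        ((hq n).trans (eval_le_eval q (Nat.le_add_right n _))))
      unfold Scheme.schemeTime
      beta_reduce
      clear hq
      have := Nat.mul_le_mul_right (Scheme.moreE.cw + 1 + Scheme.bodyTime n) (hk n)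
      generalize Scheme.moreE.cw + 1 + Scheme.bodyTime n = x at *
      generalize Scheme.moreE.cw + 1 = y at *
      generalize Scheme.startTime n = z at *
      have h6 := Nat.le_mul_of_pos_right (T + z + y) hC
      calc _ ≤ (T + z + y) + (n + 1) * n.choose (k n) * x := by omega
        _ ≤ (T + z + y) * n.choose (k n) + (n + 1) * n.choose (k n) * x := by omega
        _ = _ := by ring
    simp only [Polynomial.eval_add, Polynomial.eval_mul, Polynomial.eval_one]
    refine h2.trans ?_
    calc _ ≤ q.eval (inputSize cap) * n.choose (k n) * (b.eval (inputSize cap) + 1) :=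
          Nat.mul_le_mul hT (Nat.succ_le_succ (hb _))
      _ = q.eval (inputSize cap) * (b.eval (inputSize cap) + 1) * n.choose (k n) := by ring
      _ ≤ _ := Nat.mul_le_mul_right _ (Nat.le_add_right _ _)
  · have h6 := hb (inputSize cap)
    simp only [Polynomial.eval_add, Polynomial.eval_mul, Polynomial.eval_one, Polynomial.eval_pow,
      Polynomial.eval_C, Polynomial.eval_ofNat]
    refine h3.trans (le_trans ?_ (Nat.le_add_left _ _))
    gcongr

theorem runsScheme_inputMemWith {k : ℕ → ℕ} (hkn : ∀ n, k n ≤ n)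
    (hk : ∀ n, ∑ i ∈ Finset.range (k n + 1), n.choose i ≤ (n + 1) * n.choose (k n)) :
    RunsScheme Scheme.schemeP (fun {n} G cap => inputMemWith G cap (k n)) k
      fun n => n.choose (k n) := by
  refine runsScheme_of_runM hkn hk 0 fun n G cap => ?_
  rw [inputMemWith_eq_update, zero_add]
  exact run_scheme_update G cap (hkn n)

/-- Computing `k n` from `n` and storing it in cell `(0, 1)` turns the plain input into the input
with the bound. The cost is a constant number of units of size `B + 1`. -/
theorem runsScheme_inputMem {k : ℕ → ℕ} (hkn : ∀ n, k n ≤ n)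
    (hk : ∀ n, ∑ i ∈ Finset.range (k n + 1), n.choose i ≤ (n + 1) * n.choose (k n)) {e : Expr}
    (he : ∀ (n : ℕ) (m : Mem), m (0, 0) = n → e.eval m = k n) :
    RunsScheme (.seq (.store 0 (.lit 1) e) Scheme.schemeP) (fun {_} G cap => inputMem G cap) k
      fun n => n.choose (k n) := by
  refine runsScheme_of_runM hkn hk ((Expr.lit 1).cw + e.cw + 1) fun n G cap =>
    RunM.seq ?_
  have h := he n _ (inputMem_size G cap)
  have hns : n ≤ inputSize cap := Nat.le_add_right _ _
  have hB : inputSize cap + 2 ≤ sizeBound (inputSize cap) := by unfold sizeBound; omega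
  have hB' := (sizeBound (inputSize cap)).lt_two_pow_self
  have := hkn n
  refine RunM.store (good_inputMem G cap) (by simp) (by simp only [Expr.eval]; omega)
    (by omega) ?_
  rw [h]
  exact run_scheme_update G cap (hkn n)

end CapDom

namespace CapDom

/-! ## Binomial coefficients near `c n` -/

/-- The integers `k n` are the numbers `c n` rounded in some way. -/
def IsRounding (c : ℝ) (k : ℕ → ℕ) : Prop := ∀ n : ℕ, c * n - 1 < k n ∧ (k n : ℝ) < c * n + 1

section
variable {c : ℝ} {k : ℕ → ℕ}

theorem isRounding_floor (hc : 0 < c) (hk : ∀ n : ℕ, k n = ⌊c * n⌋₊) : IsRounding c k := by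
  intro n
  rw [hk n]
  have h : 0 ≤ c * n := by positivity
  exact ⟨by linarith [Nat.lt_floor_add_one (c * n)], by linarith [Nat.floor_le h]⟩

theorem isRounding_ceil (hc : 0 < c) (hk : ∀ n : ℕ, k n = ⌈c * n⌉₊) : IsRounding c k := by
  intro n
  rw [hk n]
  have h : 0 ≤ c * n := by positivity
  exact ⟨by linarith [Nat.le_ceil (c * n)], Nat.ceil_lt_add_one h⟩

theorem IsRounding.three_mul_lt (h : IsRounding c k) (hc : c < 1 / 3) (n : ℕ) :
    3 * k n < n + 3 := by
  have h1 := (h n).2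
  have h2 : c * n ≤ 1 / 3 * n := by gcongr
  have : (3 * k n : ℝ) < n + 3 := by linarith
  exact_mod_cast this

theorem IsRounding.le (h : IsRounding c k) (hc : c < 1 / 3) (n : ℕ) : k n ≤ n := by
  have := h.three_mul_lt hc n
  omega

theorem choose_le_choose_of_le_half {n i j : ℕ} (hij : i ≤ j) (hj : 2 * j ≤ n) :
    n.choose i ≤ n.choose j := by
  induction j, hij using Nat.le_induction with
  | base => rfl
  | succ j hij ih => exact (ih (by omega)).trans (Nat.choose_le_succ_of_lt_half_left (by omega))

/-- Apart from one degenerate case `k n ≤ n / 2`, so the binomial coefficients increase up to the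
last term. -/
theorem IsRounding.sum_choose_le (h : IsRounding c k) (hc : c < 1 / 3) (n : ℕ) :
    ∑ i ∈ Finset.range (k n + 1), n.choose i ≤ (n + 1) * n.choose (k n) := by
  have h3 := h.three_mul_lt hc n
  by_cases hn : 2 * k n ≤ n
  · calc ∑ i ∈ Finset.range (k n + 1), n.choose i
        ≤ ∑ i ∈ Finset.range (k n + 1), n.choose (k n) := Finset.sum_le_sum fun i hi =>
          choose_le_choose_of_le_half (by simpa [Nat.lt_succ_iff] using hi) hn
      _ = (k n + 1) * n.choose (k n) := by simp
      _ ≤ _ := Nat.mul_le_mul_right _ (by have := h.le hc n; omega)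
  -- From `2 k > n` and `3 k < n + 3` only `n = k = 1` remains, which occurs when `c` is rounded up.
  · obtain rfl : n = 1 := by omega
    have : k 1 = 1 := by omega
    simp [this, Finset.sum_range_succ]

/-! ### The binomial distribution with parameter `c` -/

/-- The probability that a binomially distributed variable takes the value `j`. -/
noncomputable def binomialWeight (c : ℝ) (n j : ℕ) : ℝ := n.choose j * (c ^ j * (1 - c) ^ (n - j))

theorem sum_binomialWeight (c : ℝ) (n : ℕ) :
    ∑ j ∈ Finset.range (n + 1), binomialWeight c n j = 1 := by
  have := add_pow c (1 - c) n
  rw [add_sub_cancel, one_pow] at this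
  rw [this]
  exact Finset.sum_congr rfl fun j _ => by unfold binomialWeight; ring

theorem binomialWeight_pos (hc : 0 < c) (hc1 : c < 1) {n j : ℕ} (h : j ≤ n) :
    0 < binomialWeight c n j := by
  have h1 : 0 < 1 - c := by linarith
  have h2 : (0 : ℝ) < n.choose j := by exact_mod_cast Nat.choose_pos h
  unfold binomialWeight
  positivity

theorem binomialWeight_succ (c : ℝ) {n j : ℕ} (h : j < n) :
    binomialWeight c n (j + 1) * ((j + 1) * (1 - c)) = binomialWeight c n j * ((n - j) * c) := by
  obtain ⟨d, rfl⟩ : ∃ d, n = j + 1 + d := ⟨n - (j + 1), by omega⟩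
  have h1 : ((j + 1 + d).choose (j + 1) : ℝ) * (j + 1) = (j + 1 + d).choose j * (d + 1) := by
    have := Nat.choose_succ_right_eq (j + 1 + d) j
    rw [show j + 1 + d - j = d + 1 by omega] at this
    exact_mod_cast this
  unfold binomialWeight
  rw [show j + 1 + d - (j + 1) = d by omega, show j + 1 + d - j = d + 1 by omega]
  push_cast
  linear_combination c ^ (j + 1) * (1 - c) ^ (d + 1) * h1

/-- The `n + 1` weights sum to one, so the largest is at least `1 / (n + 1)`. It is attained within
distance one of `k n`, and moving to a neighbour loses at most a factor `n / c`. -/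
theorem one_le_mul_binomialWeight (hc : 0 < c) (hc1 : c < 1 / 3) (h : IsRounding c k) (n : ℕ) :
    1 ≤ (n + 1) * ((n / c + 1) * binomialWeight c n (k n)) := by
  obtain ⟨j, hj, hmax⟩ := Finset.exists_max_image (Finset.range (n + 1)) (binomialWeight c n)
    ⟨0, by simp⟩
  simp only [Finset.mem_range, Nat.lt_succ_iff] at hj hmax
  have hsum : 1 ≤ (n + 1) * binomialWeight c n j := by
    refine (sum_binomialWeight c n).symm.le.trans ((Finset.sum_le_card_nsmul _ _
      (binomialWeight c n j) fun i hi => hmax i ?_).trans (by simp))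
    simpa [Nat.lt_succ_iff] using hi
  refine hsum.trans ?_
  gcongr
  have hkn := h.le hc1 n
  have hk0 := binomialWeight_pos hc (by linarith) hkn
  have hj0 := binomialWeight_pos hc (by linarith) hj
  -- Comparing the maximal weight with that of its successor, and below with that of its
  -- predecessor, locates the mode between `(n + 1) c - 1` and `(n + 1) c`.
  have hlow : (n + 1) * c - 1 ≤ j := by
    rcases hj.lt_or_eq with hlt | rfl
    · have h1 := binomialWeight_succ c hlt
      have h2 := hmax (j + 1) hlt
      have h3 : binomialWeight c n j * ((n - j) * c) ≤
          binomialWeight c n j * ((j + 1) * (1 - c)) := by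
        rw [← h1]
        have : 0 ≤ 1 - c := by linarith
        gcongr
      have := le_of_mul_le_mul_left h3 hj0
      linarith
    · nlinarith
  have hhigh : (j : ℝ) ≤ (n + 1) * c := by
    rcases Nat.eq_zero_or_pos j with rfl | hpos
    · push_cast; positivity
    · obtain ⟨i, rfl⟩ := Nat.exists_eq_succ_of_ne_zero hpos.ne'
      have h1 := binomialWeight_succ c (show i < n by omega)
      have h2 := hmax i (by omega)
      have hin : (0 : ℝ) ≤ n - i := by
        rw [sub_nonneg]; exact_mod_cast (by omega : i ≤ n)
      have h3 : binomialWeight c n (i + 1) * ((i + 1) * (1 - c)) ≤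
          binomialWeight c n (i + 1) * ((n - i) * c) := by
        rw [h1]; gcongr
      have := le_of_mul_le_mul_left h3 hj0
      push_cast
      linarith
  have hnc : (0 : ℝ) ≤ n / c := by positivity
  obtain ⟨hk1, hk2⟩ := h n
  have h1 : j ≤ k n + 1 := by
    have : (j : ℝ) < k n + 2 := by linarith
    have : j < k n + 2 := by exact_mod_cast this
    omega
  have h2 : k n ≤ j + 1 := by
    have : (k n : ℝ) < j + 2 := by linarith
    have : k n < j + 2 := by exact_mod_cast this
    omega
  have hnn : (n : ℝ) ≤ n / c := by
    rw [le_div_iff₀ hc]; nlinarith [(Nat.cast_nonneg n : (0 : ℝ) ≤ n)]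
  -- The weight at the mode is at most `n` times the weight one below it, because `c ≤ 1 - c`, and
  -- at most `n / c` times the weight one above it.
  rcases (by omega : j = k n ∨ j = k n + 1 ∨ j + 1 = k n) with hjk | hjk | hjk
  · rw [hjk]; nlinarith
  · have h3 := binomialWeight_succ c (show k n < n by omega)
    rw [← hjk] at h3
    have h4 : binomialWeight c n j * (1 - c) ≤ binomialWeight c n j * ((k n + 1) * (1 - c)) := by
      have : 0 ≤ 1 - c := by linarith
      have : (0 : ℝ) ≤ k n := by positivity
      gcongr
      nlinarith
    have h5 : binomialWeight c n (k n) * ((n - k n) * c) ≤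
        binomialWeight c n (k n) * (n * (1 - c)) := by
      have : (0 : ℝ) ≤ k n := by positivity
      have : (0 : ℝ) ≤ n := by positivity
      gcongr <;> linarith
    have h6 : binomialWeight c n j ≤ binomialWeight c n (k n) * n := by
      refine le_of_mul_le_mul_right ?_ (show 0 < 1 - c by linarith)
      linarith
    nlinarith
  · have h3 := binomialWeight_succ c (show j < n by omega)
    rw [hjk] at h3
    have hnj : (1 : ℝ) ≤ n - j := by
      rw [le_sub_iff_add_le]; exact_mod_cast (by omega : 1 + j ≤ n)
    have h4 : binomialWeight c n j * c ≤ binomialWeight c n j * ((n - j) * c) := by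
      gcongr
      nlinarith
    have h5 : binomialWeight c n (k n) * ((j + 1) * (1 - c)) ≤
        binomialWeight c n (k n) * (n * 1) := by
      have : (0 : ℝ) ≤ n := by positivity
      gcongr <;> linarith
    have h6 : binomialWeight c n j ≤ binomialWeight c n (k n) * (n / c) := by
      rw [mul_div_assoc', le_div_iff₀ hc]
      linarith
    nlinarith

/-- The powers of `c` and `1 - c` in the weight cancel against the entropy term, up to the deviation
of `j` from `c n`. -/
theorem binomialWeight_mul_entropy (hc : 0 < c) (hc1 : c < 1) {n j : ℕ} (hj : j ≤ n) :
    binomialWeight c n j * (1 / (c ^ c * (1 - c) ^ (1 - c))) ^ n =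
      n.choose j * (c / (1 - c)) ^ ((j : ℝ) - c * n) := by
  have h1 : 0 < 1 - c := by linarith
  have h2 : (c ^ c * (1 - c) ^ (1 - c)) ^ n = c ^ (c * n) * (1 - c) ^ ((1 - c) * n) := by
    rw [mul_pow, Real.rpow_mul hc.le, Real.rpow_mul h1.le, Real.rpow_natCast, Real.rpow_natCast]
  rw [one_div, inv_pow, h2, Real.div_rpow hc.le h1.le, Real.rpow_sub hc, Real.rpow_natCast,
    binomialWeight]
  have h3 : (1 - c) ^ ((j : ℝ) - c * n) * (1 - c) ^ (n - j) = (1 - c) ^ ((1 - c) * n) := by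
    rw [← Real.rpow_natCast, ← Real.rpow_add h1, Nat.cast_sub hj]
    congr 1; ring
  rw [← h3]
  have h4 : 0 < c ^ (c * n) := by positivity
  have h5 : 0 < (1 - c) ^ ((j : ℝ) - c * n) := by positivity
  have h6 : 0 < (1 - c) ^ (n - j) := by positivity
  field_simp

/-- Since `k n` differs from `c n` by less than one, the correction factor `r ^ (k n - c n)` lies
between `r` and `1 / r`. One direction then uses that weights are at most one, the other that the
weight at `k n` is at least inverse polynomial. -/
theorem IsRounding.oStarEq (h : IsRounding c k) (hc : 0 < c) (hc1 : c < 1 / 3) :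
    OStarEq (fun n => (n.choose (k n) : ℝ)) fun n => (1 / (c ^ c * (1 - c) ^ (1 - c))) ^ n := by
  have h1c : 0 < 1 - c := by linarith
  set r := c / (1 - c) with hr
  have hr0 : 0 < r := by positivity
  have hr1 : r ≤ 1 := by rw [hr, div_le_one h1c]; linarith
  obtain ⟨A, hA⟩ := exists_nat_ge (max (1 / r) (1 / c))
  have hA1 : 1 / r ≤ A := (le_max_left _ _).trans hA
  have hA2 : 1 / c ≤ A := (le_max_right _ _).trans hA
  refine ⟨Polynomial.C A * ((Polynomial.X + 1) * (Polynomial.C A * Polynomial.X + 1)), fun n => ?_⟩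
  have hp : (((Polynomial.C A * ((Polynomial.X + 1) * (Polynomial.C A * Polynomial.X + 1))).eval n :
      ℕ) : ℝ) = A * ((n + 1) * (A * n + 1)) := by simp
  simp only [hp]
  set g : ℝ := (1 / (c ^ c * (1 - c) ^ (1 - c))) ^ n with hg
  have hg0 : 0 < g := by positivity
  set f : ℝ := (n.choose (k n) : ℝ) with hf
  have hf0 : 0 ≤ f := by positivity
  have hkn := h.le hc1 n
  obtain ⟨hk1, hk2⟩ := h n
  have hkey := binomialWeight_mul_entropy hc (by linarith) hkn
  rw [← hg, ← hf, ← hr] at hkey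
  have hlow : r ≤ r ^ ((k n : ℝ) - c * n) := by
    conv_lhs => rw [← Real.rpow_one r]
    exact Real.rpow_le_rpow_of_exponent_ge hr0 hr1 (by linarith)
  have hhigh : r ^ ((k n : ℝ) - c * n) ≤ 1 / r := by
    rw [one_div, ← Real.rpow_neg_one]
    exact Real.rpow_le_rpow_of_exponent_ge hr0 hr1 (by linarith)
  have hw : binomialWeight c n (k n) ≤ 1 := by
    rw [← sum_binomialWeight c n]
    exact Finset.single_le_sum (f := binomialWeight c n) (fun i hi => (binomialWeight_pos hc
      (by linarith) (by simpa [Nat.lt_succ_iff] using hi)).le)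
      (by simpa [Nat.lt_succ_iff] using hkn)
  have hn0 : (0 : ℝ) ≤ n := by positivity
  have hA0 : (0 : ℝ) ≤ A := by positivity
  constructor
  · have h1 : f * r ≤ g := by
      calc f * r ≤ f * r ^ ((k n : ℝ) - c * n) := by gcongr
        _ = binomialWeight c n (k n) * g := hkey.symm
        _ ≤ 1 * g := by gcongr
        _ = g := one_mul g
    calc f = 1 / r * (f * r) := by field_simp
      _ ≤ A * g := by gcongr
      _ ≤ A * ((n + 1) * (A * n + 1)) * g := by
        gcongr
        refine le_mul_of_one_le_right hA0 ?_
        have : 0 ≤ A * (n : ℝ) := by positivity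
        nlinarith
  · have hw0 := (binomialWeight_pos hc (by linarith) hkn).le
    calc g = 1 * g := (one_mul g).symm
      _ ≤ (n + 1) * ((n / c + 1) * binomialWeight c n (k n)) * g := by
        gcongr; exact one_le_mul_binomialWeight hc hc1 h n
      _ = (n + 1) * (1 / c * n + 1) * (binomialWeight c n (k n) * g) := by ring
      _ = (n + 1) * (1 / c * n + 1) * (f * r ^ ((k n : ℝ) - c * n)) := by rw [hkey]
      _ ≤ (n + 1) * (A * n + 1) * (f * A) := by
        gcongr
        exact hhigh.trans hA1
      _ = A * ((n + 1) * (A * n + 1)) * f := by ring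

end

/-! ### Computing the rounded values for rational `c` -/

theorem rat_mul_eq_div {c : ℚ} (hc : 0 < c) (n : ℕ) :
    (c : ℝ) * n = ((c.num.toNat * n : ℕ) : ℝ) / (c.den : ℝ) := by
  have h : (c : ℝ) = (c.num.toNat : ℝ) / c.den := by
    rw [Rat.cast_def]
    congr 1
    have := Int.toNat_of_nonneg (Rat.num_pos.2 hc).le
    exact_mod_cast this.symm
  rw [h]
  push_cast
  ring

theorem eval_floor {c : ℚ} (hc : 0 < c) (n : ℕ) (m : Mem) (h : m (0, 0) = n) :
    (Expr.div (.mul (.lit c.num.toNat) (.get 0 (.lit 0))) (.lit c.den)).eval m =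
      ⌊(c : ℝ) * n⌋₊ := by
  rw [rat_mul_eq_div hc, Nat.floor_div_eq_div]
  simp [Expr.eval, h]

/-- Integer division by the denominator rounds up once the denominator minus one has been added to
the numerator. -/
theorem eval_ceil {c : ℚ} (hc : 0 < c) (n : ℕ) (m : Mem) (h : m (0, 0) = n) :
    (Expr.div (.add (.mul (.lit c.num.toNat) (.get 0 (.lit 0))) (.lit (c.den - 1)))
      (.lit c.den)).eval m = ⌈(c : ℝ) * n⌉₊ := by
  have hd : 0 < c.den := c.pos
  refine eq_of_forall_ge_iff fun x => ?_
  rw [Nat.ceil_le, rat_mul_eq_div hc, div_le_iff₀ (by exact_mod_cast hd)]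
  simp only [Expr.eval, h]
  rw [← Nat.lt_succ_iff, Nat.div_lt_iff_lt_mul hd, Nat.succ_mul]
  norm_cast
  omega

end CapDom

namespace CapDom

/-! ## The approximation ratio -/

theorem exists_isCapDominating_card_eq_optimum {V : Type*} [Fintype V] (G : SimpleGraph V)
    (cap : V → ℕ) :
    ∃ S, IsCapDominating G cap S ∧ S.card = optimum G cap :=
  Nat.sInf_mem (s := {m : ℕ | ∃ S : Finset V, IsCapDominating G cap S ∧ S.card = m})
    ⟨_, _, isCapDominating_univ G cap, rfl⟩

section
variable {V : Type*} [Fintype V] [DecidableEq V] {G : SimpleGraph V} {cap : V → ℕ}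

/-- The vertices outside `S` that `g` maps to `w`. -/
def fiber (S : Finset V) (g : V → V) (w : V) : Finset V :=
  Finset.univ.filter fun v => v ∉ S ∧ g v = w

theorem mem_fiber {S : Finset V} {g : V → V} {v w : V} : v ∈ fiber S g w ↔ v ∉ S ∧ g v = w := by
  simp [fiber]

theorem IsCapDominating.exists_map {S : Finset V} (h : IsCapDominating G cap S) :
    ∃ g : V → V, (∀ v ∉ S, g v ∈ S ∧ G.Adj v (g v)) ∧ ∀ w ∈ S, (fiber S g w).card ≤ cap w := by
  obtain ⟨f, hadj, hcap⟩ := h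
  refine ⟨fun v => if hv : v ∉ S then f ⟨v, hv⟩ else v, fun v hv => ?_, fun w hw => ?_⟩
  · beta_reduce
    rw [dif_pos hv]
    exact ⟨(f ⟨v, hv⟩).2, hadj ⟨v, hv⟩⟩
  · refine le_trans (le_of_eq ?_) (hcap ⟨w, hw⟩)
    rw [← Set.ncard_image_of_injective _ Subtype.val_injective, ← Set.ncard_coe_finset]
    congr 1
    ext v
    simp only [Finset.mem_coe, mem_fiber, Set.mem_image, Set.mem_preimage, Set.mem_singleton_iff,
      Subtype.exists]
    constructor
    · rintro ⟨hv, h⟩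
      rw [dif_pos hv] at h
      exact ⟨v, hv, Subtype.ext h, rfl⟩
    · rintro ⟨v', hv, h, rfl⟩
      exact ⟨hv, by rw [dif_pos hv, h]⟩

theorem isSimplifiedSolution_of_map {U T : Finset V} {g : V → V} (hU : U ⊆ T)
    (hg : ∀ v ∉ T, g v ∈ T ∧ G.Adj v (g v)) (hcap : ∀ w ∈ T, (fiber T g w).card ≤ cap w)
    (hone : ∀ w ∈ T, w ∉ U → (fiber T g w).card ≤ 1) : IsSimplifiedSolution G cap U T := by
  have key : ∀ w : {v : V // v ∈ T},
      ((fun v : {v : V // v ∉ T} => (⟨g v, (hg v v.2).1⟩ : {v : V // v ∈ T})) ⁻¹' {w}).ncard =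
        (fiber T g w).card := by
    intro w
    rw [← Set.ncard_image_of_injective _ Subtype.val_injective, ← Set.ncard_coe_finset]
    congr 1
    ext v
    simp only [Finset.mem_coe, mem_fiber, Set.mem_image, Set.mem_preimage, Set.mem_singleton_iff,
      Subtype.exists, Subtype.ext_iff]
    constructor
    · rintro ⟨v', hv, h, rfl⟩; exact ⟨hv, h⟩
    · rintro ⟨hv, h⟩; exact ⟨v, hv, h, rfl⟩
  exact ⟨hU, fun v => ⟨g v, (hg v v.2).1⟩, ⟨fun v => (hg v v.2).2,
    fun w => (key w).le.trans (hcap w w.2)⟩, fun w hw => (key w).le.trans (hone w w.2 hw)⟩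

/-- A dominating set becomes a simplified solution if all but one preimage of every vertex
outside `U` is added. -/
theorem exists_isSimplifiedSolution_card_le {S U : Finset V} {g : V → V}
    (hg : ∀ v ∉ S, g v ∈ S ∧ G.Adj v (g v)) (hcap : ∀ w ∈ S, (fiber S g w).card ≤ cap w)
    (hU : U ⊆ S) :
    ∃ T, IsSimplifiedSolution G cap U T ∧
      T.card ≤ S.card + ∑ w ∈ S \ U, ((fiber S g w).card - 1) := by
  -- The preimage `r w` is the one that stays outside the new solution; all other preimages of `w ∉
  -- U` are collected in `E`.
  have hr : ∀ w, ∃ r, (fiber S g w).Nonempty → r ∈ fiber S g w := fun w => by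
    by_cases h : (fiber S g w).Nonempty
    · exact ⟨h.choose, fun _ => h.choose_spec⟩
    · exact ⟨w, fun h' => absurd h' h⟩
  choose r hr using hr
  set E := (S \ U).biUnion fun w => (fiber S g w).erase (r w) with hE
  have hsub : ∀ w, fiber (S ∪ E) g w ⊆ fiber S g w := fun w v hv => by
    rw [mem_fiber, Finset.mem_union, not_or] at hv
    exact mem_fiber.2 ⟨hv.1.1, hv.2⟩
  -- The vertices of `E` come from outside `S` and so have no preimages; adding them makes no demand
  -- on their capacities.
  have hEg : ∀ w ∉ S, fiber S g w = ∅ := fun w hw => by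
    refine Finset.eq_empty_of_forall_notMem fun v hv => ?_
    rw [mem_fiber] at hv
    exact hw (hv.2 ▸ (hg v hv.1).1)
  refine ⟨S ∪ E, isSimplifiedSolution_of_map (g := g) (hU.trans Finset.subset_union_left)
    (fun v hv => ?_) (fun w hw => ?_) (fun w hw hwU => ?_), ?_⟩
  · rw [Finset.mem_union, not_or] at hv
    exact ⟨Finset.mem_union_left _ (hg v hv.1).1, (hg v hv.1).2⟩
  · refine (Finset.card_le_card (hsub w)).trans ?_
    by_cases hwS : w ∈ S
    · exact hcap w hwS
    · simp [hEg w hwS]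
  · refine (Finset.card_le_card (t := {r w}) fun v hv => ?_).trans_eq (Finset.card_singleton _)
    have hv' := hsub w hv
    rw [mem_fiber, Finset.mem_union, not_or] at hv
    rw [Finset.mem_singleton]
    by_contra hne
    refine hv.1.2 (Finset.mem_biUnion.2 ⟨w, ?_, Finset.mem_erase.2 ⟨hne, hv'⟩⟩)
    exact Finset.mem_sdiff.2 ⟨hv.2 ▸ (hg v hv.1.1).1, hwU⟩
  · refine (Finset.card_union_le _ _).trans
      (Nat.add_le_add_left (Finset.card_biUnion_le.trans ?_) _)
    refine Finset.sum_le_sum fun w _ => ?_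
    by_cases h : (fiber S g w).Nonempty
    · rw [Finset.card_erase_of_mem (hr w h)]
    · rw [Finset.not_nonempty_iff_eq_empty.1 h]; simp

/-- Averaging: take the elements with the largest values one after the other. Removing a largest
element never raises the mean of the remaining ones. -/
theorem exists_subset_card_mul_sum_le {α : Type*} [DecidableEq α] (Z : Finset α) (a : α → ℕ)
    {k : ℕ} (hk : k ≤ Z.card) :
    ∃ U ⊆ Z, U.card = k ∧ Z.card * ∑ w ∈ Z \ U, a w ≤ (Z.card - k) * ∑ w ∈ Z, a w := by
  induction k with
  | zero => exact ⟨∅, by simp, rfl, by simp⟩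
  | succ k ih =>
    obtain ⟨U, hU, hUk, h⟩ := ih (by omega)
    have hcard : (Z \ U).card = Z.card - k := by rw [Finset.card_sdiff_of_subset hU, hUk]
    obtain ⟨w, hw, hmax⟩ := Finset.exists_max_image (Z \ U) a (Finset.card_pos.1 (by omega))
    obtain ⟨hwZ, hwU⟩ := Finset.mem_sdiff.1 hw
    refine ⟨insert w U, Finset.insert_subset hwZ hU, by rw [Finset.card_insert_of_notMem hwU, hUk],
      ?_⟩
    have h1 := Finset.sum_le_card_nsmul _ _ _ hmax
    rw [hcard, smul_eq_mul] at h1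
    have h2 : Z \ insert w U = (Z \ U).erase w := by
      ext; simp only [Finset.mem_sdiff, Finset.mem_insert, Finset.mem_erase]; tauto
    have h3 := Finset.add_sum_erase _ a hw
    rw [h2]
    obtain ⟨d, hd⟩ : ∃ d, Z.card - k = d + 1 := ⟨Z.card - k - 1, by omega⟩
    rw [show Z.card - (k + 1) = d by omega]
    rw [hd] at h h1
    rw [← h3] at h h1
    refine Nat.le_of_mul_le_mul_left ?_ (Nat.succ_pos d)
    generalize ∑ w ∈ (Z \ U).erase w, a w = x at *
    generalize ∑ w ∈ Z, a w = y at *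
    have h4 : x ≤ d * a w := by linarith
    calc (d + 1) * (Z.card * x) = Z.card * (d * x + x) := by ring
      _ ≤ Z.card * (d * x + d * a w) := by gcongr
      _ = d * (Z.card * (a w + x)) := by ring
      _ ≤ d * ((d + 1) * y) := by gcongr
      _ = (d + 1) * (d * y) := by ring

/-- The size of a set returned by the scheme, in terms of the number `p` of vertices of an optimal
solution that dominate at least two vertices. -/
theorem IsSchemeOutput.card_le {k : ℕ} {S : Finset V} (h : IsSchemeOutput G cap k S) :
    ∃ p, p ≤ optimum G cap ∧ 2 * p + optimum G cap ≤ Fintype.card V ∧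
      (p ≤ k → S.card ≤ optimum G cap) ∧
      (k ≤ p → ∃ L, S.card ≤ optimum G cap + L ∧
        p * L ≤ (p - k) * (Fintype.card V - optimum G cap - p)) := by
  obtain ⟨S₀, h₀, hopt⟩ := exists_isCapDominating_card_eq_optimum G cap
  obtain ⟨g, hg, hcap⟩ := h₀.exists_map
  set d : V → ℕ := fun w => (fiber S₀ g w).card with hd
  set Z := S₀.filter fun w => 2 ≤ d w with hZ
  have hZS : Z ⊆ S₀ := Finset.filter_subset _ _
  have hsum : ∑ w ∈ Z, d w + optimum G cap ≤ Fintype.card V := by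
    have h1 : ∑ w ∈ Z, d w ≤ S₀ᶜ.card := by
      have hdisj : (Z : Set V).PairwiseDisjoint (fiber S₀ g) := fun a _ b _ hab =>
        Finset.disjoint_left.2 fun v hv hv' =>
          hab ((mem_fiber.1 hv).2.symm.trans (mem_fiber.1 hv').2)
      rw [← Finset.card_biUnion hdisj]
      refine Finset.card_le_card fun v hv => ?_
      obtain ⟨w, -, hw⟩ := Finset.mem_biUnion.1 hv
      exact Finset.mem_compl.2 (mem_fiber.1 hw).1
    have := Finset.card_le_univ S₀
    rw [Finset.card_compl] at h1
    omega
  have htwo : 2 * Z.card ≤ ∑ w ∈ Z, d w := by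
    have := Finset.card_nsmul_le_sum Z d 2 fun w hw => (Finset.mem_filter.1 hw).2
    rwa [smul_eq_mul, mul_comm] at this
  have hexcess : ∑ w ∈ Z, (d w - 1) + Z.card = ∑ w ∈ Z, d w := by
    rw [Finset.card_eq_sum_ones, ← Finset.sum_add_distrib]
    refine Finset.sum_congr rfl fun w hw => ?_
    have := (Finset.mem_filter.1 hw).2
    omega
  have hsol : ∀ U ⊆ Z, U.card ≤ k → S.card ≤ optimum G cap + ∑ w ∈ Z \ U, (d w - 1) := by
    intro U hU hUk
    obtain ⟨T, hT, hTc⟩ := exists_isSimplifiedSolution_card_le hg hcap (hU.trans hZS)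
    refine (h.2 U T hUk hT).trans (hTc.trans ?_)
    rw [hopt]
    -- Vertices of the optimal solution outside `Z` have at most one preimage and cost nothing.
    refine Nat.add_le_add_left (le_of_eq (Finset.sum_subset
      (Finset.sdiff_subset_sdiff hZS le_rfl) fun w hw hw' => ?_).symm) _
    rw [Finset.mem_sdiff] at hw hw'
    have : ¬ 2 ≤ d w := fun h2 => hw' ⟨Finset.mem_filter.2 ⟨hw.1, h2⟩, hw.2⟩
    show d w - 1 = 0
    omega
  refine ⟨Z.card, hopt ▸ Finset.card_le_card hZS, by omega, fun hk => ?_, fun hk => ?_⟩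
  · simpa using hsol Z le_rfl hk
  · obtain ⟨U, hU, hUk, hle⟩ := exists_subset_card_mul_sum_le Z (fun w => d w - 1) hk
    exact ⟨_, hsol U hU hUk.le, hle.trans (Nat.mul_le_mul_left _ (by omega))⟩

end

/-! ### Optimizing the ratio -/

/-- The bound on the approximation ratio is at least one and dominates the loss of the scheme. -/
structure IsRatio (c R : ℝ) : Prop where
  one_le : 1 ≤ R
  le : ∀ n p : ℝ, 0 < p → 3 * p ≤ n → (p - c * n) * (n - 2 * p) ≤ (R - 1) * p ^ 2

/-- Completing the square: after multiplication by `4 c` the two sides differ by exactly `(2 c n -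
(1 + 2 c) p) ^ 2`. This holds for every positive `c`, but the extremal `n / p` is compatible with `3
p ≤ n` only for `c ≤ 1 / 4`. -/
theorem isRatio_of_pos {c : ℝ} (hc : 0 < c) : IsRatio c (1 / (4 * c) + c) := by
  have hR : (1 / (4 * c) + c) * (4 * c) = 1 + 4 * c ^ 2 := by field_simp
  constructor
  · refine le_of_mul_le_mul_right ?_ (show 0 < 4 * c by linarith)
    nlinarith [sq_nonneg (1 - 2 * c)]
  · intro n p hp hn
    refine le_of_mul_le_mul_right ?_ (show 0 < 4 * c by linarith)
    have : (1 / (4 * c) + c - 1) * p ^ 2 * (4 * c) = (1 + 4 * c ^ 2 - 4 * c) * p ^ 2 := by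
      linear_combination p ^ 2 * hR
    rw [this]
    nlinarith [sq_nonneg (2 * c * n - (1 + 2 * c) * p)]

/-- The difference of the two sides factors as `(n - 3 p) (c n - (1 - c) p)`. The second factor is
nonnegative because `c n ≥ 3 c p` and `4 c ≥ 1`; equality holds at `n = 3 p`. -/
theorem isRatio_of_ge {c : ℝ} (hc : 1 / 4 ≤ c) (hc1 : c < 1 / 3) : IsRatio c (2 - 3 * c) := by
  refine ⟨by linarith, fun n p hp hn => ?_⟩
  have h1 : 0 ≤ c * n - (1 - c) * p := by nlinarith
  nlinarith [mul_nonneg (sub_nonneg.2 hn) h1]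

/-- The parameter `δ` bounds how far `k` falls short of `c n`. The shortfall costs at most `δ (n - m
- p) / p`, and `p ≥ k + 1 > c n` turns this into an additive constant. -/
theorem IsSchemeOutput.card_le_of_isRatio {V : Type*} [Fintype V] [DecidableEq V]
    {G : SimpleGraph V} {cap : V → ℕ} {k : ℕ} {S : Finset V} (h : IsSchemeOutput G cap k S)
    {c R δ : ℝ} (hc : 0 < c) (hc1 : c < 1 / 3) (hR : IsRatio c R) (hδ : 0 ≤ δ)
    (hk : c * Fintype.card V - δ ≤ k) (hk' : c * Fintype.card V < k + 1) :
    (S.card : ℝ) ≤ R * optimum G cap + δ * (1 / c - 2) := by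
  obtain ⟨p, hpm, hpn, h1, h2⟩ := h.card_le
  have hc2 : 0 ≤ 1 / c - 2 := by
    rw [sub_nonneg, le_div_iff₀ hc]; linarith
  have hm0 : (0 : ℝ) ≤ optimum G cap := by positivity
  rcases le_or_gt p k with hpk | hpk
  · have h3 : (S.card : ℝ) ≤ optimum G cap := by exact_mod_cast h1 hpk
    nlinarith [hR.one_le, mul_nonneg hδ hc2]
  · obtain ⟨L, hL, hpL⟩ := h2 hpk.le
    have hp0 : (0 : ℝ) < p := by exact_mod_cast (Nat.zero_le k).trans_lt hpk
    have hkp : (k : ℝ) + 1 ≤ p := by exact_mod_cast hpk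
    have hpm' : (p : ℝ) ≤ optimum G cap := by exact_mod_cast hpm
    have hpn' : 2 * (p : ℝ) + optimum G cap ≤ Fintype.card V := by exact_mod_cast hpn
    have hL' : (S.card : ℝ) ≤ optimum G cap + L := by exact_mod_cast hL
    have hpL' : (p : ℝ) * L ≤ (p - k) * (Fintype.card V - optimum G cap - p) := by
      have := (Nat.cast_le (α := ℝ)).2 hpL
      rwa [Nat.cast_mul, Nat.cast_mul, Nat.cast_sub hpk.le, Nat.cast_sub (by omega),
        Nat.cast_sub (by omega)] at this
    have hr := hR.le (Fintype.card V) p hp0 (by linarith)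
    have hr1 := hR.one_le
    generalize (optimum G cap : ℝ) = m at *
    generalize (Fintype.card V : ℝ) = n at *
    have h3 : n - m - p ≤ p * (1 / c - 2) := by
      have : n ≤ p * (1 / c) := by
        rw [mul_one_div, le_div_iff₀ hc]; linarith
      linarith
    -- First `k` is replaced by `c n - δ`; then `p ≤ m` replaces `n - m - p` by `n - 2 p` in the
    -- main term, whose factor `p - c n` is positive.
    have h4 : (p - k) * (n - m - p) ≤ (p - c * n) * (n - 2 * p) + δ * (p * (1 / c - 2)) := by
      have h5 : (p - k) * (n - m - p) ≤ (p - c * n + δ) * (n - m - p) := by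
        gcongr <;> linarith
      have h6 : (p - c * n) * (n - m - p) ≤ (p - c * n) * (n - 2 * p) :=
        mul_le_mul_of_nonneg_left (by linarith) (by linarith)
      have h7 : δ * (n - m - p) ≤ δ * (p * (1 / c - 2)) := by gcongr
      linarith
    -- Here `1 ≤ R` is needed: the loss is measured against `p`, which is at most the optimum.
    have h8 : (R - 1) * p ^ 2 ≤ (R - 1) * (p * m) := by
      rw [pow_two]
      gcongr
    have h9 : (L : ℝ) ≤ (R - 1) * m + δ * (1 / c - 2) := by
      refine le_of_mul_le_mul_left ?_ hp0
      linarith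
    linarith

end CapDom

theorem mainTheorem3 (c : ℝ) (hc0 : 0 < c) (hc1 : c < 1 / 3) :
    -- time and space, with `c n` rounded down or up
    (∀ k : ℕ → ℕ, ((∀ n, k n = ⌊c * n⌋₊) ∨ (∀ n, k n = ⌈c * n⌉₊)) →
      -- for every real `c`, the integer `k n` being supplied with the input
      (∃ P : CapDom.Prog,
        CapDom.RunsScheme P (fun {n} G cap => CapDom.inputMemWith G cap (k n)) k
          (fun n => n.choose (k n))) ∧
      -- for rational `c`, the program computes `k n` by itself
      (c ∈ Set.range ((↑) : ℚ → ℝ) →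
        ∃ P : CapDom.Prog,
          CapDom.RunsScheme P (fun {_} G cap => CapDom.inputMem G cap) k
            (fun n => n.choose (k n))) ∧
      CapDom.OStarEq (fun n => (n.choose (k n) : ℝ))
        (fun n => (1 / (c ^ c * (1 - c) ^ (1 - c))) ^ n)) ∧
    -- the approximation ratio, with `c n` rounded up
    (∀ (n : ℕ) (G : SimpleGraph (Fin n)) (cap : Fin n → ℕ) (S : Finset (Fin n)),
      CapDom.IsSchemeOutput G cap ⌈c * n⌉₊ S →
        (c ≤ 1 / 4 → (S.card : ℝ) ≤ (1 / (4 * c) + c) * CapDom.optimum G cap) ∧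
        (1 / 4 ≤ c → (S.card : ℝ) ≤ (2 - 3 * c) * CapDom.optimum G cap)) ∧
    -- the same with `c n` rounded down, up to an additive constant
    (∀ (n : ℕ) (G : SimpleGraph (Fin n)) (cap : Fin n → ℕ) (S : Finset (Fin n)),
      CapDom.IsSchemeOutput G cap ⌊c * n⌋₊ S →
        (c ≤ 1 / 4 →
          (S.card : ℝ) ≤ (1 / (4 * c) + c) * CapDom.optimum G cap + (1 / c - 2)) ∧
        (1 / 4 ≤ c →
          (S.card : ℝ) ≤ (2 - 3 * c) * CapDom.optimum G cap + (1 / c - 2))) := by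
  refine ⟨fun k hk => ?_, fun n G cap S hS => ?_, fun n G cap S hS => ?_⟩
  · have hr : CapDom.IsRounding c k :=
      hk.elim (CapDom.isRounding_floor hc0) (CapDom.isRounding_ceil hc0)
    refine ⟨⟨_, CapDom.runsScheme_inputMemWith (hr.le hc1) (hr.sum_choose_le hc1)⟩, ?_,
      hr.oStarEq hc0 hc1⟩
    rintro ⟨q, rfl⟩
    have hq : 0 < q := by exact_mod_cast hc0
    rcases hk with hk | hk
    · exact ⟨_, CapDom.runsScheme_inputMem (hr.le hc1) (hr.sum_choose_le hc1) fun n m h =>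
        (CapDom.eval_floor hq n m h).trans (hk n).symm⟩
    · exact ⟨_, CapDom.runsScheme_inputMem (hr.le hc1) (hr.sum_choose_le hc1) fun n m h =>
        (CapDom.eval_ceil hq n m h).trans (hk n).symm⟩
  -- Rounding up leaves no shortfall, so `δ = 0`; for rounding down below, `δ = 1`.
  · have key : ∀ R, CapDom.IsRatio c R → (S.card : ℝ) ≤ R * CapDom.optimum G cap := fun R hR => by
      have h := Nat.le_ceil (c * n)
      simpa using hS.card_le_of_isRatio hc0 hc1 hR le_rfl
        (by rw [Fintype.card_fin]; linarith) (by rw [Fintype.card_fin]; linarith)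
    exact ⟨fun _ => key _ (CapDom.isRatio_of_pos hc0), fun h => key _ (CapDom.isRatio_of_ge h hc1)⟩
  · have key : ∀ R, CapDom.IsRatio c R →
        (S.card : ℝ) ≤ R * CapDom.optimum G cap + (1 / c - 2) := fun R hR => by
      have h := Nat.lt_floor_add_one (c * n)
      simpa using hS.card_le_of_isRatio hc0 hc1 hR zero_le_one
        (by rw [Fintype.card_fin]; linarith) (by rw [Fintype.card_fin]; linarith)
    exact ⟨fun _ => key _ (CapDom.isRatio_of_pos hc0), fun h => key _ (CapDom.isRatio_of_ge h hc1)⟩
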